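/- Let $B\ge 4$ be a power of $2$ (the branching factor, a constant). A *dynamic quantum B+ tree* stores a finite set $D$ of key-record pairs (keys and records from linearly ordered sets, pairs ordered by key and, among equal keys, by record) as follows. *Structure.* A weight-balanced B+ tree of height $i$ has all leaves on the same level, at most $B$ pairs per leaf, at most $B$ children per internal node with sorted, non-overlapping routing keys (the remaining slots are dummies), and every non-root node of height $h$ has weight (number of pairs below it) between $\frac14B^{h+1}$ and $B^{h+1}$; an internal root has at least two children, and a leaf that is a root is non-empty. The structure consists of a sorted list of fewer than $B$ pairs; forests $F_0,F_1,\dots$, where $F_i$ contains at most $B-1$ weight-balanced B+ trees of height $i$; for every node of these trees with ID $u$ and each $j<B$, the ID of its $j$-th child (the ID $u$ itself for a leaf) is stored at address $uB+j$ of a hierarchy QRAM, and the routing key of its $j$-th child (the $j$-th pair for a leaf) is stored at address $uB+j$ of a data QRAM; and two classical auxiliary B+ trees, $\mathcal T_0$ mapping each pair to an ID (assigned in ascending order of insertion) and $\mathcal T_1$, with lazy range assignment, mapping each ID to the forest (or the sorted list) containing the pair. *Insertion* of a pair (no effect if it is in $D$): insert it into $\mathcal T_0$, $\mathcal T_1$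 and the sorted list; when the list reaches length $B$, turn it into a leaf added to $F_0$; whenever $F_i$ has $B$ trees, merge them, by merging their sorted contents and building a new tree with evenly distributed weights, into one tree of height $i+1$ added to $F_{i+1}$, and update $\mathcal T_1$ by one range assignment. *Deletion* of a pair (no effect if it is not in $D$): find its forest by point queries in $\mathcal T_0$ and $\mathcal T_1$ and delete it from these; if it is in the sorted list, remove it there; otherwise find its tree in $F_i$ and its leaf by classical search and replace it by a dummy. Then, from the leaf upwards, an imbalanced non-root ancestor borrows a child from an adjacent sibling if that sibling stays balanced; else it is merged directly with that sibling if the two have at most $B$ children together; else the subtrees below the two are rebuilt into one. Finally, if the root is an internal node with only one child left, it borrows a child with a non-overlapping routing key from the root of another tree of $F_i$ that has at least three children; if there is no such child but there is another tree in $F_i$, the two trees are merged (directly at the roots if their routing keys do not overlap and they have at most $B$ children together, else by rebuilding into one tree, or into two trees of equal weight if the pairs exceed the capacity $B^{i+1}$); if $F_i$ has no other tree, the root is removed, the tree is downgraded from $F_i$ to $F_{i-1}$, $\mathcal T_1$ is updated by one range assignment, and $F_{i-1}$ is merged if it has $B$ trees. An empty leaf in $F_0$ is dropped. *Cost* is the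 number of elementary steps: reading, comparing or writing one entry of a node or list, each QRAM store operation, and each creation of a node ID cost $O(1)$; every created or changed node is charged for its $2B$ store operations. **Lemma.** The amortized cost of an insertion or a deletion in a dynamic quantum B+ tree is $O(\log_B N)$, where $N$ is the number of pairs stored. Precisely: for every power of two $B\ge4$ there is a constant $C$ (depending on $B$ only) such that for all linearly ordered sets of keys and of records and every finite sequence of $m$ insertions and deletions, in any order, executed on the initially empty structure, (a) the resulting structure (its sorted list and forests) has the form described above and holds exactly the pairs of the resulting dataset, each once; and (b) the total cost of the sequence is at most $$C\sum_{t=1}^{m}\log_B\max(2,N_t),$$ where $N_t$ is the number of pairs in the dataset just before the $t$-th operation. -/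

import Mathlib

/-!
The dynamic quantum B+ tree as an explicit program with a step counter.  The type `α` is the type of
key-record pairs, ordered by key (and by record among equal keys); it is instantiated with
`K ×ₗ R` in the theorem.  The branching factor is `B`.
-/

namespace QBTree

/-! ## Auxiliary classical B+ trees with lazy range assignment -/

/-- A value together with the number of elementary steps spent on computing it. -/
structure Timed (β : Type) where
  ret : β
  time : ℕ

instance : Monad Timed where
  pure b := ⟨b, 0⟩
  bind x f := ⟨(f x.ret).ret, x.time + (f x.ret).time⟩

/-- Spend `n` steps. -/
def Timed.tick (n : ℕ) : Timed Unit := ⟨(), n⟩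

section Auxiliary

variable {κ : Type}

/-- What stands behind a key in a node of height `h` of an auxiliary B+ tree.  In a leaf (`h = 0`)
it is the value of the key.  In a node of height `h + 1` it is a child, that is, a node of height
`h`, together with a pending (lazy) assignment to all values below that child. -/
def Payload (κ : Type) : ℕ → Type
  | 0 => ℕ
  | h + 1 => Option ℕ × List (κ × Payload κ h)

/-- The contents of a node of height `h`.  The key of an entry of an internal node is the least key
below the corresponding child. -/
abbrev Entries (κ : Type) (h : ℕ) : Type := List (κ × Payload κ h)

/-- An auxiliary B+ tree. -/
structure AuxTree (κ : Type) where
  height : ℕ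
  root : Entries κ height

/-- Assign `v` to everything below an entry, lazily. -/
def assign (v : ℕ) : (h : ℕ) → Payload κ h → Payload κ h
  | 0, _ => v
  | _ + 1, p => (some v, p.2)

/-- Read a child, pushing its pending assignment to its entries. -/
def pushDown {h : ℕ} (p : Payload κ (h + 1)) : Timed (Entries κ h) :=
  let p' : Option ℕ × Entries κ h := p
  ⟨match p'.1 with
    | none => p'.2
    | some v => p'.2.map fun e => (e.1, assign v h e.2),
   p'.2.length + 1⟩

/-- Split the entries of an internal node around the entry below which `k` belongs: the last entry
whose key is at most `k`, or the first entry if there is none. -/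
def route [LinearOrder κ] {β : Type} (k : κ) :
    List (κ × β) → Option (List (κ × β) × (κ × β) × List (κ × β))
  | [] => none
  | [e] => some ([], e, [])
  | e :: e' :: es =>
    if e'.1 ≤ k then (route k (e' :: es)).map fun r => (e :: r.1, r.2.1, r.2.2)
    else some ([], e, e' :: es)

/-- Make one node out of a list of entries, or two nodes if the list is too long for one. -/
def regroup (B : ℕ) {h : ℕ} (es : Entries κ h) : Timed (Entries κ (h + 1)) :=
  ⟨(if es.length ≤ B then [es] else [es.take (es.length / 2), es.drop (es.length / 2)]).filterMap
      fun g => match g with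
        | [] => none
        | e :: _ => some (e.1, ((none, g) : Option ℕ × Entries κ h)),
   es.length + 1⟩

/-- Point query. -/
def lookupEntries [LinearOrder κ] (k : κ) : (h : ℕ) → Entries κ h → Timed (Option ℕ)
  | 0, es => ⟨(es.find? fun e => e.1 = k).map fun e => (e.2 : ℕ), es.length + 1⟩
  | h + 1, es => do
    Timed.tick (es.length + 1)
    match route k es with
    | none => pure none
    | some (_, e, _) => do
      let cs ← pushDown e.2
      lookupEntries k h cs

/-- Insertion below a node; the resulting list of entries may be longer than `B` by one. -/
def insertEntries [LinearOrder κ] (B : ℕ) (k : κ) (v : ℕ) :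
    (h : ℕ) → Entries κ h → Timed (Entries κ h)
  | 0, es =>
    let new : κ × Payload κ 0 := (k, (v : ℕ))
    ⟨(es.filter fun e => e.1 < k) ++ new :: (es.filter fun e => k < e.1), es.length + 1⟩
  | h + 1, es => do
    Timed.tick (es.length + 1)
    match route k es with
    | none => pure es
    | some (pre, e, post) => do
      let cs ← pushDown e.2
      let cs' ← insertEntries B k v h cs
      let gs ← regroup B cs'
      pure (pre ++ gs ++ post)

/-- Deletion below a node; a child with fewer than `B / 2` entries is put together with an adjacent
sibling, and the union is split evenly if it is too long for one node. -/
def deleteEntries [LinearOrder κ] (B : ℕ) (k : κ) : (h : ℕ) → Entries κ h → Timed (Entries κ h)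
  | 0, es => ⟨es.filter fun e => e.1 ≠ k, es.length + 1⟩
  | h + 1, es => do
    Timed.tick (es.length + 1)
    match route k es with
    | none => pure es
    | some (pre, e, post) => do
      let cs ← pushDown e.2
      let cs' ← deleteEntries B k h cs
      if B ≤ 2 * cs'.length then do
        let gs ← regroup B cs'
        pure (pre ++ gs ++ post)
      else
        match post, pre.getLast? with
        | s :: post', _ => do
          let ss ← pushDown s.2
          let gs ← regroup B (cs' ++ ss)
          pure (pre ++ gs ++ post')
        | [], some s => do
          let ss ← pushDown s.2
          let gs ← regroup B (ss ++ cs')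
          pure (pre.dropLast ++ gs)
        | [], none => regroup B cs'

/-- Range assignment on the children of a node.  The keys below a child lie between its own key
(inclusive) and the key of the next child, or `u` for the last child (exclusive).  Children outside
`[a, b)` stay, children inside are treated by `full`, the others by `part`. -/
def assignList [LinearOrder κ] {β : Type} (a b : κ) (full : β → β)
    (part : WithTop κ → β → Timed β) (u : WithTop κ) : List (κ × β) → Timed (List (κ × β))
  | [] => pure []
  | e :: es => do
    Timed.tick 1
    let ub : WithTop κ := match es with
      | [] => u
      | e' :: _ => (e'.1 : WithTop κ)
    let p ←
      if b ≤ e.1 ∨ ub ≤ (a : WithTop κ) then pure e.2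
      else if a ≤ e.1 ∧ ub ≤ (b : WithTop κ) then pure (full e.2)
      else part ub e.2
    let rest ← assignList a b full part u es
    pure ((e.1, p) :: rest)

/-- Assign `v` to all keys in `[a, b)` below a node all of whose keys are less than `u`. -/
def assignEntries [LinearOrder κ] (a b : κ) (v : ℕ) :
    (h : ℕ) → WithTop κ → Entries κ h → Timed (Entries κ h)
  | 0, _, es => ⟨es.map fun e => if a ≤ e.1 ∧ e.1 < b then (e.1, v) else e, es.length + 1⟩
  | h + 1, u, es =>
    assignList a b (assign v (h + 1))
      (fun ub p => do
        let cs ← pushDown p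
        let cs' ← assignEntries a b v h ub cs
        pure ((none, cs') : Option ℕ × Entries κ h)) u es

/-- The empty auxiliary tree. -/
def AuxTree.empty : AuxTree κ := ⟨0, []⟩

def AuxTree.lookup [LinearOrder κ] (T : AuxTree κ) (k : κ) : Timed (Option ℕ) :=
  lookupEntries k T.height T.root

def AuxTree.insert [LinearOrder κ] (B : ℕ) (T : AuxTree κ) (k : κ) (v : ℕ) :
    Timed (AuxTree κ) := do
  let es ← insertEntries B k v T.height T.root
  if es.length ≤ B then pure ⟨T.height, es⟩
  else do
    let gs ← regroup B es
    pure ⟨T.height + 1, gs⟩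

/-- Remove the root of an auxiliary tree if it is an internal node with a single child. -/
def collapseRoot : (h : ℕ) → Entries κ h → Timed (AuxTree κ)
  | h + 1, [e] => do
    let cs ← pushDown e.2
    pure ⟨h, cs⟩
  | h, es => pure ⟨h, es⟩

def AuxTree.delete [LinearOrder κ] (B : ℕ) (T : AuxTree κ) (k : κ) : Timed (AuxTree κ) := do
  let es ← deleteEntries B k T.height T.root
  collapseRoot T.height es

/-- Assign `v` to all keys in `[a, b)`. -/
def AuxTree.assignRange [LinearOrder κ] (T : AuxTree κ) (a b : κ) (v : ℕ) :
    Timed (AuxTree κ) := do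
  let es ← assignEntries a b v T.height ⊤ T.root
  pure ⟨T.height, es⟩

end Auxiliary

/-! ## Static quantum B+ trees -/

section Trees

variable {α : Type}

/-- A node with its integer ID, its routing key `(lo, hi)`, its weight, and its non-dummy slots;
the remaining slots, up to `B`, are dummies. -/
structure QNode (α β : Type) where
  id : ℕ
  lo : α
  hi : α
  wt : ℕ
  slots : List β

/-- What fills a slot of a node of height `h`: a key-record pair if the node is a leaf (`h = 0`),
a node of height `h - 1` otherwise. -/
def Slot (α : Type) : ℕ → Type
  | 0 => α
  | h + 1 => QNode α (Slot α h)

/-- A B+ tree of height `h`, given by its root.  All leaves have the same level. -/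
abbrev Tree (α : Type) (h : ℕ) : Type := QNode α (Slot α h)

def slotLo : (h : ℕ) → Slot α h → α
  | 0, x => x
  | _ + 1, t => QNode.lo t

def slotHi : (h : ℕ) → Slot α h → α
  | 0, x => x
  | _ + 1, t => QNode.hi t

def slotWt : (h : ℕ) → Slot α h → ℕ
  | 0, _ => 1
  | _ + 1, t => QNode.wt t

/-- A value in the data QRAM: the routing key of a child, or a key-record pair. -/
inductive Cell (α : Type) where
  | routing (lo hi : α)
  | item (x : α)

/-- The memory: the hierarchy QRAM `Q0`, the data QRAM `Q1` (`none` is the mark *dummy*), the next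
free node ID and the number of elementary steps executed so far. -/
structure Mem (α : Type) where
  Q0 : ℕ → Option ℕ
  Q1 : ℕ → Option (Cell α)
  nextId : ℕ
  steps : ℕ

/-- Programs that use the memory. -/
abbrev Prog (α β : Type) : Type := StateM (Mem α) β

/-- Spend `n` steps. -/
def tick (n : ℕ) : Prog α Unit := modify fun m => { m with steps := m.steps + n }

/-- Run a classical computation, paying for its steps. -/
def liftTimed {β : Type} (t : Timed β) : Prog α β := do
  tick t.time
  pure t.ret

/-- A new node ID. -/
def freshId : Prog α ℕ := do
  let m ← get
  set { m with nextId := m.nextId + 1, steps := m.steps + 1 }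
  pure m.nextId

/-- The ID of the `j`-th child of a node, to be kept in `Q0`; the ID of the node itself for a
leaf. -/
def hierarchyCell : (h : ℕ) → Tree α h → ℕ → Option ℕ
  | 0, t, _ => some t.id
  | h + 1, t, j => (t.slots[j]?).map fun c => QNode.id (β := Slot α h) c

/-- The routing key of the `j`-th child of a node or the `j`-th key-record pair of a leaf, to be
kept in `Q1`. -/
def dataCell : (h : ℕ) → Tree α h → ℕ → Option (Cell α)
  | 0, t, j => (t.slots[j]?).map fun x => Cell.item x
  | h + 1, t, j => (t.slots[j]?).map fun c => Cell.routing (slotLo (h + 1) c) (slotHi (h + 1) c)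

/-- Replicate a node in the two QRAMs: the `2 * B` store operations
`Q0[id * B + j] = hierarchyCell j` and `Q1[id * B + j] = dataCell j`, for `j < B`. -/
def store (B h : ℕ) (t : Tree α h) : Prog α Unit :=
  modify fun m =>
    { m with
      Q0 := fun a => if a / B = t.id then hierarchyCell h t (a % B) else m.Q0 a
      Q1 := fun a => if a / B = t.id then dataCell h t (a % B) else m.Q1 a
      steps := m.steps + 2 * B }

/-- Cut a list into `k` consecutive pieces whose lengths differ by at most one. -/
def splitEven : ℕ → List α → List (List α)
  | 0, _ => []
  | k + 1, l => l.take (l.length / (k + 1)) :: splitEven k (l.drop (l.length / (k + 1)))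

/-- Build a tree of height `h` on a sorted list of `n` key-record pairs.  A node of height `h + 1`
gets `max 2 ⌈n / B ^ (h + 1)⌉` children of equal weight (up to one); if `n ≥ B ^ (h + 1)`, then all
nodes below are perfectly balanced.  The argument `d` is used for an empty list only. -/
def build (B : ℕ) (d : α) : (h : ℕ) → List α → Prog α (Tree α h)
  | 0, l => do
    tick (l.length + 1)
    let i ← freshId
    let t : Tree α 0 := ⟨i, l.headD d, l.getLastD d, l.length, l⟩
    store B 0 t
    pure t
  | h + 1, l => do
    let k := max 2 ((l.length + B ^ (h + 1) - 1) / B ^ (h + 1))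
    tick (k + 1)
    let cs ← (splitEven k l).mapM (build B d h)
    let i ← freshId
    let t : Tree α (h + 1) := ⟨i, l.headD d, l.getLastD d, l.length, cs⟩
    store B (h + 1) t
    pure t

/-- Read all key-record pairs below a node, in order, visiting all nodes below it.  The pairs are
appended to one output array, so that concatenation costs nothing beyond the visits. -/
def collect : (h : ℕ) → Tree α h → Prog α (List α)
  | 0, t => do
    tick (t.slots.length + 1)
    pure t.slots
  | h + 1, t => do
    tick (t.slots.length + 1)
    let ls ← t.slots.mapM (collect h)
    pure ls.flatten

/-- The first element on which `f` succeeds, with what precedes and follows it. -/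
def splitFirst {β γ : Type} (f : β → Option γ) : List β → Option (List β × γ × List β)
  | [] => none
  | b :: bs =>
    match f b with
    | some c => some ([], c, bs)
    | none => (splitFirst f bs).map fun r => (b :: r.1, r.2.1, r.2.2)

variable [LinearOrder α]

/-- Split the children of a node around the child whose routing key contains `x`. -/
def routeChild {h : ℕ} (x : α) (cs : List (Tree α h)) :
    Option (List (Tree α h) × Tree α h × List (Tree α h)) :=
  splitFirst (fun c => if c.lo ≤ x ∧ x ≤ c.hi then some c else none) cs

/-- Classical search for a key-record pair in a tree. -/
def contains (x : α) : (h : ℕ) → Tree α h → Prog α Bool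
  | 0, t => do
    tick (t.slots.length + 1)
    let l : List α := t.slots
    pure (decide (x ∈ l))
  | h + 1, t => do
    tick (t.slots.length + 1)
    match routeChild (h := h) x t.slots with
    | none => pure false
    | some (_, c, _) => contains x h c

/-- `u` borrows the first child of its right sibling `v`, if `u` has room for it and `v` stays
balanced. -/
def borrowRight (B : ℕ) {h : ℕ} (u v : Tree α h) : Option (Tree α h × Tree α h) :=
  match v.slots with
  | [] => none
  | c :: rest =>
    if u.slots.length < B ∧ B ^ (h + 1) + 4 * slotWt h c ≤ 4 * v.wt then
      some ({ u with slots := u.slots ++ [c], hi := slotHi h c, wt := u.wt + slotWt h c },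
            { v with slots := rest, lo := (rest.head?.map (slotLo h)).getD v.lo,
                     wt := v.wt - slotWt h c })
    else none

/-- `v` borrows the last child of its left sibling `u`, if `v` has room for it and `u` stays
balanced. -/
def borrowLeft (B : ℕ) {h : ℕ} (u v : Tree α h) : Option (Tree α h × Tree α h) :=
  match u.slots.getLast? with
  | none => none
  | some c =>
    if v.slots.length < B ∧ B ^ (h + 1) + 4 * slotWt h c ≤ 4 * u.wt then
      some ({ u with slots := u.slots.dropLast,
                     hi := (u.slots.dropLast.getLast?.map (slotHi h)).getD u.hi,
                     wt := u.wt - slotWt h c },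
            { v with slots := c :: v.slots, lo := slotLo h c, wt := v.wt + slotWt h c })
    else none

/-- Two adjacent siblings `u`, `v`, where `u` precedes `v`, put together in one node. -/
def concat {h : ℕ} (u v : Tree α h) : Tree α h :=
  { u with slots := u.slots ++ v.slots, hi := v.hi, wt := u.wt + v.wt }

/-- Repair two adjacent siblings one of which is imbalanced: by borrowing a child (`b` is the result
of the attempt), else by a direct merge if they have at most `B` children together, else by
rebuilding the subtrees below them into one. -/
def repairPair (B : ℕ) (d : α) {h : ℕ} (b : Option (Tree α h × Tree α h)) (u v : Tree α h) :
    Prog α (List (Tree α h)) := do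
  tick (u.slots.length + v.slots.length + 1)
  match b with
  | some (u', v') => do
    store B h u'
    store B h v'
    pure [u', v']
  | none =>
    if u.slots.length + v.slots.length ≤ B then do
      let w := concat u v
      store B h w
      pure [w]
    else do
      let l ← collect h u
      let l' ← collect h v
      let w ← build B d h (l ++ l')
      pure [w]

/-- Rebalance the child `c` between the children `pre` and `post` of a node, with the help of its
right sibling, or of its left sibling if it is the last child. -/
def rebalance (B : ℕ) (d : α) {h : ℕ} (pre : List (Tree α h)) (c : Tree α h)
    (post : List (Tree α h)) : Prog α (List (Tree α h)) :=
  if B ^ (h + 1) ≤ 4 * c.wt then pure (pre ++ c :: post)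
  else
    match post, pre.getLast? with
    | v :: post', _ => do
      let r ← repairPair B d (borrowRight B c v) c v
      pure (pre ++ r ++ post')
    | [], some v => do
      let r ← repairPair B d (borrowLeft B v c) v c
      pure (pre.dropLast ++ r)
    | [], none => pure [c]

/-- Delete `x` below a node: replace it by a dummy in its leaf, then, on the way back, rebalance
the ancestors of that leaf, except for the root of the tree. -/
def deleteBelow (B : ℕ) (x : α) : (h : ℕ) → Tree α h → Prog α (Tree α h)
  | 0, t => do
    tick (t.slots.length + 1)
    let l : List α := t.slots
    let l' := l.filter fun y => y ≠ x
    let t' : Tree α 0 := { t with slots := l', wt := l'.length }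
    store B 0 t'
    pure t'
  | h + 1, t => do
    tick (t.slots.length + 1)
    match routeChild (h := h) x t.slots with
    | none => pure t
    | some (pre, c, post) => do
      let c' ← deleteBelow B x h c
      let cs ← rebalance B x pre c' post
      let t' : Tree α (h + 1) := { t with slots := cs, wt := (cs.map (QNode.wt)).sum }
      store B (h + 1) t'
      pure t'

/-- Merge sorted lists. -/
def mergeSorted : List (List α) → Prog α (List α)
  | [] => pure []
  | l :: ls => do
    let r ← mergeSorted ls
    tick (l.length + r.length + 1)
    pure (List.merge l r fun a b => decide (a ≤ b))

end Trees

/-! ## The dynamic quantum B+ tree -/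

section Dynamic

variable {α : Type}

/-- The dynamic quantum B+ tree, apart from the QRAMs.  *Level* `0` is the sorted list `buffer`, and
level `i + 1` is the forest `F_i = forest i` of trees of height `i`. -/
structure DynTree (α : Type) where
  /-- the sorted list of recently inserted pairs -/
  buffer : List α
  /-- the forests -/
  forest : (i : ℕ) → List (Tree α i)
  /-- `forest i` is empty for `i ≥ top` -/
  top : ℕ
  /-- auxiliary B+ tree: from key-record pairs to their IDs -/
  T0 : AuxTree α
  /-- auxiliary B+ tree: from the IDs of key-record pairs to levels -/
  T1 : AuxTree ℕ
  /-- the counter for the IDs of key-record pairs -/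
  nextItem : ℕ
  /-- The IDs of the pairs in level `0` lie in `[bound 0, nextItem)`, those of the pairs in level
  `k + 1` in `[bound (k + 1), bound k)`. -/
  bound : ℕ → ℕ

/-- The empty dynamic quantum B+ tree. -/
def DynTree.empty : DynTree α :=
  ⟨[], fun _ => [], 0, AuxTree.empty, AuxTree.empty, 0, fun _ => 0⟩

/-- Replace the forest `F_i`. -/
def DynTree.setForest (s : DynTree α) (i : ℕ) (ts : List (Tree α i)) : DynTree α :=
  { s with forest := Function.update s.forest i ts }

variable [LinearOrder α]

/-- As long as the forest `F_i` has `B` trees, merge them into one tree of height `i + 1`, add it to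
`F_{i+1}`, update `T1` for all pairs in `F_i` by a range assignment, and go on with `F_{i+1}`.  The
first argument bounds the number of rounds. -/
def cascade (B : ℕ) (d : α) : ℕ → ℕ → DynTree α → Prog α (DynTree α)
  | 0, _, s => pure s
  | n + 1, i, s => do
    tick 1
    if (s.forest i).length < B then pure s
    else do
      let ls ← (s.forest i).mapM (collect i)
      let l ← mergeSorted ls
      let t ← build B d (i + 1) l
      let T1 ← liftTimed (s.T1.assignRange (s.bound (i + 1)) (s.bound i) (i + 2))
      let s' := (s.setForest i []).setForest (i + 1) (t :: s.forest (i + 1))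
      cascade B d n (i + 1)
        { s' with
          T1 := T1
          top := max s.top (i + 2)
          bound := Function.update s.bound (i + 1) (s.bound i) }

/-- `INSERT`: nothing happens if the pair is present.  Otherwise it gets the next ID, is inserted
into the auxiliary trees and into the sorted list, and the list is flushed into `F_0` when its
length reaches `B`. -/
def DynTree.insert (B : ℕ) (x : α) (s : DynTree α) : Prog α (DynTree α) := do
  let found ← liftTimed (s.T0.lookup x)
  match found with
  | some _ => pure s
  | none => do
    let T0 ← liftTimed (s.T0.insert B x s.nextItem)
    let T1 ← liftTimed (s.T1.insert B s.nextItem 0)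
    tick (s.buffer.length + 1)
    let s' := { s with
      buffer := s.buffer.orderedInsert (· ≤ ·) x
      T0 := T0
      T1 := T1
      nextItem := s.nextItem + 1 }
    if s'.buffer.length < B then pure s'
    else do
      let t ← build B x 0 s'.buffer
      let T1' ← liftTimed (s'.T1.assignRange (s'.bound 0) s'.nextItem 1)
      cascade B x (s'.top + 1) 0
        { s'.setForest 0 (t :: s'.forest 0) with
          buffer := []
          T1 := T1'
          top := max s'.top 1
          bound := Function.update s'.bound 0 s'.nextItem }

/-- Find the tree of a forest that contains `x`; return it and the other trees. -/
def locate (x : α) {i : ℕ} : List (Tree α i) → Prog α (Option (Tree α i × List (Tree α i)))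
  | [] => pure none
  | t :: ts => do
    let b ← contains x i t
    if b then pure (some (t, ts))
    else do
      let r ← locate x ts
      pure (r.map fun p => (p.1, t :: p.2))

/-- Do the routing keys of two nodes not overlap? -/
def Apart {β : Type} (u v : QNode α β) : Prop := u.hi < v.lo ∨ v.hi < u.lo

instance {β : Type} (u v : QNode α β) : Decidable (Apart u v) := by
  unfold Apart; infer_instance

/-- Put two nodes together in one node, in the order of their routing keys. -/
def joinApart {h : ℕ} (u v : Tree α h) : Tree α h :=
  if u.hi < v.lo then concat u v else { concat v u with id := u.id }

/-- Give the child `c'` as a second child to a root `t` whose only child is `c`. -/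
def addChild {i : ℕ} (t : Tree α (i + 1)) (c c' : Tree α i) : Tree α (i + 1) :=
  if c.hi < c'.lo then { t with slots := [c, c'], lo := c.lo, hi := c'.hi, wt := c.wt + c'.wt }
  else { t with slots := [c', c], lo := c'.lo, hi := c.hi, wt := c.wt + c'.wt }

/-- Look for a tree whose root has at least three children one of which can become a sibling of
`c`, that is, has a routing key that does not overlap that of `c`.  Return the child and the tree
without that child, between the preceding and the following trees. -/
def findLender {i : ℕ} (c : Tree α i) (ts : List (Tree α (i + 1))) :
    Option (List (Tree α (i + 1)) × (Tree α i × Tree α (i + 1)) × List (Tree α (i + 1))) :=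
  splitFirst (fun s : Tree α (i + 1) =>
    if 3 ≤ s.slots.length then
      let cs : List (Tree α i) := s.slots
      (splitFirst (fun c' => if Apart c c' then some c' else none) cs).map fun r =>
        (r.2.1, { s with slots := r.1 ++ r.2.2, wt := s.wt - r.2.1.wt })
    else none) ts

/-- Merge the trees `t` and `t'` of the same forest: put their roots together if their routing keys
do not overlap and they have at most `B` children, else rebuild the trees into one tree, or into two
trees of equal weight if there are too many pairs for one tree of this height. -/
def mergeRoots (B : ℕ) (d : α) {h : ℕ} (t t' : Tree α h) : Prog α (List (Tree α h)) := do
  tick (t.slots.length + t'.slots.length + 1)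
  if Apart t t' ∧ t.slots.length + t'.slots.length ≤ B then do
    let w := joinApart t t'
    store B h w
    pure [w]
  else do
    let l ← collect h t
    let l' ← collect h t'
    let m ← mergeSorted [l, l']
    if m.length ≤ B ^ (h + 1) then do
      let w ← build B d h m
      pure [w]
    else
      (splitEven 2 m).mapM (build B d h)

/-- After a deletion in the tree `t` of `F_i`, where `ts` are the other trees of `F_i`: an empty leaf
is dropped.  If the root of `t` is an internal node with one child, then it borrows a child from
another tree of the forest if possible; else `t` is merged with another tree of the forest if there
is one; else its root is removed, and `t` is downgraded from `F_i` to `F_{i-1}`. -/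
def fixRoot (B : ℕ) (d : α) : (i : ℕ) → Tree α i → List (Tree α i) → DynTree α →
    Prog α (DynTree α)
  | 0, t, ts, s => do
    tick 1
    if t.slots.length = 0 then pure (s.setForest 0 ts) else pure (s.setForest 0 (t :: ts))
  | i + 1, t, ts, s => do
    tick 1
    let cs : List (Tree α i) := t.slots
    match cs with
    | [c] => do
      tick ((ts.map fun t' => t'.slots.length + 1).sum + 1)
      match findLender c ts with
      | some (pre, (c', t'), post) => do
        let w := addChild t c c'
        store B (i + 1) w
        store B (i + 1) t'
        pure (s.setForest (i + 1) (w :: (pre ++ t' :: post)))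
      | none =>
        match ts with
        | t' :: ts' => do
          let r ← mergeRoots B d t t'
          pure (s.setForest (i + 1) (r ++ ts'))
        | [] => do
          let T1 ← liftTimed (s.T1.assignRange (s.bound (i + 2)) (s.bound (i + 1)) (i + 1))
          let s' := (s.setForest (i + 1) []).setForest i (c :: s.forest i)
          cascade B d (s.top + 1) i
            { s' with
              T1 := T1
              bound := Function.update s.bound (i + 1) (s.bound (i + 2)) }
    | _ => pure (s.setForest (i + 1) (t :: ts))

/-- `DELETE`: nothing happens if the pair is absent.  Otherwise its level is found by two point
queries in the auxiliary trees, and it is deleted from them and from its level. -/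
def DynTree.delete (B : ℕ) (x : α) (s : DynTree α) : Prog α (DynTree α) := do
  let found ← liftTimed (s.T0.lookup x)
  match found with
  | none => pure s
  | some n => do
    let level ← liftTimed (s.T1.lookup n)
    let T0 ← liftTimed (s.T0.delete B x)
    let T1 ← liftTimed (s.T1.delete B n)
    let s' := { s with T0 := T0, T1 := T1 }
    match level with
    | none => pure s'
    | some 0 => do
      tick (s.buffer.length + 1)
      pure { s' with buffer := s.buffer.filter fun y => y ≠ x }
    | some (i + 1) => do
      let r ← locate x (s.forest i)
      match r with
      | none => pure s'
      | some (t, ts) => do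
        let t' ← deleteBelow B x i t
        fixRoot B x i t' ts s'

/-- The update operations. -/
inductive Op (α : Type) where
  | insert (x : α)
  | delete (x : α)

/-- Execute one operation. -/
def step (B : ℕ) (s : DynTree α) : Op α → Prog α (DynTree α)
  | Op.insert x => s.insert B x
  | Op.delete x => s.delete B x

/-- Execute a sequence of operations on the empty structure. -/
def run (B : ℕ) (ops : List (Op α)) : DynTree α × Mem α :=
  (ops.foldlM (step B) DynTree.empty : Prog α (DynTree α)) ⟨fun _ => none, fun _ => none, 0, 0⟩

/-- The structure after a sequence of operations. -/
def finalTree (B : ℕ) (ops : List (Op α)) : DynTree α := (run B ops).1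

/-- The total number of elementary steps of a sequence of operations, including the store operations
of the QRAMs. -/
def totalCost (B : ℕ) (ops : List (Op α)) : ℕ := (run B ops).2.steps

/-- The effect of an operation on the dataset. -/
def Op.apply (D : Finset α) : Op α → Finset α
  | Op.insert x => Insert.insert x D
  | Op.delete x => D.erase x

/-- The dataset after a sequence of operations, starting with the empty dataset. -/
def dataset (ops : List (Op α)) : Finset α := ops.foldl Op.apply ∅

end Dynamic

/-! ## What it means to hold a dataset -/

section Holds

variable {α : Type}

/-- The key-record pairs below a node of height `h`. -/
def items : (h : ℕ) → Tree α h → List α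
  | 0, t => t.slots
  | h + 1, t => t.slots.flatMap (items h)

/-- All key-record pairs in the sorted list and in the forests. -/
def DynTree.contents (s : DynTree α) : List α :=
  s.buffer ++ (List.range s.top).flatMap fun i => (s.forest i).flatMap (items i)

variable [LinearOrder α]

/-- Correctness of the B+ tree below a node of height `h`: there are at most `B` slots, the pairs
in a leaf are sorted, routing keys are correct, the routing keys of the children are sorted and do
not overlap, and every proper descendant `c` is balanced, that is, its weight lies between
`B ^ (h' + 1) / 4` and `B ^ (h' + 1)` where `h'` is the height of `c`. -/
def WellFormed (B : ℕ) : (h : ℕ) → Tree α h → Prop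
  | 0, t =>
    let l : List α := t.slots
    l.length ≤ B ∧ t.wt = l.length ∧ l.Pairwise (· < ·) ∧ ∀ x ∈ l, t.lo ≤ x ∧ x ≤ t.hi
  | h + 1, t =>
    let cs : List (Tree α h) := t.slots
    cs.length ≤ B ∧ t.wt = (items (h + 1) t).length ∧
    cs.Pairwise (fun u v => u.hi < v.lo) ∧
    ∀ c ∈ cs, WellFormed B h c ∧ t.lo ≤ c.lo ∧ c.lo ≤ c.hi ∧ c.hi ≤ t.hi ∧
      B ^ (h + 1) ≤ 4 * c.wt ∧ c.wt ≤ B ^ (h + 1)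

/-- Weight-balanced B+ trees: in addition, the root has at least two children if it is an internal
node, and at least one pair if it is a leaf. -/
def WeightBalanced (B : ℕ) : (h : ℕ) → Tree α h → Prop
  | 0, t => WellFormed B 0 t ∧ 1 ≤ t.slots.length
  | h + 1, t => WellFormed B (h + 1) t ∧ 2 ≤ t.slots.length

/-- The structure holds exactly the pairs of the dataset `D`, in a sorted list of fewer than `B`
pairs and in forests `F_i` of at most `B - 1` weight-balanced B+ trees of height `i`. -/
def DynTree.Holds (B : ℕ) (s : DynTree α) (D : Finset α) : Prop :=
  s.contents.Nodup ∧ s.contents.toFinset = D ∧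
  s.buffer.length < B ∧ s.buffer.Pairwise (· < ·) ∧
  (∀ i, s.top ≤ i → s.forest i = []) ∧
  ∀ i, (s.forest i).length ≤ B - 1 ∧ ∀ t ∈ s.forest i, WeightBalanced B i t

end Holds

end QBTree

/-!
# The amortized cost of dynamic quantum B+ trees

The proof is an amortized analysis by a potential function, carried along with an invariant which
says that the structure is correct.

Programs are treated through `Runs p Q`: from every memory, the result of `p` and the number of its
steps satisfy `Q`.  The contents of the two QRAMs never influence the control flow, so that memory
matters only through the step counter.

*Auxiliary trees.*  `AuxTree.Represents` relates an auxiliary tree to the sorted list of pairs that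
it stands for, pending range assignments taken into account.  Insertion, deletion, point query and
range assignment act on that list as expected and take time proportional to the height; a range
assignment descends only below nodes whose key range has an end of the interval in its interior, at
most two per level.  `DynTree.Indexed` says that the two trees together lead from each pair to its
level.  It rests on the fact that the IDs of the pairs of a level fill an interval that is disjoint
from the intervals of the other levels (`mem_interval_iff`), so that one range assignment moves
exactly the pairs of one level (`move`).

*Potential.*  The *deficit* of a tree of height `h` sums, over its proper descendants `c`, say of
height `h'`, the number `B ^ (h' + 1) - 2 * wt c`, truncated at zero, which is twice the amount by
which `c` is lighter than half of its capacity.  A freshly built tree has the least deficit that its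
size allows (`BuiltOn.deficit_le`), one deletion raises the deficit by at most two per level, and a node that is
out of balance has a deficit of about half of its capacity.  If such a node cannot borrow, then its
sibling has a weight close to the minimum, the two become one, and the drop of the deficit pays for
rebuilding (`runs_repairPair`).  It even leaves a surplus, which `runs_deleteBelow` hands on when the
root loses a child; this surplus pays for the merge of two roots.  So a deletion in a tree costs a
constant per level.  Besides its deficit, each tree of height `i` contributes
`B ^ (i + 1) * (L + 2 - i) + L` to the potential, up to a constant factor, where `L` is the logarithm
of the number of pairs.  When `B` trees are merged into one of height `i + 1`, the first summand
drops by `B ^ (i + 2)` in total, enough for reading, merging and building; the `B - 1` copies of `L`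
that become free pay for the range assignment (`runs_cascade`).  When the only tree of a forest is
downgraded because its root has a single child, it gains one level to climb but its capacity
shrinks by the factor `B`, so that the potential does not rise (`runs_fixRoot`).

*Growth of `L`.*  When the number `n` of pairs grows by one, then `L` grows by at most `1 / n`.  As
the trees have total capacity `O(n)`, this raises the potential by a constant (`pot_succ_le`).

Each operation thus costs `O(L)` plus the drop of the potential (`runs_insert`, `runs_delete`), and
the potential is zero at the start and never negative.
-/

namespace QBTree

/-! ### Entries of auxiliary B+ trees -/

section AuxiliaryTrees

variable {κ : Type}

@[simp] theorem Timed.ret_pure {β : Type} (b : β) : (pure b : Timed β).ret = b := rfl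

@[simp] theorem Timed.time_pure {β : Type} (b : β) : (pure b : Timed β).time = 0 := rfl

@[simp] theorem Timed.ret_bind {β γ : Type} (x : Timed β) (f : β → Timed γ) :
    (x >>= f).ret = (f x.ret).ret := rfl

@[simp] theorem Timed.time_bind {β γ : Type} (x : Timed β) (f : β → Timed γ) :
    (x >>= f).time = x.time + (f x.ret).time := rfl

@[simp] theorem Timed.time_tick (n : ℕ) : (Timed.tick n).time = n := rfl

/-- The entries stored in a child, without the pending assignment. -/
def rawKids {h : ℕ} (p : Payload κ (h + 1)) : Entries κ h := p.2

/-- The entries of a child after its pending assignment has been pushed to them. -/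
def kids {h : ℕ} (p : Payload κ (h + 1)) : Entries κ h := (pushDown p).ret

/-- Assign `v` lazily to all entries of a list. -/
def assignAll (v : ℕ) {h : ℕ} (es : Entries κ h) : Entries κ h :=
  es.map fun e => (e.1, assign v h e.2)

theorem kids_cases {h : ℕ} (p : Payload κ (h + 1)) :
    kids p = rawKids p ∨ ∃ v, kids p = assignAll v (rawKids p) := by
  obtain ⟨_ | v, es⟩ := p
  · exact Or.inl rfl
  · exact Or.inr ⟨v, rfl⟩

theorem time_pushDown {h : ℕ} (p : Payload κ (h + 1)) :
    (pushDown p).time = (rawKids p).length + 1 := rfl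

theorem rawKids_assign {h : ℕ} (v : ℕ) (p : Payload κ (h + 1)) :
    rawKids (assign v (h + 1) p) = rawKids p := rfl

theorem kids_assign {h : ℕ} (v : ℕ) (p : Payload κ (h + 1)) :
    kids (assign v (h + 1) p) = assignAll v (rawKids p) := rfl

@[simp] theorem length_assignAll (v : ℕ) {h : ℕ} (es : Entries κ h) :
    (assignAll v es).length = es.length := by simp [assignAll]

theorem map_fst_assignAll (v : ℕ) {h : ℕ} (es : Entries κ h) :
    (assignAll v es).map Prod.fst = es.map Prod.fst := by
  simp [assignAll, Function.comp_def]

theorem length_kids {h : ℕ} (p : Payload κ (h + 1)) : (kids p).length = (rawKids p).length := by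
  rcases kids_cases p with h | ⟨v, h⟩ <;> simp [h]

theorem map_fst_kids {h : ℕ} (p : Payload κ (h + 1)) :
    (kids p).map Prod.fst = (rawKids p).map Prod.fst := by
  rcases kids_cases p with h | ⟨v, h⟩ <;> simp [h, map_fst_assignAll]

/-- The key-value pairs represented by a list of entries of height `h`, pending assignments taken
into account. -/
def flat : (h : ℕ) → Entries κ h → List (κ × ℕ)
  | 0, es => es
  | h + 1, es => es.flatMap fun e => flat h (kids e.2)

theorem flat_succ (h : ℕ) (es : Entries κ (h + 1)) :
    flat (h + 1) es = es.flatMap fun e => flat h (kids e.2) := rfl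

theorem flat_append {h : ℕ} (es es' : Entries κ h) :
    flat h (es ++ es') = flat h es ++ flat h es' := by
  cases h with
  | zero => rfl
  | succ h => simp [flat_succ]

theorem flat_cons {h : ℕ} (e : κ × Payload κ (h + 1)) (es : Entries κ (h + 1)) :
    flat (h + 1) (e :: es) = flat h (kids e.2) ++ flat (h + 1) es := by
  simp [flat_succ]

theorem flat_assignAll (v : ℕ) {h : ℕ} (es : Entries κ h) :
    flat h (assignAll v es) = (flat h es).map fun x => (x.1, v) := by
  induction h generalizing v with
  | zero => rfl
  | succ h ih =>
    rw [flat_succ, flat_succ, assignAll, List.flatMap_map, List.map_flatMap]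
    congr 1
    funext e
    rw [kids_assign, ih]
    rcases kids_cases e.2 with h' | ⟨w, h'⟩
    · rw [h']
    · rw [h', ih, List.map_map]; rfl

/-- The shape of an auxiliary B+ tree below a list of entries: all nodes have between `B / 2` and `B`
entries, and the key of an entry is the first key of the child behind it.  The length of the list
itself is not restricted. -/
def AuxValid (B : ℕ) : (h : ℕ) → Entries κ h → Prop
  | 0, _ => True
  | h + 1, es => ∀ e ∈ es, B ≤ 2 * (rawKids e.2).length ∧ (rawKids e.2).length ≤ B ∧
      ((rawKids e.2).map Prod.fst).head? = some e.1 ∧ AuxValid B h (rawKids e.2)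

theorem auxValid_succ {B h : ℕ} {es : Entries κ (h + 1)} :
    AuxValid B (h + 1) es ↔ ∀ e ∈ es, B ≤ 2 * (rawKids e.2).length ∧ (rawKids e.2).length ≤ B ∧
      ((rawKids e.2).map Prod.fst).head? = some e.1 ∧ AuxValid B h (rawKids e.2) := Iff.rfl

theorem auxValid_append {B h : ℕ} {es es' : Entries κ h} :
    AuxValid B h (es ++ es') ↔ AuxValid B h es ∧ AuxValid B h es' := by
  cases h with
  | zero => simp [AuxValid]
  | succ h => simp only [auxValid_succ, List.mem_append]; grind

theorem auxValid_cons {B h : ℕ} {e : κ × Payload κ h} {es : Entries κ h} :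
    AuxValid B h (e :: es) ↔ AuxValid B h [e] ∧ AuxValid B h es :=
  auxValid_append (es := [e])

theorem auxValid_assignAll {B h : ℕ} (v : ℕ) {es : Entries κ h} :
    AuxValid B h (assignAll v es) ↔ AuxValid B h es := by
  cases h with
  | zero => simp [AuxValid]
  | succ h =>
    simp only [auxValid_succ, assignAll, List.mem_map, forall_exists_index, and_imp,
      forall_apply_eq_imp_iff₂, rawKids_assign]

theorem auxValid_kids {B h : ℕ} {p : Payload κ (h + 1)} (hp : AuxValid B h (rawKids p)) :
    AuxValid B h (kids p) := by
  rcases kids_cases p with h | ⟨v, h⟩ <;> simpa [h, auxValid_assignAll]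

theorem auxValid_succ_kids {B h : ℕ} {es : Entries κ (h + 1)} (hes : AuxValid B (h + 1) es)
    {e : κ × Payload κ (h + 1)} (he : e ∈ es) : B ≤ 2 * (kids e.2).length ∧ (kids e.2).length ≤ B ∧
      ((kids e.2).map Prod.fst).head? = some e.1 ∧ AuxValid B h (kids e.2) := by
  rw [length_kids, map_fst_kids]
  obtain ⟨h1, h2, h3, h4⟩ := hes e he
  exact ⟨h1, h2, h3, auxValid_kids h4⟩

/-- The first key below a list of entries is the key of the first entry. -/
theorem head?_flat {B : ℕ} {h : ℕ} {es : Entries κ h} (hes : AuxValid B h es) :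
    ((flat h es).map Prod.fst).head? = (es.map Prod.fst).head? := by
  induction h with
  | zero => rfl
  | succ h ih =>
    cases es with
    | nil => rfl
    | cons e es =>
      obtain ⟨-, -, h3, h4⟩ := auxValid_succ_kids hes (List.mem_cons_self)
      have := ih h4
      rw [h3] at this
      rw [flat_cons, List.map_append, List.head?_append, this]
      rfl

/-- A node of height `h` represents at least `(B / 2) ^ h` pairs for each of its entries. -/
theorem length_mul_pow_le {B : ℕ} {h : ℕ} {es : Entries κ h} (hes : AuxValid B h es) :
    es.length * B ^ h ≤ (flat h es).length * 2 ^ h := by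
  induction h with
  | zero => exact le_of_eq rfl
  | succ h ih =>
    induction es with
    | nil => simp
    | cons e es ihes =>
      rw [auxValid_cons] at hes
      have h2 := ihes hes.2
      obtain ⟨h3, -, -, h5⟩ := auxValid_succ_kids hes.1 (List.mem_singleton_self e)
      have h6 := ih h5
      rw [flat_cons, List.length_append, List.length_cons, add_mul, add_mul, one_mul, add_comm]
      refine add_le_add ?_ h2
      calc B ^ (h + 1) = B * B ^ h := by ring
        _ ≤ (2 * (kids e.2).length) * B ^ h := Nat.mul_le_mul_right _ h3
        _ = 2 * ((kids e.2).length * B ^ h) := by ring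
        _ ≤ 2 * ((flat h (kids e.2)).length * 2 ^ h) := Nat.mul_le_mul_left _ h6
        _ = _ := by ring

/-- The key of an entry occurs below it. -/
theorem exists_mem_flat_kids {B h : ℕ} {e : κ × Payload κ (h + 1)}
    (he : AuxValid B (h + 1) [e]) : ∃ x ∈ flat h (kids e.2), x.1 = e.1 := by
  obtain ⟨-, -, h3, h4⟩ := auxValid_succ_kids he (List.mem_singleton_self e)
  have := (head?_flat h4).trans h3
  cases hf : flat h (kids e.2) with
  | nil => simp [hf] at this
  | cons x l => simp [hf] at this; exact ⟨x, by simp, this⟩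

/-- The entry of a parent node that stands for the node with the entries `g`. -/
def groupEntry {h : ℕ} (g : Entries κ h) : Option (κ × Payload κ (h + 1)) :=
  match g with
  | [] => none
  | e :: _ => some (e.1, ((none, g) : Option ℕ × Entries κ h))

theorem ret_regroup (B : ℕ) {h : ℕ} (es : Entries κ h) : (regroup B es).ret =
    (if es.length ≤ B then [es] else
      [es.take (es.length / 2), es.drop (es.length / 2)]).filterMap groupEntry := rfl

theorem time_regroup {B h : ℕ} (es : Entries κ h) : (regroup B es).time = es.length + 1 := rfl

theorem exists_groupEntry {B h : ℕ} (hB : 0 < B) {g : Entries κ h} (hg : AuxValid B h g)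
    (h1 : B ≤ 2 * g.length) (h2 : g.length ≤ B) : ∃ e : κ × Payload κ (h + 1),
      groupEntry g = some e ∧ AuxValid B (h + 1) [e] ∧ flat h (kids e.2) = flat h g := by
  cases g with
  | nil => simp at h1; omega
  | cons x g =>
    refine ⟨_, rfl, ?_, rfl⟩
    intro e he
    rw [List.mem_singleton] at he
    subst he
    exact ⟨h1, h2, rfl, hg⟩

theorem regroup_spec {B h : ℕ} (hB : 0 < B) {es : Entries κ h} (hv : AuxValid B h es)
    (h1 : B ≤ 2 * es.length) (h2 : es.length ≤ 2 * B) :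
    AuxValid B (h + 1) (regroup B es).ret ∧ flat (h + 1) (regroup B es).ret = flat h es ∧
      (regroup B es).ret.length = if es.length ≤ B then 1 else 2 := by
  rw [ret_regroup]
  split
  · obtain ⟨e, he, he1, he2⟩ := exists_groupEntry hB hv h1 ‹_›
    rw [List.filterMap_cons_some he, List.filterMap_nil]
    exact ⟨he1, by rw [flat_cons, he2]; simp [flat], rfl⟩
  · rw [← List.take_append_drop (es.length / 2) es, auxValid_append] at hv
    obtain ⟨e, he, he1, he2⟩ := exists_groupEntry hB hv.1 (by simp; omega) (by simp; omega)
    obtain ⟨e', he', he1', he2'⟩ := exists_groupEntry hB hv.2 (by simp; omega) (by simp; omega)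
    rw [List.filterMap_cons_some he, List.filterMap_cons_some he', List.filterMap_nil]
    refine ⟨auxValid_cons.2 ⟨he1, he1'⟩, ?_, rfl⟩
    rw [flat_cons, flat_cons, he2, he2']
    conv_rhs => rw [← List.take_append_drop (es.length / 2) es, flat_append]
    simp [flat]

section Order

variable [LinearOrder κ]

/-- The keys of a list of pairs are strictly increasing. -/
def SortedKeys {β : Type} (l : List (κ × β)) : Prop := l.Pairwise fun a b => a.1 < b.1

theorem le_of_mem_of_head? {l : List (κ × ℕ)} (hl : SortedKeys l) {k : κ}
    (hk : (l.map Prod.fst).head? = some k) {x : κ × ℕ} (hx : x ∈ l) : k ≤ x.1 := by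
  cases l with
  | nil => simp at hx
  | cons y l =>
    simp only [List.map_cons, List.head?_cons, Option.some.injEq] at hk
    rcases List.mem_cons.1 hx with rfl | hx
    · exact hk.ge
    · exact hk ▸ (List.rel_of_pairwise_cons hl hx).le

/-- Keys below an entry are at least the key of the entry. -/
theorem entry_le_of_mem {B h : ℕ} {e : κ × Payload κ (h + 1)} (he : AuxValid B (h + 1) [e])
    (hs : SortedKeys (flat h (kids e.2))) {x : κ × ℕ} (hx : x ∈ flat h (kids e.2)) : e.1 ≤ x.1 := by
  obtain ⟨-, -, h3, h4⟩ := auxValid_succ_kids he (List.mem_singleton_self e)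
  exact le_of_mem_of_head? hs ((head?_flat h4).trans h3) hx

theorem route_eq_some {β : Type} {k : κ} {es : List (κ × β)}
    {r : List (κ × β) × (κ × β) × List (κ × β)} (hr : route k es = some r) :
    es = r.1 ++ r.2.1 :: r.2.2 ∧ (r.1 = [] ∨ r.2.1.1 ≤ k) ∧ ∀ e ∈ r.2.2.head?, k < e.1 := by
  induction es generalizing r with
  | nil => simp [route] at hr
  | cons e es ih =>
    cases es with
    | nil => simp [route] at hr; subst hr; simp
    | cons e' es =>
      rw [route] at hr
      split at hr
      · rename_i hle
        rw [Option.map_eq_some_iff] at hr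
        obtain ⟨r', hr', rfl⟩ := hr
        obtain ⟨h1, h2, h3⟩ := ih hr'
        refine ⟨by simp [← h1], Or.inr ?_, h3⟩
        rcases h2 with h2 | h2
        · rw [h2] at h1; simp at h1; rw [← h1.1]; exact hle
        · exact h2
      · rename_i hle
        simp at hr; subst hr; simpa using hle

theorem route_ne_none {β : Type} (k : κ) {es : List (κ × β)} (hes : es ≠ []) :
    route k es ≠ none := by
  induction es with
  | nil => simp at hes
  | cons e es ih =>
    cases es with
    | nil => simp [route]
    | cons e' es =>
      rw [route]
      split
      · simpa using ih (by simp)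
      · simp

/-- What routing a key `k` achieves: all keys before the chosen child are less than `k`, and all keys
after it are greater. -/
theorem route_spec {B h : ℕ} {k : κ} {es : Entries κ (h + 1)} (hv : AuxValid B (h + 1) es)
    (hs : SortedKeys (flat (h + 1) es)) (hne : es ≠ []) :
    ∃ pre e post, route k es = some (pre, e, post) ∧ es = pre ++ e :: post ∧
      (∀ x ∈ flat (h + 1) pre, x.1 < k) ∧ (∀ x ∈ flat (h + 1) post, k < x.1) := by
  obtain ⟨⟨pre, e, post⟩, hr⟩ := Option.ne_none_iff_exists'.1 (route_ne_none k hne)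
  obtain ⟨h1, h2, h3⟩ := route_eq_some hr
  refine ⟨pre, e, post, hr, h1, ?_, ?_⟩
  · intro x hx
    rcases h2 with h2 | h2
    · simp only at h2; subst h2; simp [flat] at hx
    · refine lt_of_lt_of_le ?_ h2
      simp only at h1
      rw [h1, flat_append] at hs
      rw [h1, auxValid_append, auxValid_cons] at hv
      obtain ⟨y, hy, hy'⟩ := exists_mem_flat_kids hv.2.1
      rw [← hy']
      exact (List.pairwise_append.1 hs).2.2 x hx y (by rw [flat_cons]; simp [hy])
  · intro x hx
    cases post with
    | nil => simp [flat] at hx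
    | cons e' post =>
      refine lt_of_lt_of_le (h3 e' rfl) ?_
      simp only at h1
      rw [h1, flat_append, flat_cons] at hs
      rw [h1, auxValid_append, auxValid_cons] at hv
      have hs' := (List.pairwise_append.1 (List.pairwise_append.1 hs).2.1).2.1
      exact le_of_mem_of_head? hs' (head?_flat hv.2.2) hx

theorem lookupEntries_spec {B h : ℕ} {k : κ} {es : Entries κ h} (hv : AuxValid B h es)
    (hs : SortedKeys (flat h es)) :
    (lookupEntries k h es).ret = ((flat h es).find? fun x => x.1 = k).map Prod.snd ∧
      (lookupEntries k h es).time ≤ es.length + 1 + h * (2 * B + 2) := by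
  induction h with
  | zero => exact ⟨rfl, by simp [lookupEntries]⟩
  | succ h ih =>
    rcases eq_or_ne es [] with rfl | hne
    · simp [lookupEntries, route, flat]
    obtain ⟨pre, e, post, hr, rfl, h1, h2⟩ := route_spec (k := k) hv hs hne
    simp only [flat_append, flat_cons] at hs ⊢
    rw [auxValid_append, auxValid_cons] at hv
    obtain ⟨-, h3, -, h4⟩ := auxValid_succ_kids hv.2.1 (List.mem_singleton_self e)
    obtain ⟨ih1, ih2⟩ := ih h4 (List.pairwise_append.1 (List.pairwise_append.1 hs).2.1).1
    simp only [lookupEntries, hr, Timed.ret_bind, Timed.time_bind, Timed.time_tick,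
      time_pushDown, ← length_kids]
    refine ⟨?_, ?_⟩
    · change (lookupEntries k h (kids e.2)).ret = _
      rw [ih1, List.find?_append, List.find?_append,
        List.find?_eq_none (l := flat (h + 1) pre).2 (fun x hx => by simpa using (h1 x hx).ne),
        List.find?_eq_none (l := flat (h + 1) post).2 (fun x hx => by simpa using (h2 x hx).ne')]
      simp
    · change _ + (_ + (lookupEntries k h (kids e.2)).time) ≤ _
      rw [add_mul, one_mul]
      omega

/-- Insert a pair into a sorted list of pairs. -/
def insertPair (k : κ) (v : ℕ) (l : List (κ × ℕ)) : List (κ × ℕ) :=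
  (l.filter fun e => e.1 < k) ++ (k, v) :: (l.filter fun e => k < e.1)

theorem insertPair_append {k : κ} {v : ℕ} {l₁ l l₂ : List (κ × ℕ)} (h1 : ∀ x ∈ l₁, x.1 < k)
    (h2 : ∀ x ∈ l₂, k < x.1) :
    insertPair k v (l₁ ++ (l ++ l₂)) = l₁ ++ (insertPair k v l ++ l₂) := by
  have e1 : (l₁.filter fun e => e.1 < k) = l₁ := List.filter_eq_self.2 (by simpa using h1)
  have e2 : (l₂.filter fun e => k < e.1) = l₂ := List.filter_eq_self.2 (by simpa using h2)
  have e3 : (l₁.filter fun e => k < e.1) = [] :=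
    List.filter_eq_nil_iff.2 fun x hx => by simpa using (h1 x hx).le
  have e4 : (l₂.filter fun e => e.1 < k) = [] :=
    List.filter_eq_nil_iff.2 fun x hx => by simpa using (h2 x hx).le
  simp [insertPair, e1, e2, e3, e4]

theorem insertPair_perm {k : κ} {v : ℕ} {l : List (κ × ℕ)} (hk : ∀ x ∈ l, x.1 ≠ k) :
    (insertPair k v l).Perm ((k, v) :: l) := by
  refine List.perm_middle.trans (List.Perm.cons _ ?_)
  refine List.Perm.trans ?_ (List.filter_append_perm (fun e => decide (e.1 < k)) l)
  refine List.Perm.append_left _ (List.Perm.of_eq (List.filter_congr fun x hx => ?_))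
  have := hk x hx
  rcases lt_or_gt_of_ne this with h | h
  · simp [h, h.le]
  · simp [h, h.le]

theorem sortedKeys_insertPair {k : κ} {v : ℕ} {l : List (κ × ℕ)} (hl : SortedKeys l) :
    SortedKeys (insertPair k v l) := by
  refine List.pairwise_append.2 ⟨hl.filter _, List.pairwise_cons.2 ⟨?_, hl.filter _⟩, ?_⟩
  · intro x hx; simpa using (List.mem_filter.1 hx).2
  · intro x hx y hy
    have hx' : x.1 < k := by simpa using (List.mem_filter.1 hx).2
    rcases List.mem_cons.1 hy with rfl | hy
    · exact hx'
    · exact hx'.trans (by simpa using (List.mem_filter.1 hy).2)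

theorem insertEntries_spec {B h : ℕ} (hB : 4 ≤ B) {k : κ} {v : ℕ} {es : Entries κ h}
    (hv : AuxValid B h es) (hs : SortedKeys (flat h es)) (hk : ∀ x ∈ flat h es, x.1 ≠ k)
    (hne : h ≠ 0 → es ≠ []) :
    AuxValid B h (insertEntries B k v h es).ret ∧
      flat h (insertEntries B k v h es).ret = insertPair k v (flat h es) ∧
      es.length ≤ (insertEntries B k v h es).ret.length ∧
      (insertEntries B k v h es).ret.length ≤ es.length + 1 ∧
      (insertEntries B k v h es).time ≤ es.length + 1 + h * (3 * B + 4) := by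
  induction h with
  | zero =>
    have : (insertEntries B k v 0 es).ret.length = es.length + 1 :=
      (insertPair_perm (v := v) hk).length_eq
    refine ⟨trivial, rfl, by omega, by omega, by simp [insertEntries]⟩
  | succ h ih =>
    obtain ⟨pre, e, post, hr, rfl, h1, h2⟩ := route_spec (k := k) hv hs (hne (by simp))
    simp only [flat_append, flat_cons] at hs hk ⊢
    rw [auxValid_append, auxValid_cons] at hv
    obtain ⟨h3, h4, -, h5⟩ := auxValid_succ_kids hv.2.1 (List.mem_singleton_self e)
    obtain ⟨ih1, ih2, ih3, ih4, ih5⟩ := ih h5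
      (List.pairwise_append.1 (List.pairwise_append.1 hs).2.1).1 (fun x hx => hk x (by simp [hx]))
      (fun _ h => by simp [h] at h3; omega)
    obtain ⟨r1, r2, r3⟩ := regroup_spec (by omega) ih1 (by omega) (by omega)
    simp only [insertEntries, hr, Timed.ret_bind, Timed.time_bind, Timed.time_tick,
      time_pushDown, ← length_kids, Timed.ret_pure, Timed.time_pure, time_regroup]
    change AuxValid B (h + 1) (pre ++ (regroup B (insertEntries B k v h (kids e.2)).ret).ret ++ post)
      ∧ flat (h + 1) (pre ++ (regroup B (insertEntries B k v h (kids e.2)).ret).ret ++ post) = _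
      ∧ _ ≤ (pre ++ (regroup B (insertEntries B k v h (kids e.2)).ret).ret ++ post).length
      ∧ (pre ++ (regroup B (insertEntries B k v h (kids e.2)).ret).ret ++ post).length ≤ _
      ∧ _ + (_ + ((insertEntries B k v h (kids e.2)).time +
        ((insertEntries B k v h (kids e.2)).ret.length + 1 + 0))) ≤ _
    refine ⟨?_, ?_, ?_, ?_, ?_⟩
    · rw [auxValid_append, auxValid_append]
      exact ⟨⟨hv.1, r1⟩, hv.2.2⟩
    · rw [flat_append, flat_append, r2, ih2, insertPair_append h1 h2, List.append_assoc]
    · simp only [List.length_append, List.length_cons]; split at r3 <;> omega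
    · simp only [List.length_append, List.length_cons]; split at r3 <;> omega
    · rw [add_mul, one_mul]; omega

theorem deleteEntries_spec {B h : ℕ} (hB : 4 ≤ B) {k : κ} {es : Entries κ h}
    (hv : AuxValid B h es) (hs : SortedKeys (flat h es))
    (hne : h ≠ 0 → 2 ≤ es.length) :
    AuxValid B h (deleteEntries B k h es).ret ∧
      flat h (deleteEntries B k h es).ret = (flat h es).filter (fun x => x.1 ≠ k) ∧
      es.length ≤ (deleteEntries B k h es).ret.length + 1 ∧
      (deleteEntries B k h es).ret.length ≤ es.length ∧
      (deleteEntries B k h es).time ≤ es.length + 1 + h * (5 * B + 5) := by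
  induction h with
  | zero =>
    refine ⟨trivial, rfl, ?_, List.length_filter_le _ _, by simp [deleteEntries]⟩
    change es.length ≤ (es.filter fun e => e.1 ≠ k).length + 1
    have hs' : es.Pairwise fun a b => a.1 < b.1 := hs
    clear hv hs hne
    induction es with
    | nil => simp
    | cons e es ih =>
      rw [List.pairwise_cons] at hs'
      by_cases he : e.1 = k
      · have : (es.filter fun e => e.1 ≠ k) = es :=
          List.filter_eq_self.2 fun x hx => by simpa using (he ▸ hs'.1 x hx).ne'
        rw [List.filter_cons_of_neg (by simpa using he), this, List.length_cons]
      · rw [List.filter_cons_of_pos (by simpa using he)]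
        simpa using ih hs'.2
  | succ h ih =>
    have hlen := hne (by simp)
    obtain ⟨pre, e, post, hr, rfl, h1, h2⟩ := route_spec (k := k) hv hs (by rintro rfl; simp at hlen)
    simp only [flat_append, flat_cons] at hs ⊢
    rw [auxValid_append, auxValid_cons] at hv
    obtain ⟨h3, h4, -, h5⟩ := auxValid_succ_kids hv.2.1 (List.mem_singleton_self e)
    obtain ⟨ih1, ih2, ih3, ih4, ih5⟩ := ih h5
      (List.pairwise_append.1 (List.pairwise_append.1 hs).2.1).1 (fun _ => by omega)
    have e1 : (flat (h + 1) pre).filter (fun x => x.1 ≠ k) = flat (h + 1) pre :=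
      List.filter_eq_self.2 fun x hx => by simpa using (h1 x hx).ne
    have e2 : (flat (h + 1) post).filter (fun x => x.1 ≠ k) = flat (h + 1) post :=
      List.filter_eq_self.2 fun x hx => by simpa using (h2 x hx).ne'
    rw [List.filter_append, List.filter_append, e1, e2]
    have hpush : (pushDown e.2).ret = kids e.2 := rfl
    simp only [deleteEntries, hr, Timed.ret_bind, Timed.time_bind, Timed.time_tick,
      time_pushDown, ← length_kids, hpush]
    rw [add_mul, one_mul]
    rw [List.length_append, List.length_cons] at hlen ⊢
    split
    · obtain ⟨r1, r2, r3⟩ := regroup_spec (by omega) ih1 (by omega) (by omega)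
      rw [if_pos (by omega)] at r3
      simp only [Timed.ret_bind, Timed.time_bind, Timed.ret_pure, Timed.time_pure, time_regroup]
      refine ⟨?_, ?_, ?_, ?_, ?_⟩
      · rw [auxValid_append, auxValid_append]
        exact ⟨⟨hv.1, r1⟩, hv.2.2⟩
      · rw [flat_append, flat_append, r2, ih2, List.append_assoc]
      · simp only [List.length_append]; omega
      · simp only [List.length_append]; omega
      · omega
    · split
      · rename_i s post'
        have hv' := auxValid_cons.1 hv.2.2
        obtain ⟨g3, g4, -, g5⟩ := auxValid_succ_kids hv'.1 (List.mem_singleton_self s)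
        have hpush' : (pushDown s.2).ret = kids s.2 := rfl
        obtain ⟨r1, r2, r3⟩ := regroup_spec (B := B) (by omega) (auxValid_append.2 ⟨ih1, g5⟩)
          (by rw [List.length_append]; omega) (by rw [List.length_append]; omega)
        simp only [Timed.ret_bind, Timed.time_bind, Timed.ret_pure, Timed.time_pure, time_regroup,
          time_pushDown, hpush', ← length_kids]
        refine ⟨?_, ?_, ?_, ?_, ?_⟩
        · rw [auxValid_append, auxValid_append]
          exact ⟨⟨hv.1, r1⟩, hv'.2⟩
        · rw [flat_append, flat_append, r2, flat_append, ih2, flat_cons]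
          simp only [List.append_assoc]
        · simp only [List.length_append, List.length_cons] at r3 ⊢; split at r3 <;> omega
        · simp only [List.length_append, List.length_cons] at r3 ⊢; split at r3 <;> omega
        · simp only [List.length_append]; omega
      · rename_i s hlast
        obtain ⟨pre', rfl⟩ := List.getLast?_eq_some_iff.1 hlast
        rw [auxValid_append] at hv
        obtain ⟨g3, g4, -, g5⟩ := auxValid_succ_kids hv.1.2 (List.mem_singleton_self s)
        have hpush' : (pushDown s.2).ret = kids s.2 := rfl
        obtain ⟨r1, r2, r3⟩ := regroup_spec (B := B) (by omega) (auxValid_append.2 ⟨g5, ih1⟩)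
          (by rw [List.length_append]; omega) (by rw [List.length_append]; omega)
        simp only [Timed.ret_bind, Timed.time_bind, Timed.ret_pure, Timed.time_pure, time_regroup,
          time_pushDown, hpush', ← length_kids, List.dropLast_concat]
        refine ⟨?_, ?_, ?_, ?_, ?_⟩
        · rw [auxValid_append]
          exact ⟨hv.1.1, r1⟩
        · rw [flat_append, r2, flat_append, ih2, flat_append, flat_cons]
          simp [flat]
        · simp only [List.length_append, List.length_cons, List.length_nil] at r3 ⊢
          split at r3 <;> omega
        · simp only [List.length_append, List.length_cons, List.length_nil] at r3 ⊢
          split at r3 <;> omega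
        · simp only [List.length_append, List.length_cons]; omega
      · rename_i hlast
        rw [List.getLast?_eq_none_iff] at hlast
        subst hlast
        simp at hlen

end Order

end AuxiliaryTrees


/-! ### Lazy range assignment -/

section RangeAssignment

variable {κ : Type} [LinearOrder κ]

/-- The effect on a pair of assigning `v` to all keys in `[a, b)`. -/
def setIn (a b : κ) (v : ℕ) (x : κ × ℕ) : κ × ℕ := if a ≤ x.1 ∧ x.1 < b then (x.1, v) else x

/-- The key of the first entry of a list, or `u` if the list is empty: an upper bound for the keys
below the preceding entry. -/
def nextKey {β : Type} (u : WithTop κ) : List (κ × β) → WithTop κ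
  | [] => u
  | e :: _ => e.1

theorem assignList_cons {β : Type} (a b : κ) (full : β → β) (part : WithTop κ → β → Timed β)
    (u : WithTop κ) (e : κ × β) (es : List (κ × β)) {p : Timed β}
    (hp : (if b ≤ e.1 ∨ nextKey u es ≤ (a : WithTop κ) then pure e.2
      else if a ≤ e.1 ∧ nextKey u es ≤ (b : WithTop κ) then pure (full e.2)
      else part (nextKey u es) e.2) = p) :
    assignList a b full part u (e :: es) = ⟨(e.1, p.ret) :: (assignList a b full part u es).ret,
      1 + (p.time + (assignList a b full part u es).time)⟩ := by
  rw [assignList.eq_def]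
  by_cases c1 : b ≤ e.1 ∨ nextKey u es ≤ (a : WithTop κ)
  · rw [if_pos c1] at hp
    cases es <;> simp only [nextKey] at c1 ⊢ <;> rw [if_pos c1, ← hp] <;> rfl
  by_cases c2 : a ≤ e.1 ∧ nextKey u es ≤ (b : WithTop κ)
  · rw [if_neg c1, if_pos c2] at hp
    cases es <;> simp only [nextKey] at c1 c2 ⊢ <;> rw [if_neg c1, if_pos c2, ← hp] <;> rfl
  · rw [if_neg c1, if_neg c2] at hp
    cases es <;> simp only [nextKey] at c1 c2 hp ⊢ <;> rw [if_neg c1, if_neg c2, ← hp] <;> rfl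

/-- How many of the two ends of `[a, b)` lie strictly between `lo` and `u`. -/
def crossings (a b lo : κ) (u : WithTop κ) : ℕ :=
  (if lo < a ∧ (a : WithTop κ) < u then 1 else 0) + (if lo < b ∧ (b : WithTop κ) < u then 1 else 0)

theorem crossings_le_two (a b lo : κ) (u : WithTop κ) : crossings a b lo u ≤ 2 := by
  unfold crossings; split_ifs <;> omega

theorem crossings_mono (a b : κ) {lo lo' : κ} (u : WithTop κ) (h : lo ≤ lo') :
    crossings a b lo' u ≤ crossings a b lo u := by
  unfold crossings
  have h1 : lo' < a → lo < a := h.trans_lt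
  have h2 : lo' < b → lo < b := h.trans_lt
  grind

theorem crossings_add_le (a b : κ) {lo m : κ} {u : WithTop κ} (h : lo ≤ m)
    (hm : (m : WithTop κ) ≤ u) :
    crossings a b lo m + crossings a b m u ≤ crossings a b lo u := by
  have key : ∀ c : κ, (if lo < c ∧ (c : WithTop κ) < m then 1 else 0) +
      (if m < c ∧ (c : WithTop κ) < u then 1 else 0) ≤
      (if lo < c ∧ (c : WithTop κ) < u then 1 else 0) := by
    intro c
    simp only [WithTop.coe_lt_coe]
    have h1 : m < c → lo < c := h.trans_lt
    have h2 : c < m → (c : WithTop κ) < u := fun hc => (WithTop.coe_lt_coe.2 hc).trans_le hm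
    have h3 : c < m → ¬ m < c := fun h h' => lt_asymm h h'
    grind
  have := key a
  have := key b
  unfold crossings
  omega

theorem one_le_crossings {a b lo : κ} {u : WithTop κ} (h1 : ¬(b ≤ lo ∨ u ≤ (a : WithTop κ)))
    (h2 : ¬(a ≤ lo ∧ u ≤ (b : WithTop κ))) : 1 ≤ crossings a b lo u := by
  unfold crossings
  simp only [not_or, not_le, not_and_or] at h1 h2
  rcases h2 with h2 | h2
  · rw [if_pos ⟨h2, h1.2⟩]; omega
  · rw [if_pos (c := lo < b ∧ _) ⟨h1.1, h2⟩]; omega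

/-- Range assignment acts on the represented pairs as expected and keeps the shape of the tree.  At
each height, it enters only the nodes whose key range has an end of `[a, b)` in its interior. -/
theorem assignEntries_spec {B h : ℕ} {a b : κ} {v : ℕ} {u : WithTop κ} {es : Entries κ h}
    (hv : AuxValid B h es) (hs : SortedKeys (flat h es))
    (hu : ∀ x ∈ flat h es, (x.1 : WithTop κ) < u) :
    (assignEntries a b v h u es).ret.map Prod.fst = es.map Prod.fst ∧
    AuxValid B h (assignEntries a b v h u es).ret ∧
    flat h (assignEntries a b v h u es).ret = (flat h es).map (setIn a b v) ∧
    ∀ lo, (∀ k ∈ (es.map Prod.fst).head?, lo ≤ k) →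
      (assignEntries a b v h u es).time ≤
        es.length + 1 + crossings a b lo u * (h * (2 * B + 2)) := by
  induction h generalizing u with
  | zero =>
    refine ⟨?_, trivial, rfl, fun lo _ => by simp [assignEntries]⟩
    simp only [assignEntries, List.map_map]
    refine List.map_congr_left fun e _ => ?_
    simp only [Function.comp_apply]
    split <;> rfl
  | succ h ih =>
    rw [assignEntries]
    induction es with
    | nil => exact ⟨rfl, fun e he => by simp [assignList] at he, rfl, fun lo _ => by simp [assignList]⟩
    | cons e es ihes =>
      rw [flat_cons] at hs hu
      rw [auxValid_cons] at hv
      obtain ⟨k1, k2, k3, k4⟩ := auxValid_succ_kids hv.1 (List.mem_singleton_self e)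
      obtain ⟨hs1, hs2, hs3⟩ := List.pairwise_append.1 hs
      obtain ⟨i1, i2, i3, i4⟩ := ihes hv.2 hs2 (fun x hx => hu x (List.mem_append_right _ hx))
      set ub : WithTop κ := nextKey u es with hub
      have hxub : ∀ x ∈ flat h (kids e.2), (x.1 : WithTop κ) < ub := by
        intro x hx
        cases es with
        | nil => exact hu x (List.mem_append_left _ hx)
        | cons e' es' =>
          rw [auxValid_cons (es := es')] at hv
          obtain ⟨y, hy, hy'⟩ := exists_mem_flat_kids hv.2.1
          simp only [hub, nextKey]
          rw [WithTop.coe_lt_coe, ← hy']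
          exact hs3 x hx y (by rw [flat_cons]; exact List.mem_append_left _ hy)
      obtain ⟨j1, j2, j3, j4⟩ := ih k4 hs1 hxub
      have hlow : ∀ x ∈ flat h (kids e.2), e.1 ≤ x.1 := fun x hx => entry_le_of_mem hv.1 hs1 hx
      set part : WithTop κ → Payload κ (h + 1) → Timed (Payload κ (h + 1)) := fun ub p => do
        let cs ← pushDown p
        let cs' ← assignEntries a b v h ub cs
        pure ((none, cs') : Option ℕ × Entries κ h) with hpart
      -- the entry `e` alone
      have child : ∃ p : Timed (Payload κ (h + 1)),
          (if b ≤ e.1 ∨ ub ≤ (a : WithTop κ) then pure e.2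
            else if a ≤ e.1 ∧ ub ≤ (b : WithTop κ) then pure (assign v (h + 1) e.2)
            else part ub e.2) = p ∧
          AuxValid B (h + 1) [(e.1, p.ret)] ∧
          flat h (kids p.ret) = (flat h (kids e.2)).map (setIn a b v) ∧
          p.time ≤ crossings a b e.1 ub * ((h + 1) * (2 * B + 2)) := by
        refine ⟨_, rfl, ?_⟩
        split_ifs with c1 c2
        · refine ⟨hv.1, ?_, Nat.zero_le _⟩
          refine (List.map_id _).symm.trans (List.map_congr_left fun x hx => ?_)
          rw [id, setIn, if_neg]
          rintro ⟨h1, h2⟩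
          rcases c1 with c1 | c1
          · exact absurd h2 (not_lt.2 (c1.trans (hlow x hx)))
          · exact absurd (WithTop.coe_le_coe.2 h1) (not_le.2 ((hxub x hx).trans_le c1))
        · refine ⟨?_, ?_, Nat.zero_le _⟩
          · intro e' he'
            rw [List.mem_singleton] at he'
            subst he'
            exact hv.1 e (List.mem_singleton_self e)
          · rw [Timed.ret_pure, kids_assign, flat_assignAll]
            have : ∀ x ∈ flat h (kids e.2), setIn a b v x = (x.1, v) := by
              intro x hx
              rw [setIn, if_pos]
              exact ⟨c2.1.trans (hlow x hx), WithTop.coe_lt_coe.1 ((hxub x hx).trans_le c2.2)⟩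
            rw [List.map_congr_left this]
            rcases kids_cases e.2 with h' | ⟨w, h'⟩
            · rw [h']
            · rw [h', flat_assignAll, List.map_map]; rfl
        · have hlen := congrArg List.length j1
          rw [List.length_map, List.length_map] at hlen
          refine ⟨?_, j3, ?_⟩
          · intro e' he'
            rw [List.mem_singleton] at he'
            subst he'
            change B ≤ 2 * (assignEntries a b v h ub (kids e.2)).ret.length ∧
              (assignEntries a b v h ub (kids e.2)).ret.length ≤ B ∧
              ((assignEntries a b v h ub (kids e.2)).ret.map Prod.fst).head? = some e.1 ∧
              AuxValid B h (assignEntries a b v h ub (kids e.2)).ret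
            rw [hlen, j1]
            exact ⟨k1, k2, k3, j2⟩
          · have j5 := j4 e.1 (fun k hk => by rw [k3] at hk; exact (Option.some.inj hk).le)
            have c3 := one_le_crossings c1 c2
            rw [hpart]
            simp only [Timed.time_bind, time_pushDown, ← length_kids]
            change (kids e.2).length + 1 + ((assignEntries a b v h ub (kids e.2)).time + 0) ≤ _
            calc _ ≤ 1 * (2 * B + 2) + crossings a b e.1 ub * (h * (2 * B + 2)) := by omega
              _ ≤ crossings a b e.1 ub * (2 * B + 2) + crossings a b e.1 ub * (h * (2 * B + 2)) :=
                Nat.add_le_add_right (Nat.mul_le_mul_right _ c3) _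
              _ = _ := by ring
      obtain ⟨p, hp, p1, p2, p3⟩ := child
      rw [assignList_cons _ _ _ _ _ _ _ hp]
      dsimp only
      refine ⟨by simpa using i1, auxValid_cons.2 ⟨p1, i2⟩, ?_, ?_⟩
      · rw [flat_cons, flat_cons, List.map_append, p2, i3]
      · intro lo hlo
        have hlo' : lo ≤ e.1 := hlo e.1 rfl
        have c1 := crossings_mono a b u hlo'
        have hle : crossings a b lo u * ((h + 1) * (2 * B + 2)) ≥
            crossings a b e.1 u * ((h + 1) * (2 * B + 2)) := Nat.mul_le_mul_right _ c1
        rw [List.length_cons]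
        cases es with
        | nil =>
          have : (assignList a b (assign v (h + 1)) part u []).time = 0 := rfl
          rw [this]
          simp only [hub, nextKey] at p3
          simp only [List.length_nil]
          omega
        | cons e' es' =>
          have i5 := i4 e'.1 (fun k hk => (Option.some.inj hk).le)
          have hee : e.1 ≤ e'.1 := by
            rw [auxValid_cons (es := es')] at hv
            obtain ⟨x, hx, hx'⟩ := exists_mem_flat_kids hv.1
            have := hxub x hx
            rw [hx'] at this
            exact (WithTop.coe_lt_coe.1 this).le
          have heu : (e'.1 : WithTop κ) ≤ u := by
            rw [auxValid_cons (es := es')] at hv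
            obtain ⟨y, hy, hy'⟩ := exists_mem_flat_kids hv.2.1
            rw [← hy']
            exact (hu y (List.mem_append_right _ (by rw [flat_cons]; simp [hy]))).le
          have c2 := crossings_add_le a b hee heu
          have c3 : (crossings a b e.1 e'.1 + crossings a b e'.1 u) * ((h + 1) * (2 * B + 2)) ≤
            crossings a b e.1 u * ((h + 1) * (2 * B + 2)) := Nat.mul_le_mul_right _ c2
          rw [add_mul] at c3
          simp only [hub, nextKey] at p3
          omega

end RangeAssignment

/-! ### Auxiliary B+ trees -/

section AuxTrees

variable {κ : Type} [LinearOrder κ]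

/-- The auxiliary B+ tree `T` has the right shape and represents the list `l` of pairs. -/
structure AuxTree.Represents (B : ℕ) (T : AuxTree κ) (l : List (κ × ℕ)) : Prop where
  flat_eq : flat T.height T.root = l
  sorted : SortedKeys l
  valid : AuxValid B T.height T.root
  length_le : T.root.length ≤ B
  two_le : T.height ≠ 0 → 2 ≤ T.root.length

namespace AuxTree

variable {B : ℕ} {T : AuxTree κ} {l : List (κ × ℕ)}

theorem represents_empty (B : ℕ) : (AuxTree.empty : AuxTree κ).Represents B [] :=
  ⟨rfl, List.Pairwise.nil, trivial, Nat.zero_le _, fun h => absurd rfl h⟩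

/-- The height of an auxiliary tree is at most logarithmic: all nodes apart from the root have at
least `B / 2 ≥ √B` entries. -/
theorem Represents.pow_height_le (hT : T.Represents B l) (hB : 4 ≤ B) :
    B ^ T.height ≤ (max 2 l.length) ^ 2 := by
  rcases eq_or_ne T.height 0 with h0 | h0
  · rw [h0, pow_zero]
    exact Nat.one_le_pow _ _ (by omega)
  have h1 := length_mul_pow_le hT.valid
  rw [hT.flat_eq] at h1
  have h2 := hT.two_le h0
  have h3 : B ^ T.height ≤ l.length * 2 ^ T.height :=
    (Nat.le_mul_of_pos_left _ (by omega)).trans h1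
  have h4 : (2 ^ T.height) ^ 2 ≤ B ^ T.height := by
    rw [← pow_mul, mul_comm, pow_mul]
    exact Nat.pow_le_pow_left hB _
  have h5 : B ^ T.height * B ^ T.height ≤ l.length ^ 2 * B ^ T.height := by
    calc B ^ T.height * B ^ T.height ≤ (l.length * 2 ^ T.height) * (l.length * 2 ^ T.height) :=
          Nat.mul_le_mul h3 h3
      _ = l.length ^ 2 * (2 ^ T.height) ^ 2 := by ring
      _ ≤ _ := Nat.mul_le_mul_left _ h4
  exact (Nat.le_of_mul_le_mul_right h5 (by positivity)).trans
    (Nat.pow_le_pow_left (le_max_right _ _) 2)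

theorem Represents.lookup_eq_some_iff (hT : T.Represents B l) {k : κ} {v : ℕ} :
    (T.lookup k).ret = some v ↔ (k, v) ∈ l := by
  have h := (lookupEntries_spec (k := k) hT.valid (hT.flat_eq ▸ hT.sorted)).1
  rw [hT.flat_eq] at h
  rw [AuxTree.lookup, h]
  have hs := hT.sorted
  clear h hT
  induction l with
  | nil => simp
  | cons x l ih =>
    obtain ⟨h1, h2⟩ := List.pairwise_cons.1 hs
    by_cases hx : x.1 = k
    · rw [List.find?_cons_of_pos (by simpa using hx)]
      simp only [Option.map_some, Option.some.injEq, List.mem_cons]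
      refine ⟨fun h => Or.inl (by rw [← hx, ← h]), ?_⟩
      rintro (h | h)
      · rw [← h]
      · exact absurd (h1 _ h) (by simp [hx])
    · rw [List.find?_cons_of_neg (by simpa using hx), List.mem_cons]
      refine (ih h2).trans ⟨Or.inr, ?_⟩
      rintro (h | h)
      · exact absurd (by rw [← h]) hx
      · exact h

theorem Represents.time_lookup_le (hT : T.Represents B l) (k : κ) :
    (T.lookup k).time ≤ (T.height + 1) * (5 * B + 6) := by
  have h := (lookupEntries_spec (k := k) hT.valid (hT.flat_eq ▸ hT.sorted)).2
  have := hT.length_le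
  rw [AuxTree.lookup]
  have : T.height * (2 * B + 2) ≤ T.height * (5 * B + 6) := Nat.mul_le_mul_left _ (by omega)
  rw [add_mul]
  omega

theorem Represents.insert (hT : T.Represents B l) (hB : 4 ≤ B) {k : κ} (v : ℕ)
    (hk : ∀ x ∈ l, x.1 ≠ k) : (T.insert B k v).ret.Represents B (insertPair k v l) ∧
      (T.insert B k v).time ≤ (T.height + 1) * (5 * B + 6) := by
  obtain ⟨h1, h2, h3, h4, h5⟩ := insertEntries_spec (v := v) hB hT.valid
    (hT.flat_eq ▸ hT.sorted) (hT.flat_eq ▸ hk) (fun h => by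
      have := hT.two_le h; rintro h; simp [h] at this)
  rw [hT.flat_eq] at h2
  have hlen := hT.length_le
  have hmul : T.height * (3 * B + 4) ≤ T.height * (5 * B + 6) := Nat.mul_le_mul_left _ (by omega)
  rw [add_mul]
  unfold AuxTree.insert
  simp only [Timed.ret_bind, Timed.time_bind]
  split
  · simp only [Timed.ret_pure, Timed.time_pure]
    exact ⟨⟨h2, sortedKeys_insertPair hT.sorted, h1, by assumption,
      fun h => (hT.two_le h).trans h3⟩, by omega⟩
  · obtain ⟨r1, r2, r3⟩ := regroup_spec (B := B) (by omega) h1 (by omega) (by omega)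
    rw [if_neg (by assumption)] at r3
    simp only [Timed.ret_bind, Timed.time_bind, Timed.ret_pure, Timed.time_pure, time_regroup]
    exact ⟨⟨r2.trans h2, sortedKeys_insertPair hT.sorted, r1, by dsimp only; omega,
      fun _ => by dsimp only; omega⟩, by omega⟩

theorem represents_collapseRoot {h : ℕ} {es : Entries κ h} (hs : SortedKeys (flat h es))
    (hv : AuxValid B h es) (hle : es.length ≤ B) (hB : 4 ≤ B) (hpos : h ≠ 0 → 1 ≤ es.length) :
    (collapseRoot h es).ret.Represents B (flat h es) ∧ (collapseRoot h es).time ≤ B + 1 := by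
  cases h with
  | zero => exact ⟨⟨rfl, hs, hv, hle, fun h => absurd rfl h⟩, Nat.zero_le _⟩
  | succ h =>
    match es with
    | [] => simp at hpos
    | [e] =>
      obtain ⟨k1, k2, -, k4⟩ := auxValid_succ_kids hv (List.mem_singleton_self e)
      have hfl : flat h (kids e.2) = flat (h + 1) [e] := by simp [flat]
      refine ⟨⟨hfl, hs, k4, k2, fun _ => ?_⟩, ?_⟩
      · change 2 ≤ (kids e.2).length; omega
      · change (rawKids e.2).length + 1 + 0 ≤ _
        rw [← length_kids]; omega
    | e :: e' :: es' =>
      exact ⟨⟨rfl, hs, hv, hle, fun _ => by simp [collapseRoot]⟩, Nat.zero_le _⟩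

theorem Represents.delete (hT : T.Represents B l) (hB : 4 ≤ B) (k : κ) :
    (T.delete B k).ret.Represents B (l.filter fun x => x.1 ≠ k) ∧
      (T.delete B k).time ≤ (T.height + 1) * (5 * B + 6) := by
  obtain ⟨h1, h2, h3, h4, h5⟩ := deleteEntries_spec (k := k) hB hT.valid
    (hT.flat_eq ▸ hT.sorted) hT.two_le
  rw [hT.flat_eq] at h2
  have hlen := hT.length_le
  have hmul : T.height * (5 * B + 5) ≤ T.height * (5 * B + 6) := Nat.mul_le_mul_left _ (by omega)
  obtain ⟨c1, c2⟩ := represents_collapseRoot (B := B) (h2 ▸ hT.sorted.filter _) h1 (by omega) hB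
    (fun h => by have := hT.two_le h; omega)
  rw [h2] at c1
  unfold AuxTree.delete
  simp only [Timed.ret_bind, Timed.time_bind]
  refine ⟨c1, ?_⟩
  rw [add_mul]
  omega

theorem Represents.assignRange (hT : T.Represents B l) (a b : κ) (v : ℕ) :
    (T.assignRange a b v).ret.Represents B (l.map (setIn a b v)) ∧
      (T.assignRange a b v).time ≤ (T.height + 1) * (5 * B + 6) := by
  obtain ⟨h1, h2, h3, h4⟩ := assignEntries_spec (a := a) (b := b) (v := v) (u := ⊤) hT.valid
    (hT.flat_eq ▸ hT.sorted) (fun x _ => WithTop.coe_lt_top _)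
  rw [hT.flat_eq] at h3
  have hlen := congrArg List.length h1
  rw [List.length_map, List.length_map] at hlen
  have hle := hT.length_le
  unfold AuxTree.assignRange
  simp only [Timed.ret_bind, Timed.time_bind, Timed.ret_pure, Timed.time_pure]
  refine ⟨⟨h3, ?_, h2, hlen ▸ hle, fun h => hlen ▸ hT.two_le h⟩, ?_⟩
  · refine List.pairwise_map.2 (hT.sorted.imp fun {x y} hxy => ?_)
    unfold setIn
    split_ifs <;> exact hxy
  · have key : ∃ lo, ∀ k ∈ (T.root.map Prod.fst).head?, lo ≤ k := by
      cases T.root with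
      | nil => exact ⟨a, by simp⟩
      | cons e es => exact ⟨e.1, by simp⟩
    obtain ⟨lo, hlo⟩ := key
    have h5 := h4 lo hlo
    have h6 : crossings a b lo ⊤ * (T.height * (2 * B + 2)) ≤ 2 * (T.height * (2 * B + 2)) :=
      Nat.mul_le_mul_right _ (crossings_le_two _ _ _ _)
    have h7 : T.height * (4 * B + 4) ≤ T.height * (5 * B + 6) := Nat.mul_le_mul_left _ (by omega)
    have h8 : 2 * (T.height * (2 * B + 2)) = T.height * (4 * B + 4) := by ring
    rw [add_mul]
    omega

end AuxTree

end AuxTrees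


/-! ### Reasoning about programs -/

section Programs

variable {α β γ : Type}

/-- Execute a program. -/
def exec (p : Prog α β) (m : Mem α) : β × Mem α := p m

/-- From every initial memory, the result `b` of the program and the number `k` of steps that it
takes satisfy `Q b k`. -/
def Runs (p : Prog α β) (Q : β → ℕ → Prop) : Prop :=
  ∀ m : Mem α, ∃ k, (exec p m).2.steps = m.steps + k ∧ Q (exec p m).1 k

namespace Runs

variable {Q : γ → ℕ → Prop}

theorem mono {p : Prog α β} {P Q : β → ℕ → Prop} (hp : Runs p P) (h : ∀ b k, P b k → Q b k) :
    Runs p Q := fun m => by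
  obtain ⟨k, h1, h2⟩ := hp m
  exact ⟨k, h1, h _ _ h2⟩

theorem pure {b : γ} (h : Q b 0) : Runs (pure b : Prog α γ) Q := fun _ => ⟨0, rfl, h⟩

theorem bind {p : Prog α β} {f : β → Prog α γ} {P : β → ℕ → Prop} (hp : Runs p P)
    (hf : ∀ b k, P b k → Runs (f b) fun c k' => Q c (k + k')) : Runs (p >>= f) Q := fun m => by
  obtain ⟨k, h1, h2⟩ := hp m
  obtain ⟨k', h3, h4⟩ := hf _ _ h2 (exec p m).2
  exact ⟨k + k', by rw [← add_assoc, ← h1]; exact h3, h4⟩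

theorem tick_bind {n : ℕ} {f : Unit → Prog α γ} (h : Runs (f ()) fun c k => Q c (n + k)) :
    Runs (tick n >>= f) Q :=
  bind (P := fun _ k => k = n) (fun _ => ⟨n, rfl, rfl⟩) fun _ _ hk => hk ▸ h

theorem liftTimed_bind {t : Timed β} {f : β → Prog α γ}
    (h : Runs (f t.ret) fun c k => Q c (t.time + k)) : Runs (liftTimed t >>= f) Q :=
  bind (P := fun b k => b = t.ret ∧ k = t.time) (fun _ => ⟨t.time, rfl, rfl, rfl⟩)
    fun _ _ hk => by rw [hk.1, hk.2]; exact h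

theorem freshId_bind {f : ℕ → Prog α γ} (h : ∀ i, Runs (f i) fun c k => Q c (1 + k)) :
    Runs (freshId >>= f) Q :=
  bind (P := fun _ k => k = 1) (fun _ => ⟨1, rfl, rfl⟩) fun i _ hk => hk ▸ h i

theorem store_bind {B i : ℕ} {t : Tree α i} {f : Unit → Prog α γ}
    (h : Runs (f ()) fun c k => Q c (2 * B + k)) : Runs (store B i t >>= f) Q :=
  bind (P := fun _ k => k = 2 * B) (fun _ => ⟨2 * B, rfl, rfl⟩) fun _ _ hk => hk ▸ h

theorem mapM {f : γ → Prog α β} {l : List γ} {P : γ → β → Prop} {C : ℕ}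
    (h : ∀ x ∈ l, Runs (f x) fun b k => P x b ∧ k ≤ C) :
    Runs (l.mapM f) fun bs k => List.Forall₂ P l bs ∧ k ≤ l.length * C := by
  induction l with
  | nil => rw [List.mapM_nil]; exact pure ⟨List.Forall₂.nil, by simp⟩
  | cons x l ih =>
    rw [List.mapM_cons]
    refine bind (h x List.mem_cons_self) fun b k hb => ?_
    refine bind (ih fun y hy => h y (List.mem_cons_of_mem _ hy)) fun bs k' hbs => ?_
    refine pure ⟨List.Forall₂.cons hb.1 hbs.1, ?_⟩
    have := hb.2
    have := hbs.2
    rw [List.length_cons, add_mul, one_mul]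
    omega

end Runs

end Programs

/-! ### Weight-balanced trees -/

section Nodes

variable {α : Type}

/-- The pairs in a slot of a node of height `h`. -/
def slotItems : (h : ℕ) → Slot α h → List α
  | 0, x => [x]
  | h + 1, t => items h t

theorem items_eq_flatMap {h : ℕ} (t : Tree α h) : items h t = t.slots.flatMap (slotItems h) := by
  cases h with
  | zero => exact (List.flatMap_singleton' (l := t.slots)).symm
  | succ h => rfl

/-- How much the weights of the proper descendants of a node fall short of half of their capacities,
counted twice.  Up to a factor, this is the part of the potential that pays for the repair of
imbalanced nodes. -/
def deficit (B : ℕ) : (h : ℕ) → Tree α h → ℕ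
  | 0, _ => 0
  | h + 1, t => (t.slots.map fun c : Tree α h => (B ^ (h + 1) - 2 * c.wt) + deficit B h c).sum

/-- The contribution of a node to the deficit of its parent. -/
def nodeDeficit (B : ℕ) {h : ℕ} (c : Tree α h) : ℕ := (B ^ (h + 1) - 2 * c.wt) + deficit B h c

/-- The contribution of a slot of a node of height `h` to its deficit. -/
def slotDeficit (B : ℕ) : (h : ℕ) → Slot α h → ℕ
  | 0, _ => 0
  | h + 1, c => nodeDeficit B (h := h) c

theorem deficit_eq_sum {B h : ℕ} (t : Tree α h) :
    deficit B h t = (t.slots.map (slotDeficit B h)).sum := by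
  cases h with
  | zero =>
    refine (List.sum_eq_zero fun x hx => ?_).symm
    obtain ⟨s, -, rfl⟩ := List.mem_map.1 hx
    rfl
  | succ h => rfl

theorem deficit_succ {B h : ℕ} (t : Tree α (h + 1)) :
    deficit B (h + 1) t = (List.map (nodeDeficit B) (t.slots : List (Tree α h))).sum := rfl

theorem pow_le_slotDeficit {B h : ℕ} (s : Slot α h) : B ^ h ≤ slotDeficit B h s + 2 * slotWt h s := by
  cases h with
  | zero => simp [slotWt]
  | succ h =>
    change B ^ (h + 1) ≤ (B ^ (h + 1) - 2 * QNode.wt s) + deficit B h s + 2 * QNode.wt s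
    omega

theorem length_mul_pow_le_deficit {B h : ℕ} (l : List (Slot α h)) :
    l.length * B ^ h ≤ (l.map (slotDeficit B h)).sum + 2 * (l.map (slotWt h)).sum := by
  induction l with
  | nil => simp
  | cons s l ih =>
    have := pow_le_slotDeficit (B := B) s
    simp only [List.length_cons, List.map_cons, List.sum_cons, add_mul, one_mul]
    omega

variable [LinearOrder α]

/-- What is required of a slot of a node of height `h`: nothing of a pair in a leaf, and of a child
that it is well formed and balanced. -/
def SlotOk (B : ℕ) : (h : ℕ) → Slot α h → Prop
  | 0, _ => True
  | h + 1, t => WellFormed B h t ∧ QNode.lo t ≤ QNode.hi t ∧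
      B ^ (h + 1) ≤ 4 * QNode.wt t ∧ QNode.wt t ≤ B ^ (h + 1)

theorem slotOk_succ {B h : ℕ} {t : Tree α h} : SlotOk B (h + 1) t ↔ WellFormed B h t ∧
    t.lo ≤ t.hi ∧ B ^ (h + 1) ≤ 4 * t.wt ∧ t.wt ≤ B ^ (h + 1) := Iff.rfl

/-- Well-formedness, in the same words for leaves and for internal nodes. -/
theorem wellFormed_iff {B h : ℕ} {t : Tree α h} : WellFormed B h t ↔
    t.slots.length ≤ B ∧ t.wt = (items h t).length ∧
    t.slots.Pairwise (fun u v => slotHi h u < slotLo h v) ∧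
    ∀ s ∈ t.slots, SlotOk B h s ∧ t.lo ≤ slotLo h s ∧ slotHi h s ≤ t.hi := by
  cases h with
  | zero =>
    simp only [WellFormed, SlotOk, items, slotHi, slotLo, true_and]
    exact Iff.rfl
  | succ h =>
    refine and_congr_right fun _ => and_congr_right fun _ => and_congr_right fun _ =>
      forall₂_congr fun c _ => ?_
    exact ⟨fun ⟨h1, h2, h3, h4, h5, h6⟩ => ⟨⟨h1, h3, h5, h6⟩, h2, h4⟩,
      fun ⟨⟨h1, h3, h5, h6⟩, h2, h4⟩ => ⟨h1, h2, h3, h4, h5, h6⟩⟩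

theorem weightBalanced_iff {B h : ℕ} {t : Tree α h} : WeightBalanced B h t ↔
    WellFormed B h t ∧ 1 ≤ t.slots.length ∧ (h ≠ 0 → 2 ≤ t.slots.length) := by
  cases h with
  | zero => simp [WeightBalanced]
  | succ h =>
    exact and_congr_right fun _ => ⟨fun h => ⟨by omega, fun _ => h⟩, fun h => h.2 (by simp)⟩

namespace SlotOk

variable {B h : ℕ} {s : Slot α h}

theorem lo_le_hi (hs : SlotOk B h s) : slotLo h s ≤ slotHi h s := by
  cases h with
  | zero => exact le_refl _
  | succ h => exact hs.2.1

theorem pow_le (hs : SlotOk B h s) : B ^ h ≤ 4 * slotWt h s := by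
  cases h with
  | zero => simp [slotWt]
  | succ h => exact hs.2.2.1

theorem le_pow (hs : SlotOk B h s) : slotWt h s ≤ B ^ h := by
  cases h with
  | zero => simp [slotWt]
  | succ h => exact hs.2.2.2

theorem wt_eq (hs : SlotOk B h s) : slotWt h s = (slotItems h s).length := by
  cases h with
  | zero => rfl
  | succ h => exact (wellFormed_iff.1 hs.1).2.1

end SlotOk

theorem sum_slotWt {B h : ℕ} {l : List (Slot α h)} (hl : ∀ s ∈ l, SlotOk B h s) :
    (l.map (slotWt h)).sum = (l.flatMap (slotItems h)).length := by
  rw [List.length_flatMap, List.map_congr_left fun s hs => (hl s hs).wt_eq]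

namespace WellFormed

variable {B h : ℕ} {t : Tree α h}

theorem length_le (ht : WellFormed B h t) : t.slots.length ≤ B := (wellFormed_iff.1 ht).1

theorem wt_eq (ht : WellFormed B h t) : t.wt = (items h t).length := (wellFormed_iff.1 ht).2.1

theorem slotOk (ht : WellFormed B h t) {s : Slot α h} (hs : s ∈ t.slots) : SlotOk B h s :=
  ((wellFormed_iff.1 ht).2.2.2 s hs).1

theorem wt_eq_sum (ht : WellFormed B h t) : t.wt = (t.slots.map (slotWt h)).sum := by
  rw [ht.wt_eq, items_eq_flatMap, sum_slotWt fun s hs => ht.slotOk hs]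

theorem lo_le_and_le_hi {x : α} (ht : WellFormed B h t) (hx : x ∈ items h t) :
    t.lo ≤ x ∧ x ≤ t.hi := by
  induction h with
  | zero => exact ht.2.2.2 x hx
  | succ h ih =>
    obtain ⟨c, hc, hx⟩ := List.mem_flatMap.1 hx
    obtain ⟨h1, h2, -, h4, -⟩ := ht.2.2.2 c hc
    obtain ⟨h5, h6⟩ := ih h1 hx
    exact ⟨h2.trans h5, h6.trans h4⟩

theorem pairwise_items (ht : WellFormed B h t) : (items h t).Pairwise (· < ·) := by
  induction h with
  | zero => exact ht.2.2.1
  | succ h ih =>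
    refine List.pairwise_flatMap.2 ⟨fun c hc => ih (ht.2.2.2 c hc).1, ?_⟩
    refine ht.2.2.1.imp_of_mem fun {u v} hu hv huv x hx y hy => ?_
    exact ((ht.2.2.2 u hu).1.lo_le_and_le_hi hx).2.trans_lt
      (huv.trans_le ((ht.2.2.2 v hv).1.lo_le_and_le_hi hy).1)

theorem wt_le (ht : WellFormed B h t) : t.wt ≤ B ^ (h + 1) := by
  rw [ht.wt_eq_sum, pow_succ']
  refine (List.sum_le_card_nsmul _ (B ^ h) ?_).trans ?_
  · intro x hx
    obtain ⟨s, hs, rfl⟩ := List.mem_map.1 hx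
    exact (ht.slotOk hs).le_pow
  · rw [List.length_map, smul_eq_mul]
    exact Nat.mul_le_mul_right _ ht.length_le

theorem length_mul_pow_le (ht : WellFormed B h t) : t.slots.length * B ^ h ≤ 4 * t.wt := by
  rw [ht.wt_eq_sum]
  have key : ∀ l : List (Slot α h), (∀ s ∈ l, SlotOk B h s) →
      l.length * B ^ h ≤ 4 * (l.map (slotWt h)).sum := by
    intro l hl
    induction l with
    | nil => simp
    | cons s l ih =>
      have h1 := (hl s List.mem_cons_self).pow_le
      have h2 := ih fun s hs => hl s (List.mem_cons_of_mem _ hs)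
      simp only [List.length_cons, List.map_cons, List.sum_cons, add_mul, one_mul]
      omega
  exact key _ fun s hs => ht.slotOk hs

theorem length_mul_pow_le_deficit (ht : WellFormed B h t) :
    t.slots.length * B ^ h ≤ deficit B h t + 2 * t.wt := by
  rw [deficit_eq_sum, ht.wt_eq_sum]
  exact QBTree.length_mul_pow_le_deficit _

end WellFormed

namespace WeightBalanced

variable {B h : ℕ} {t : Tree α h}

theorem wellFormed (ht : WeightBalanced B h t) : WellFormed B h t := (weightBalanced_iff.1 ht).1

/-- The root of a weight-balanced tree is at least half as heavy as a balanced child may be. -/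
theorem pow_le (ht : WeightBalanced B h t) : B ^ h ≤ 2 * t.wt := by
  obtain ⟨h1, h2, h3⟩ := weightBalanced_iff.1 ht
  rcases eq_or_ne h 0 with rfl | h0
  · have := h1.length_mul_pow_le
    simp only [pow_zero, mul_one] at this ⊢
    omega
  · have := h1.length_mul_pow_le
    have := Nat.mul_le_mul_right (B ^ h) (h3 h0)
    omega

theorem two_mul_pow_le (ht : WeightBalanced B h t) : 2 * B ^ h ≤ deficit B h t + 2 * t.wt := by
  obtain ⟨h1, h2, h3⟩ := weightBalanced_iff.1 ht
  rcases eq_or_ne h 0 with rfl | h0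
  · have := h1.length_mul_pow_le
    simp only [pow_zero, mul_one] at this ⊢
    omega
  · exact (Nat.mul_le_mul_right (B ^ h) (h3 h0)).trans h1.length_mul_pow_le_deficit

end WeightBalanced

end Nodes

/-! ### Reading and building trees -/

section CollectBuild

variable {α : Type}

theorem runs_collect {B h : ℕ} (hB : 4 ≤ B) [LinearOrder α] {t : Tree α h}
    (ht : WellFormed B h t) :
    Runs (collect h t) fun l k => l = items h t ∧ k + 2 ≤ 3 * B ^ (h + 1) := by
  induction h with
  | zero =>
    refine Runs.tick_bind (Runs.pure ⟨rfl, ?_⟩)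
    have := ht.length_le
    rw [zero_add, pow_one]
    omega
  | succ h ih =>
    refine Runs.tick_bind (Runs.bind (Runs.mapM (P := fun c l => l = items h c)
      (C := 3 * B ^ (h + 1) - 2) fun c hc => (ih (ht.2.2.2 c hc).1).mono fun b k hk =>
        ⟨hk.1, by omega⟩) fun ls k hk => Runs.pure ⟨?_, ?_⟩)
    · have : ls = t.slots.map (items h) :=
        (List.forall₂_eq_eq_eq ▸ List.forall₂_map_right_iff.2 (hk.1.flip.imp fun _ _ h => h) :)
      rw [this]; rfl
    · have h1 := ht.length_le
      have h3 : k ≤ B * (3 * B ^ (h + 1) - 2) := hk.2.trans (Nat.mul_le_mul_right _ h1)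
      rw [Nat.mul_sub B] at h3
      have h4 : B * (3 * B ^ (h + 1)) = 3 * B ^ (h + 1 + 1) := by ring
      have h5 : B * 2 ≤ B * (3 * B ^ (h + 1)) :=
        Nat.mul_le_mul_left _ (by have := Nat.pow_pos (n := h + 1) (show 0 < B by omega); omega)
      omega

theorem splitEven_spec {k : ℕ} (hk : 0 < k) (l : List α) :
    (splitEven k l).flatten = l ∧ (splitEven k l).length = k ∧
    ∀ p ∈ splitEven k l, (∀ a, k * a ≤ l.length → a ≤ p.length) ∧
      ∀ b, l.length ≤ k * b → p.length ≤ b := by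
  induction k generalizing l with
  | zero => omega
  | succ k ih =>
    set q := l.length / (k + 1) with hq
    have h1 : (k + 1) * q ≤ l.length := Nat.mul_div_le _ _
    have h2 : l.length < (k + 1) * (q + 1) := Nat.lt_mul_div_succ _ (Nat.succ_pos k)
    have h3 : q ≤ l.length := Nat.div_le_self _ _
    rw [splitEven, ← hq]
    have hfirst : (∀ a, (k + 1) * a ≤ l.length → a ≤ (l.take q).length) ∧
        ∀ b, l.length ≤ (k + 1) * b → (l.take q).length ≤ b := by
      rw [List.length_take, min_eq_left h3]
      exact ⟨fun a ha => (Nat.le_div_iff_mul_le (Nat.succ_pos k)).2 (by rwa [mul_comm]),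
        fun b hb => Nat.div_le_of_le_mul hb⟩
    rcases Nat.eq_zero_or_pos k with rfl | hk0
    · have hd : l.take q = l := List.take_of_length_le (by omega)
      refine ⟨by simp [splitEven, hd], rfl, ?_⟩
      intro p hp
      simp only [splitEven, List.mem_cons, List.not_mem_nil, or_false] at hp
      exact hp ▸ hfirst
    · obtain ⟨i1, i2, i3⟩ := ih hk0 (l.drop q)
      refine ⟨by rw [List.flatten_cons, i1, List.take_append_drop], by simp [i2], ?_⟩
      intro p hp
      rcases List.mem_cons.1 hp with rfl | hp
      · exact hfirst
      · obtain ⟨j1, j2⟩ := i3 p hp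
        rw [List.length_drop] at j1 j2
        refine ⟨fun a ha => j1 a ?_, fun b hb => j2 b ?_⟩
        · have : a ≤ q := (Nat.le_div_iff_mul_le (Nat.succ_pos k)).2 (by rwa [mul_comm])
          have := Nat.mul_le_mul_left k this
          rw [add_mul, one_mul] at h1
          omega
        · have hqb : q ≤ b := Nat.div_le_of_le_mul hb
          rw [add_mul, one_mul] at hb
          rcases hqb.eq_or_lt with h | h
          · omega
          · have := Nat.mul_le_mul_left k (show q + 1 ≤ b from h)
            rw [add_mul, one_mul] at h2
            omega

theorem forall₂_pairwise {β γ : Type} {R : β → γ → Prop} {S : β → β → Prop} {S' : γ → γ → Prop}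
    {l : List β} {l' : List γ} (h : List.Forall₂ R l l') (hl : l.Pairwise S)
    (hS : ∀ a b a' b', R a a' → R b b' → S a b → S' a' b') : l'.Pairwise S' := by
  induction h with
  | nil => exact List.Pairwise.nil
  | cons hab h ih =>
    rw [List.pairwise_cons] at hl
    refine List.pairwise_cons.2 ⟨fun c hc => ?_, ih hl.2⟩
    obtain ⟨i, hi, rfl⟩ := List.getElem_of_mem hc
    have hi' := h.length_eq ▸ hi
    exact hS _ _ _ _ hab (h.get hi' hi) (hl.1 _ (List.getElem_mem hi'))

theorem forall₂_exists_left {β γ : Type} {R : β → γ → Prop} {l : List β} {l' : List γ}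
    (h : List.Forall₂ R l l') {c : γ} (hc : c ∈ l') : ∃ b ∈ l, R b c := by
  obtain ⟨i, hi, rfl⟩ := List.getElem_of_mem hc
  have hi' := h.length_eq ▸ hi
  exact ⟨_, List.getElem_mem hi', h.get hi' hi⟩

theorem headD_mem {l : List α} (hl : l ≠ []) (d : α) : l.headD d ∈ l := by
  cases l with
  | nil => exact absurd rfl hl
  | cons x l => simp

theorem getLastD_mem {l : List α} (hl : l ≠ []) (d : α) : l.getLastD d ∈ l := by
  rw [List.getLastD_eq_getLast?, List.getLast?_eq_some_getLast hl]
  exact List.getLast_mem hl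

/-- The pieces on which `build` puts the children of a node are balanced, and their deficits add up
to no more than the deficit of the whole list. -/
theorem splitEven_balanced {B h k : ℕ} (hB : 4 ≤ B) (h4 : 4 ∣ B) {l : List α}
    (hk : k = max 2 ((l.length + B ^ (h + 1) - 1) / B ^ (h + 1)))
    (h1 : l.length ≤ B ^ (h + 2)) (h2 : B ^ (h + 1) ≤ 2 * l.length) :
    k ≤ B ∧ (∀ p ∈ splitEven k l, p.length ≤ B ^ (h + 1) ∧ B ^ (h + 1) ≤ 4 * p.length) ∧
      ((splitEven k l).map fun p => B ^ (h + 1) - 2 * p.length).sum ≤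
        2 * (B ^ (h + 1) - l.length) := by
  obtain ⟨M, hM⟩ : 4 ∣ B ^ (h + 1) := h4.trans (dvd_pow_self B (Nat.succ_ne_zero h))
  have hB1 : B ^ (h + 2) = B * B ^ (h + 1) := pow_succ' B (h + 1)
  have hP0 : 0 < B ^ (h + 1) := Nat.pow_pos (by omega)
  set P := B ^ (h + 1) with hP
  set n := l.length with hn
  rw [hB1] at h1
  obtain ⟨s1, s2, s3⟩ := splitEven_spec (k := k) (by omega) l
  have hq1 : (n + P - 1) / P * P ≤ n + P - 1 := Nat.div_mul_le_self _ _
  have hq2 : n + P - 1 < ((n + P - 1) / P + 1) * P := by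
    rw [mul_comm]; exact Nat.lt_mul_div_succ _ hP0
  have hq3 : n ≤ k * P := by
    have h5 : (n + P - 1) / P * P ≤ k * P := Nat.mul_le_mul_right _ (by omega)
    rw [add_mul, one_mul] at hq2
    omega
  have hkB : k ≤ B := by
    have : (n + P - 1) / P < B + 1 := by
      rw [Nat.div_lt_iff_lt_mul hP0, add_mul, one_mul]
      omega
    omega
  have hup : ∀ p ∈ splitEven k l, p.length ≤ P := fun p hp => (s3 p hp).2 P hq3
  refine ⟨hkB, ?_⟩
  rcases le_or_gt P n with hPn | hPn
  · -- enough pairs for pieces of at least half of the capacity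
    have hlow : ∀ p ∈ splitEven k l, 2 * M ≤ p.length := by
      refine fun p hp => (s3 p hp).1 _ ?_
      have : k * P ≤ 2 * n := by
        rcases le_total 2 ((n + P - 1) / P) with h | h
        · rw [hk, max_eq_right h]; omega
        · rw [hk, max_eq_left h]; omega
      have h6 : k * P = 2 * (k * (2 * M)) := by rw [hM]; ring
      omega
    refine ⟨fun p hp => ⟨hup p hp, by have := hlow p hp; omega⟩, ?_⟩
    rw [List.sum_eq_zero]
    · exact Nat.zero_le _
    · intro x hx
      obtain ⟨p, hp, rfl⟩ := List.mem_map.1 hx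
      have := hlow p hp
      omega
  · -- two pieces, both of at most half of the capacity
    have hk2 : k = 2 := by
      have : (n + P - 1) / P < 2 := by
        rw [Nat.div_lt_iff_lt_mul hP0]
        omega
      omega
    have hlow : ∀ p ∈ splitEven k l, M ≤ p.length ∧ p.length ≤ 2 * M := fun p hp =>
      ⟨(s3 p hp).1 _ (by rw [hk2]; omega), (s3 p hp).2 _ (by rw [hk2]; omega)⟩
    refine ⟨fun p hp => ⟨hup p hp, by have := hlow p hp; omega⟩, ?_⟩
    obtain ⟨p, q, hpq⟩ := List.length_eq_two.1 (s2.trans hk2)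
    have hlen := congrArg List.length s1
    rw [hpq] at hlow hlen ⊢
    simp only [List.flatten_cons, List.flatten_nil, List.append_nil, List.length_append,
      List.mem_cons, List.not_mem_nil, or_false, forall_eq_or_imp, forall_eq] at hlen hlow
    simp only [List.map_cons, List.map_nil, List.sum_cons, List.sum_nil]
    omega

variable [LinearOrder α]

/-- `t` is a weight-balanced tree of height `h` on the sorted list `l` whose deficit is as small as
the length of the list permits. -/
structure BuiltOn (B h : ℕ) (l : List α) (t : Tree α h) : Prop where
  balanced : WeightBalanced B h t
  items_eq : items h t = l
  lo_mem : t.lo ∈ l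
  hi_mem : t.hi ∈ l
  deficit_le : deficit B h t ≤ 2 * (B ^ h - l.length)

namespace BuiltOn

variable {B h : ℕ} {l : List α} {t : Tree α h}

theorem wt_eq (ht : BuiltOn B h l t) : t.wt = l.length := by
  rw [ht.balanced.wellFormed.wt_eq, ht.items_eq]

theorem lo_le_hi (ht : BuiltOn B h l t) : t.lo ≤ t.hi :=
  (ht.balanced.wellFormed.lo_le_and_le_hi (ht.items_eq.symm ▸ ht.hi_mem)).1

end BuiltOn

theorem headD_le {l : List α} (hl : l.Pairwise (· < ·)) (d : α) {x : α} (hx : x ∈ l) :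
    l.headD d ≤ x := by
  cases l with
  | nil => simp at hx
  | cons y l =>
    rcases List.mem_cons.1 hx with rfl | hx
    · exact le_refl _
    · exact (List.rel_of_pairwise_cons hl hx).le

theorem le_getLastD {l : List α} (hl : l.Pairwise (· < ·)) (d : α) {x : α} (hx : x ∈ l) :
    x ≤ l.getLastD d := by
  induction l using List.reverseRecOn with
  | nil => simp at hx
  | append_singleton l y _ =>
    rw [List.getLastD_concat]
    rcases List.mem_append.1 hx with hx | hx
    · exact ((List.pairwise_append.1 hl).2.2 x hx y (by simp)).le
    · exact (List.mem_singleton.1 hx).le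

theorem runs_build {B : ℕ} (hB : 4 ≤ B) (h4 : 4 ∣ B) (d : α) {h : ℕ} {l : List α}
    (hl : l.Pairwise (· < ·)) (h1 : l.length ≤ B ^ (h + 1)) (h2 : B ^ h ≤ 2 * l.length) :
    Runs (build B d h l) fun t k => BuiltOn B h l t ∧ k + 5 ≤ 8 * B ^ (h + 1) := by
  induction h generalizing l with
  | zero =>
    rw [zero_add, pow_one] at h1 ⊢
    have hne : l ≠ [] := by rintro rfl; simp at h2
    refine Runs.tick_bind (Runs.freshId_bind fun i => Runs.store_bind (Runs.pure ⟨?_, ?_⟩))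
    · exact ⟨⟨⟨h1, rfl, hl, fun x hx => ⟨headD_le hl d hx, le_getLastD hl d hx⟩⟩,
        List.length_pos_of_ne_nil hne⟩, rfl, headD_mem hne d, getLastD_mem hne d, Nat.zero_le _⟩
    · omega
  | succ h ih =>
    have hB1 : B ^ (h + 1 + 1) = B * B ^ (h + 1) := pow_succ' B (h + 1)
    have hP0 : 0 < B ^ (h + 1) := Nat.pow_pos (by omega)
    have hne : l ≠ [] := by rintro rfl; simp at h2; omega
    set k := max 2 ((l.length + B ^ (h + 1) - 1) / B ^ (h + 1)) with hk
    obtain ⟨b1, b2, b3⟩ := splitEven_balanced hB h4 hk h1 h2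
    obtain ⟨s1, s2, -⟩ := splitEven_spec (k := k) (by omega) l
    have hpw := s1.symm ▸ hl
    rw [List.pairwise_flatten] at hpw
    have hpow : ∀ p ∈ splitEven k l, B ^ h ≤ p.length := by
      intro p hp
      have h6 := (b2 p hp).2
      rw [pow_succ'] at h6
      have := Nat.mul_le_mul_right (B ^ h) hB
      omega
    rw [build]
    simp only [← hk]
    refine Runs.tick_bind (Runs.bind (Runs.mapM (P := BuiltOn B h) (C := 8 * B ^ (h + 1) - 5)
      fun p hp => (ih (hpw.1 p hp) (b2 p hp).1 (by have := hpow p hp; omega)).mono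
        fun t k hk => ⟨hk.1, by omega⟩) fun cs kc hcs => ?_)
    obtain ⟨hF, hkc⟩ := hcs
    refine Runs.freshId_bind fun i => Runs.store_bind (Runs.pure ⟨?_, ?_⟩)
    · have hitems : cs.map (items h) = splitEven k l :=
        (List.forall₂_eq_eq_eq ▸ List.forall₂_map_right_iff.2
          (hF.imp fun _ _ h => h.items_eq.symm) : splitEven k l = cs.map (items h)).symm
      have hflat : cs.flatMap (items h) = l := by rw [List.flatMap_def, hitems, s1]
      have hlen : cs.length = k := hF.length_eq ▸ s2
      have hsub : ∀ p ∈ splitEven k l, ∀ x ∈ p, x ∈ l := fun p hp x hx =>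
        s1 ▸ List.mem_flatten.2 ⟨p, hp, hx⟩
      refine ⟨⟨⟨hlen.le.trans b1, ?_, ?_, ?_⟩, ?_⟩, hflat, headD_mem hne d, getLastD_mem hne d, ?_⟩
      · change l.length = (cs.flatMap (items h)).length
        rw [hflat]
      · exact forall₂_pairwise hF hpw.2 fun p q u v hu hv hpq => hpq _ hu.hi_mem _ hv.lo_mem
      · intro c hc
        obtain ⟨p, hp, hpc⟩ := forall₂_exists_left hF hc
        refine ⟨hpc.balanced.wellFormed, headD_le hl d (hsub p hp _ hpc.lo_mem), hpc.lo_le_hi,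
          le_getLastD hl d (hsub p hp _ hpc.hi_mem), ?_, ?_⟩
        · rw [hpc.wt_eq]; exact (b2 p hp).2
        · rw [hpc.wt_eq]; exact (b2 p hp).1
      · change 2 ≤ cs.length
        omega
      · refine le_trans ?_ b3
        rw [deficit]
        refine List.Forall₂.sum_le_sum (List.forall₂_map_left_iff.2 (List.forall₂_map_right_iff.2
          ((List.forall₂_and_left _ _ |>.2 ⟨fun p hp => hp, hF⟩).flip.imp ?_)))
        rintro c p ⟨hp, hpc⟩
        have := hpc.deficit_le
        have := hpow p hp
        rw [hpc.wt_eq]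
        omega
    · rw [s2] at hkc
      have h3 : k * (8 * B ^ (h + 1) - 5) ≤ B * (8 * B ^ (h + 1) - 5) :=
        Nat.mul_le_mul_right _ b1
      rw [Nat.mul_sub B] at h3
      have h4 : B * (8 * B ^ (h + 1)) = 8 * B ^ (h + 1 + 1) := by rw [hB1]; ring
      have h5 : B * 5 ≤ B * (8 * B ^ (h + 1)) := Nat.mul_le_mul_left _ (by omega)
      omega

end CollectBuild


/-! ### Repairing adjacent siblings -/

section Siblings

variable {α : Type}

theorem items_concat {h : ℕ} (u v : Tree α h) : items h (concat u v) = items h u ++ items h v := by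
  rw [items_eq_flatMap, items_eq_flatMap, items_eq_flatMap]
  simp [concat]

theorem deficit_concat {B h : ℕ} (u v : Tree α h) :
    deficit B h (concat u v) = deficit B h u + deficit B h v := by
  rw [deficit_eq_sum, deficit_eq_sum, deficit_eq_sum]
  simp [concat]

variable [LinearOrder α]

/-- A list of slots of a node of height `h` whose routing keys are sorted, do not overlap and lie
between `lo` and `hi`. -/
def SlotsOk (B h : ℕ) (lo hi : α) (l : List (Slot α h)) : Prop :=
  l.Pairwise (fun u v => slotHi h u < slotLo h v) ∧
    ∀ s ∈ l, SlotOk B h s ∧ lo ≤ slotLo h s ∧ slotHi h s ≤ hi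

theorem WellFormed.slotsOk {B h : ℕ} {t : Tree α h} (ht : WellFormed B h t) :
    SlotsOk B h t.lo t.hi t.slots := (wellFormed_iff.1 ht).2.2

theorem SlotsOk.wellFormed {B h : ℕ} {t : Tree α h} (ht : SlotsOk B h t.lo t.hi t.slots)
    (h1 : t.slots.length ≤ B) (h2 : t.wt = (t.slots.map (slotWt h)).sum) : WellFormed B h t :=
  wellFormed_iff.2 ⟨h1, by rw [h2, items_eq_flatMap, sum_slotWt fun s hs => (ht.2 s hs).1], ht⟩

namespace SlotsOk

variable {B h : ℕ} {lo hi lo' hi' : α} {l l' : List (Slot α h)}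

theorem mono (hl : SlotsOk B h lo hi l) (h1 : lo' ≤ lo) (h2 : hi ≤ hi') :
    SlotsOk B h lo' hi' l :=
  ⟨hl.1, fun s hs => ⟨(hl.2 s hs).1, h1.trans (hl.2 s hs).2.1, (hl.2 s hs).2.2.trans h2⟩⟩

theorem sublist (hl : SlotsOk B h lo hi l) (h : l'.Sublist l) : SlotsOk B _ lo hi l' :=
  ⟨hl.1.sublist h, fun s hs => hl.2 s (h.subset hs)⟩

theorem singleton {s : Slot α h} (hs : SlotOk B h s) (h1 : lo ≤ slotLo h s)
    (h2 : slotHi h s ≤ hi) : SlotsOk B h lo hi [s] :=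
  ⟨List.pairwise_singleton _ _, fun s' hs' => by rw [List.mem_singleton.1 hs']; exact ⟨hs, h1, h2⟩⟩

theorem append (hl : SlotsOk B h lo hi l) (hl' : SlotsOk B h lo' hi' l') (h : hi < lo')
    (h1 : lo ≤ lo') (h2 : hi ≤ hi') : SlotsOk B _ lo hi' (l ++ l') := by
  refine ⟨List.pairwise_append.2 ⟨hl.1, hl'.1, fun u hu v hv => ?_⟩, fun s hs => ?_⟩
  · exact ((hl.2 u hu).2.2.trans_lt h).trans_le (hl'.2 v hv).2.1
  · rcases List.mem_append.1 hs with hs | hs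
    · exact (hl.mono le_rfl h2).2 s hs
    · exact (hl'.mono h1 le_rfl).2 s hs

/-- Tighten the lower bound to the lower end of the first slot. -/
theorem cons_lo {s : Slot α h} (hl : SlotsOk B h lo hi (s :: l)) :
    SlotsOk B h (slotLo h s) hi (s :: l) := by
  refine ⟨hl.1, fun s' hs' => ⟨(hl.2 s' hs').1, ?_, (hl.2 s' hs').2.2⟩⟩
  rcases List.mem_cons.1 hs' with rfl | hs'
  · exact le_rfl
  · exact (hl.2 s List.mem_cons_self).1.lo_le_hi.trans (List.rel_of_pairwise_cons hl.1 hs').le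

/-- Tighten the upper bound to the upper end of the last slot. -/
theorem concat_hi {s : Slot α h} (hl : SlotsOk B h lo hi (l ++ [s])) :
    SlotsOk B h lo (slotHi h s) (l ++ [s]) := by
  refine ⟨hl.1, fun s' hs' => ⟨(hl.2 s' hs').1, (hl.2 s' hs').2.1, ?_⟩⟩
  rcases List.mem_append.1 hs' with h1 | h1
  · exact ((List.pairwise_append.1 hl.1).2.2 s' h1 s (List.mem_singleton_self s)).le.trans
      (hl.2 s (by simp)).1.lo_le_hi
  · rw [List.mem_singleton.1 h1]

/-- Replace the middle part of a list of slots. -/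
theorem replace {pre r post : List (Slot α h)} (h1 : SlotsOk B h lo hi pre)
    (h2 : SlotsOk B h lo' hi' r) (h3 : SlotsOk B h lo hi post)
    (h4 : ∀ s ∈ pre, slotHi h s < lo') (h5 : ∀ s ∈ post, hi' < slotLo h s) (h6 : lo ≤ lo')
    (h7 : lo' ≤ hi') (h8 : hi' ≤ hi) : SlotsOk B h lo hi (pre ++ r ++ post) := by
  refine ⟨?_, ?_⟩
  · rw [List.append_assoc, List.pairwise_append, List.pairwise_append]
    refine ⟨h1.1, ⟨h2.1, h3.1, fun u hu v hv => (h2.2 u hu).2.2.trans_lt (h5 v hv)⟩, ?_⟩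
    intro u hu v hv
    rcases List.mem_append.1 hv with hv | hv
    · exact (h4 u hu).trans_le (h2.2 v hv).2.1
    · exact ((h4 u hu).trans_le h7).trans (h5 v hv)
  · intro s hs
    rw [List.append_assoc, List.mem_append, List.mem_append] at hs
    rcases hs with hs | hs | hs
    · exact h1.2 s hs
    · exact (h2.mono h6 h8).2 s hs
    · exact h3.2 s hs

end SlotsOk

/-- The outcome `r` of the repair of two adjacent siblings `u`, `v`: one or two balanced nodes with
the same pairs and no larger deficit, up to a constant. -/
structure RepairOf (B : ℕ) {h : ℕ} (u v : Tree α h) (r : List (Tree α h)) : Prop where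
  slotsOk : SlotsOk B (h + 1) u.lo v.hi r
  items_eq : r.flatMap (items h) = items h u ++ items h v
  one_le : 1 ≤ r.length
  le_two : r.length ≤ 2
  of_singleton : ∀ w, r = [w] → WeightBalanced B h w

/-- A node that is out of balance by one pair. -/
structure Imbalanced (B : ℕ) {h : ℕ} (u : Tree α h) : Prop where
  wellFormed : WellFormed B h u
  lo_le_hi : u.lo ≤ u.hi
  lt_pow : 4 * u.wt < B ^ (h + 1)
  pow_le : B ^ (h + 1) ≤ 4 * u.wt + 4

variable {B h : ℕ} {u v : Tree α h}

theorem Imbalanced.length_lt (hu : Imbalanced B u) : u.slots.length < B := by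
  by_contra hlt
  have h1 := hu.wellFormed.length_mul_pow_le
  have h2 := Nat.mul_le_mul_right (B ^ h) (not_lt.1 hlt)
  have h3 := hu.lt_pow
  rw [pow_succ'] at h3
  omega

theorem borrowRight_eq_some (hB : 4 ≤ B) (hu : Imbalanced B u) (hv : SlotOk B (h + 1) v)
    (huv : u.hi < v.lo) {p : Tree α h × Tree α h} (hp : borrowRight B u v = some p) :
    RepairOf B u v [p.1, p.2] ∧ nodeDeficit B p.1 + nodeDeficit B p.2 ≤
      nodeDeficit B u + nodeDeficit B v := by
  obtain ⟨hv1, hv2, hv3, hv4⟩ := slotOk_succ.1 hv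
  have hP : B ^ (h + 1) = B * B ^ h := pow_succ' B h
  have hPB : 4 * B ^ h ≤ B * B ^ h := Nat.mul_le_mul_right _ hB
  have hP0 : 0 < B ^ h := Nat.pow_pos (by omega)
  have hu3 := hu.lt_pow
  have hu4 := hu.pow_le
  unfold borrowRight at hp
  split at hp
  · simp at hp
  rename_i c rest hvs
  split at hp
  · rename_i hc
    simp only [Option.some.injEq] at hp
    subst hp
    have hS := hv1.slotsOk
    have hwv := hv1.wt_eq_sum
    have hlen := hv1.length_le
    have hdv := deficit_eq_sum (B := B) v
    have hiv := items_eq_flatMap v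
    rw [hvs] at hS hwv hlen hdv hiv
    simp only [List.map_cons, List.sum_cons, List.length_cons, List.flatMap_cons] at hwv hlen hdv hiv
    have hcS := hS.2 c List.mem_cons_self
    have hc1 := hcS.1.pow_le
    have hc2 := hcS.1.le_pow
    cases rest with
    | nil => simp only [List.map_nil, List.sum_nil] at hwv; omega
    | cons s rest =>
      have hsS := hS.2 s (by simp)
      have hcs : slotHi h c < slotLo h s := List.rel_of_pairwise_cons hS.1 (by simp)
      set u' : Tree α h := { u with
        slots := u.slots ++ [c], hi := slotHi h c, wt := u.wt + slotWt h c } with hu'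
      set v' : Tree α h := { v with
        slots := s :: rest, lo := slotLo h s, wt := v.wt - slotWt h c } with hv'
      have wu : WellFormed B h u' := by
        refine SlotsOk.wellFormed ?_ ?_ ?_
        · exact hu.wellFormed.slotsOk.append
            (SlotsOk.singleton (lo := v.lo) hcS.1 hcS.2.1 le_rfl) huv (hu.lo_le_hi.trans huv.le)
            (huv.le.trans (hcS.2.1.trans hcS.1.lo_le_hi))
        · have := hu.length_lt
          simp only [hu', List.length_append, List.length_cons, List.length_nil]
          omega
        · simp [hu', hu.wellFormed.wt_eq_sum]
      have wv : WellFormed B h v' := by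
        refine SlotsOk.wellFormed (SlotsOk.cons_lo (hS.sublist (List.sublist_cons_self _ _))) ?_ ?_
        · simp only [hv', List.length_cons] at hlen ⊢; omega
        · simp only [hv', List.map_cons, List.sum_cons] at hwv ⊢; omega
      have su : SlotOk B (h + 1) u' := slotOk_succ.2 ⟨wu,
        hu.lo_le_hi.trans (huv.le.trans (hcS.2.1.trans hcS.1.lo_le_hi)),
        by simp only [hu']; omega, by simp only [hu']; omega⟩
      have sv : SlotOk B (h + 1) v' := slotOk_succ.2 ⟨wv, hsS.1.lo_le_hi.trans hsS.2.2,
        by simp only [hv']; omega, by simp only [hv']; omega⟩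
      refine ⟨⟨?_, ?_, by simp, by simp, by simp⟩, ?_⟩
      · exact (SlotsOk.singleton (lo := u.lo) (hi := slotHi h c) su le_rfl le_rfl).append
          (SlotsOk.singleton (lo := slotLo h s) (hi := v.hi) sv le_rfl le_rfl) hcs
          (hu.lo_le_hi.trans (huv.le.trans (hcS.2.1.trans (hcS.1.lo_le_hi.trans hcs.le))))
          (hcs.le.trans (hsS.1.lo_le_hi.trans hsS.2.2))
      · change List.flatMap (items h) [u', v'] = _
        simp only [List.flatMap_cons, List.flatMap_nil, List.append_nil]
        rw [items_eq_flatMap u', items_eq_flatMap v', items_eq_flatMap u, hiv]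
        simp [hu', hv']
      · change nodeDeficit B u' + nodeDeficit B v' ≤ _
        rw [nodeDeficit, nodeDeficit, nodeDeficit, nodeDeficit,
          deficit_eq_sum u', deficit_eq_sum v', deficit_eq_sum u, hdv]
        simp only [hu', hv', List.map_append, List.sum_append, List.map_cons, List.sum_cons,
          List.map_nil, List.sum_nil]
        omega
  · simp at hp

theorem borrowLeft_eq_some (hB : 4 ≤ B) (hv : Imbalanced B v) (hu : SlotOk B (h + 1) u)
    (huv : u.hi < v.lo) {p : Tree α h × Tree α h} (hp : borrowLeft B u v = some p) :
    RepairOf B u v [p.1, p.2] ∧ nodeDeficit B p.1 + nodeDeficit B p.2 ≤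
      nodeDeficit B u + nodeDeficit B v := by
  obtain ⟨hu1, hu2, hu3, hu4⟩ := slotOk_succ.1 hu
  have hP : B ^ (h + 1) = B * B ^ h := pow_succ' B h
  have hPB : 4 * B ^ h ≤ B * B ^ h := Nat.mul_le_mul_right _ hB
  have hP0 : 0 < B ^ h := Nat.pow_pos (by omega)
  have hv3 := hv.lt_pow
  have hv4 := hv.pow_le
  unfold borrowLeft at hp
  split at hp
  · simp at hp
  rename_i c hlast
  obtain ⟨rest, hus⟩ := List.getLast?_eq_some_iff.1 hlast
  rw [hus, List.dropLast_concat] at hp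
  split at hp
  · rename_i hc
    simp only [Option.some.injEq] at hp
    subst hp
    have hS := hu1.slotsOk
    have hwu := hu1.wt_eq_sum
    have hlen := hu1.length_le
    have hdu := deficit_eq_sum (B := B) u
    have hiu := items_eq_flatMap u
    rw [hus] at hS hwu hlen hdu hiu
    simp only [List.map_append, List.map_cons, List.map_nil, List.sum_append, List.sum_cons,
      List.sum_nil, List.length_append, List.length_cons, List.length_nil] at hwu hlen hdu
    have hcS := hS.2 c (by simp)
    have hc1 := hcS.1.pow_le
    have hc2 := hcS.1.le_pow
    rcases List.eq_nil_or_concat' rest with rfl | ⟨rest, s, rfl⟩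
    · simp only [List.map_nil, List.sum_nil] at hwu; omega
    · have hsS := hS.2 s (by simp)
      have hsc : slotHi h s < slotLo h c := (List.pairwise_append.1 hS.1).2.2 s (by simp) c (by simp)
      set u' : Tree α h := { u with
        slots := rest ++ [s], hi := slotHi h s, wt := u.wt - slotWt h c } with hu'
      set v' : Tree α h := { v with
        slots := c :: v.slots, lo := slotLo h c, wt := v.wt + slotWt h c } with hv'
      have heq : ({ u with
          slots := rest ++ [s]
          hi := ((rest ++ [s]).getLast?.map (slotHi h)).getD u.hi
          wt := u.wt - slotWt h c } : Tree α h) = u' := by simp [hu']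
      rw [heq]
      have wu : WellFormed B h u' := by
        refine SlotsOk.wellFormed (SlotsOk.concat_hi (hS.sublist (List.sublist_append_left _ _))) ?_ ?_
        · simp only [hu', List.length_append, List.length_cons, List.length_nil] at hlen ⊢; omega
        · simp only [hu', List.map_append, List.map_cons, List.map_nil, List.sum_append,
            List.sum_cons, List.sum_nil] at hwu ⊢
          omega
      have wv : WellFormed B h v' := by
        refine SlotsOk.wellFormed ?_ ?_ ?_
        · exact (SlotsOk.singleton (hi := u.hi) hcS.1 le_rfl hcS.2.2).append hv.wellFormed.slotsOk huv
            (hcS.1.lo_le_hi.trans (hcS.2.2.trans huv.le)) (huv.le.trans hv.lo_le_hi)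
        · have := hv.length_lt
          simp only [hv', List.length_cons]
          omega
        · simp [hv', hv.wellFormed.wt_eq_sum, add_comm]
      have su : SlotOk B (h + 1) u' := slotOk_succ.2 ⟨wu, hsS.2.1.trans hsS.1.lo_le_hi,
        by simp only [hu']; omega, by simp only [hu']; omega⟩
      have sv : SlotOk B (h + 1) v' := slotOk_succ.2 ⟨wv,
        hcS.1.lo_le_hi.trans (hcS.2.2.trans (huv.le.trans hv.lo_le_hi)),
        by simp only [hv']; omega, by simp only [hv']; omega⟩
      refine ⟨⟨?_, ?_, by simp, by simp, by simp⟩, ?_⟩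
      · exact (SlotsOk.singleton (lo := u.lo) (hi := slotHi h s) su le_rfl le_rfl).append
          (SlotsOk.singleton (lo := slotLo h c) (hi := v.hi) sv le_rfl le_rfl) hsc
          (hsS.2.1.trans (hsS.1.lo_le_hi.trans hsc.le))
          (hsc.le.trans (hcS.1.lo_le_hi.trans (hcS.2.2.trans (huv.le.trans hv.lo_le_hi))))
      · simp only [List.flatMap_cons, List.flatMap_nil, List.append_nil]
        rw [items_eq_flatMap u', items_eq_flatMap v', items_eq_flatMap v, hiu]
        simp [hu', hv']
      · change nodeDeficit B u' + nodeDeficit B v' ≤ _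
        rw [nodeDeficit, nodeDeficit, nodeDeficit, nodeDeficit,
          deficit_eq_sum u', deficit_eq_sum v', deficit_eq_sum v, hdu]
        simp only [hu', hv', List.map_append, List.sum_append, List.map_cons, List.sum_cons,
          List.map_nil, List.sum_nil] at hwu ⊢
        omega
  · simp at hp

/-- A sibling from which no child can be borrowed is not much heavier than necessary. -/
theorem borrowRight_eq_none (hB : 4 ≤ B) (hu : Imbalanced B u) (hv : SlotOk B (h + 1) v)
    (hp : borrowRight B u v = none) : 4 * v.wt < B ^ (h + 1) + 4 * B ^ h := by
  have hP0 : 0 < B ^ (h + 1) := Nat.pow_pos (by omega)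
  unfold borrowRight at hp
  split at hp
  · rename_i hvs
    have := hv.1.wt_eq_sum
    rw [hvs] at this
    simp only [List.map_nil, List.sum_nil] at this
    omega
  · rename_i c rest hvs
    have hc := (hv.1.slotOk (s := c) (by rw [hvs]; simp)).le_pow
    have := hu.length_lt
    split at hp
    · simp at hp
    · rename_i hcond
      simp only [not_and, not_le] at hcond
      have := hcond this
      omega

theorem borrowLeft_eq_none (hB : 4 ≤ B) (hv : Imbalanced B v) (hu : SlotOk B (h + 1) u)
    (hp : borrowLeft B u v = none) : 4 * u.wt < B ^ (h + 1) + 4 * B ^ h := by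
  have hP0 : 0 < B ^ (h + 1) := Nat.pow_pos (by omega)
  unfold borrowLeft at hp
  split at hp
  · rename_i hus
    have := hu.1.wt_eq_sum
    rw [List.getLast?_eq_none_iff.1 hus] at this
    simp only [List.map_nil, List.sum_nil] at this
    omega
  · rename_i c hlast
    have hc := (hu.1.slotOk (s := c) (List.mem_of_getLast? hlast)).le_pow
    have := hv.length_lt
    split at hp
    · simp at hp
    · rename_i hcond
      simp only [not_and, not_le] at hcond
      have := hcond this
      omega

theorem wellFormed_concat (hu : WellFormed B h u) (hv : WellFormed B h v) (huv : u.hi < v.lo)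
    (hu' : u.lo ≤ u.hi) (hv' : v.lo ≤ v.hi) (hlen : u.slots.length + v.slots.length ≤ B) :
    WellFormed B h (concat u v) := by
  refine SlotsOk.wellFormed (hu.slotsOk.append hv.slotsOk huv (hu'.trans huv.le) (huv.le.trans hv'))
    ?_ ?_
  · simpa [concat] using hlen
  · simp [concat, hu.wt_eq_sum, hv.wt_eq_sum]

/-- Two siblings one of which is out of balance are repaired at constant cost, apart from a cost
proportional to the capacity if the two become one; the latter is paid by the drop of the deficit,
which leaves a surplus of `E` times the capacity. -/
theorem runs_repairPair (hB : 4 ≤ B) (h4 : 4 ∣ B) (d : α) (E : ℕ) {u v : Tree α h}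
    {b : Option (Tree α h × Tree α h)} (hu : WellFormed B h u) (hv : WellFormed B h v)
    (huv : u.hi < v.lo) (hu' : u.lo ≤ u.hi) (hv' : v.lo ≤ v.hi)
    (hsome : ∀ p, b = some p → RepairOf B u v [p.1, p.2] ∧
      nodeDeficit B p.1 + nodeDeficit B p.2 ≤
        nodeDeficit B u + nodeDeficit B v)
    (hnone : b = none → 4 * (u.wt + v.wt) ≤ 3 * B ^ (h + 1))
    (hpu : B ^ (h + 1) ≤ 4 * u.wt + 4) (hpv : B ^ (h + 1) ≤ 4 * v.wt + 4)
    (hsum : 2 * B ^ (h + 1) ≤ 4 * (u.wt + v.wt) + 4)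
    (hmin : 4 * u.wt < B ^ (h + 1) ∨ 4 * v.wt < B ^ (h + 1)) :
    Runs (repairPair B d b u v) fun r k => RepairOf B u v r ∧
      k + 2 * (E + 14) * (r.map (nodeDeficit B)).sum + E * B ^ (h + 1) * (2 - r.length) ≤
        2 * (E + 14) * (nodeDeficit B u + nodeDeficit B v) +
          (6 * B + 1 + 4 * (E + 14)) := by
  have hP : B ^ (h + 1) = B * B ^ h := pow_succ' B h
  have hPB : 4 * B ^ h ≤ B * B ^ h := Nat.mul_le_mul_right _ hB
  have hP0 : 0 < B ^ h := Nat.pow_pos (by omega)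
  have hlu := hu.length_le
  have hlv := hv.length_le
  -- the deficit of the lighter node alone
  have hdrop : ∀ x y k : ℕ, y ≤ 2 + x → k ≤ 14 * B ^ (h + 1) + 6 * B + 1 →
      k + 2 * (E + 14) * y + E * B ^ (h + 1) ≤ 2 * (E + 14) *
        ((B ^ (h + 1) - 2 * u.wt) + (B ^ (h + 1) - 2 * v.wt) + x) + (6 * B + 1 + 4 * (E + 14)) := by
    intro x y k hy hk
    have h1 : B ^ (h + 1) ≤ 2 * ((B ^ (h + 1) - 2 * u.wt) + (B ^ (h + 1) - 2 * v.wt)) := by omega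
    set S := (B ^ (h + 1) - 2 * u.wt) + (B ^ (h + 1) - 2 * v.wt)
    have h2 := Nat.mul_le_mul_left (E + 14) h1
    have h3 := Nat.mul_le_mul_left (2 * (E + 14)) hy
    rw [mul_add (2 * (E + 14)) S x]
    rw [mul_add (2 * (E + 14)) 2 x] at h3
    have h5 : 2 * (E + 14) * S = (E + 14) * (2 * S) := by ring
    have h6 : (E + 14) * B ^ (h + 1) = E * B ^ (h + 1) + 14 * B ^ (h + 1) := by ring
    omega
  unfold repairPair
  refine Runs.tick_bind ?_
  split
  · rename_i u' v'
    obtain ⟨h1, h2⟩ := hsome _ rfl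
    refine Runs.store_bind (Runs.store_bind (Runs.pure ⟨h1, ?_⟩))
    have h3 := Nat.mul_le_mul_left (2 * (E + 14)) h2
    simp only [List.map_cons, List.map_nil, List.sum_cons, List.sum_nil, List.length_cons,
      List.length_nil, add_zero, Nat.reduceAdd, Nat.sub_self, mul_zero] at h3 ⊢
    omega
  · have hle := hnone rfl
    split
    · rename_i hlen
      have hw := wellFormed_concat hu hv huv hu' hv' hlen
      have hwt : (concat u v).wt = u.wt + v.wt := rfl
      refine Runs.store_bind (Runs.pure ⟨⟨?_, ?_, le_rfl, by simp, ?_⟩, ?_⟩)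
      · exact SlotsOk.singleton (h := h + 1) (lo := u.lo) (hi := v.hi) (s := (concat u v : Tree α h))
          (slotOk_succ.2 ⟨hw, hu'.trans (huv.le.trans hv'), by omega, by omega⟩) le_rfl le_rfl
      · simp [items_concat]
      · rintro w hwe
        rw [List.singleton_inj] at hwe
        subst hwe
        have hpos : ∀ t : Tree α h, WellFormed B h t → 0 < t.wt → 1 ≤ t.slots.length := by
          intro t ht h0
          by_contra hn
          have : t.slots = [] := List.length_eq_zero_iff.1 (by omega)
          have h3 := ht.wt_eq_sum
          rw [this] at h3
          simp only [List.map_nil, List.sum_nil] at h3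
          omega
        refine weightBalanced_iff.2 ⟨hw, hpos _ hw (by omega), fun h0 => ?_⟩
        obtain ⟨h', rfl⟩ : ∃ h', h = h' + 1 := ⟨h - 1, by omega⟩
        have hPB' : 4 * B ^ h' ≤ B * B ^ h' := Nat.mul_le_mul_right _ hB
        have hP0' : 0 < B ^ h' := Nat.pow_pos (by omega)
        have hP' : B ^ (h' + 1) = B * B ^ h' := pow_succ' B h'
        have h5 := hpos u hu (by omega)
        have h6 := hpos v hv (by omega)
        simp only [concat, List.length_append]
        omega
      · simp only [List.map_cons, List.map_nil, List.sum_cons, List.sum_nil, List.length_cons,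
          List.length_nil, add_zero, zero_add, Nat.add_one_sub_one, mul_one]
        rw [nodeDeficit, nodeDeficit, nodeDeficit, deficit_concat, hwt]
        refine le_trans (hdrop (deficit B h u + deficit B h v) _ _ ?_ ?_) (le_of_eq (by ring))
        · omega
        · omega
    · have hsorted : (items h u ++ items h v).Pairwise (· < ·) :=
        List.pairwise_append.2 ⟨hu.pairwise_items, hv.pairwise_items, fun x hx y hy =>
          ((hu.lo_le_and_le_hi hx).2.trans_lt huv).trans_le (hv.lo_le_and_le_hi hy).1⟩
      have hlen : (items h u ++ items h v).length = u.wt + v.wt := by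
        rw [List.length_append, hu.wt_eq, hv.wt_eq]
      refine Runs.bind (runs_collect hB hu) fun l k1 hl => ?_
      refine Runs.bind (runs_collect hB hv) fun l' k2 hl' => ?_
      rw [hl.1, hl'.1]
      refine Runs.bind (runs_build hB h4 d hsorted (by omega) (by omega)) fun w k3 hw => ?_
      obtain ⟨hw, hk3⟩ := hw
      have hwt := hw.wt_eq
      have hlo := hw.lo_mem
      have hhi := hw.hi_mem
      refine Runs.pure ⟨⟨?_, ?_, le_rfl, by simp, ?_⟩, ?_⟩
      · have hbd : ∀ x ∈ items h u ++ items h v, u.lo ≤ x ∧ x ≤ v.hi := by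
          intro x hx
          rcases List.mem_append.1 hx with hx | hx
          · exact ⟨(hu.lo_le_and_le_hi hx).1, (hu.lo_le_and_le_hi hx).2.trans (huv.le.trans hv')⟩
          · exact ⟨hu'.trans (huv.le.trans (hv.lo_le_and_le_hi hx).1), (hv.lo_le_and_le_hi hx).2⟩
        exact SlotsOk.singleton (h := h + 1) (s := w) (slotOk_succ.2 ⟨hw.balanced.wellFormed,
          hw.lo_le_hi, by omega, by omega⟩) (hbd _ hlo).1 (hbd _ hhi).2
      · simpa using hw.items_eq
      · rintro w' hwe
        rw [List.singleton_inj] at hwe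
        exact hwe ▸ hw.balanced
      · simp only [List.map_cons, List.map_nil, List.sum_cons, List.sum_nil, List.length_cons,
          List.length_nil, add_zero, zero_add, Nat.add_one_sub_one, mul_one]
        have hd := hw.deficit_le
        rw [nodeDeficit, nodeDeficit, nodeDeficit]
        refine le_trans (hdrop (deficit B h u + deficit B h v) _ _ ?_ ?_) (le_of_eq (by ring))
        · omega
        · have := hl.2
          have := hl'.2
          omega

end Siblings


/-! ### Searching and deleting in a tree -/

section TreeDelete

variable {α : Type}

theorem mem_append_cons {β : Type} (pre post : List β) (b : β) : b ∈ pre ++ b :: post := by simp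

theorem splitFirst_eq_some {β γ : Type} {f : β → Option γ} {l : List β}
    {r : List β × γ × List β} (hr : splitFirst f l = some r) :
    ∃ b, l = r.1 ++ b :: r.2.2 ∧ f b = some r.2.1 := by
  induction l generalizing r with
  | nil => simp [splitFirst] at hr
  | cons b l ih =>
    rw [splitFirst] at hr
    split at hr
    · rename_i c hc
      simp only [Option.some.injEq] at hr
      subst hr
      exact ⟨b, rfl, hc⟩
    · rw [Option.map_eq_some_iff] at hr
      obtain ⟨r', hr', rfl⟩ := hr
      obtain ⟨b', h1, h2⟩ := ih hr'
      exact ⟨b', by rw [h1]; rfl, h2⟩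

theorem splitFirst_eq_none {β γ : Type} {f : β → Option γ} {l : List β}
    (hr : splitFirst f l = none) : ∀ b ∈ l, f b = none := by
  induction l with
  | nil => simp
  | cons b l ih =>
    rw [splitFirst] at hr
    split at hr
    · simp at hr
    · rename_i hb
      rw [Option.map_eq_none_iff] at hr
      exact List.forall_mem_cons.2 ⟨hb, ih hr⟩

variable [LinearOrder α]

theorem routeChild_eq_some {B h : ℕ} {x : α} {t : Tree α (h + 1)}
    (ht : WellFormed B (h + 1) t) {pre post : List (Tree α h)} {c : Tree α h}
    (hr : routeChild (h := h) x t.slots = some (pre, c, post)) :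
    t.slots = pre ++ c :: post ∧ (∀ p ∈ pre, x ∉ items h p) ∧ (∀ p ∈ post, x ∉ items h p) := by
  obtain ⟨b, h1, h2⟩ := splitFirst_eq_some hr
  split at h2
  · rename_i hx
    simp only [Option.some.injEq] at h2
    subst h2
    have hS := ht.slotsOk
    have h1' : t.slots = pre ++ b :: post := h1
    rw [h1'] at hS
    refine ⟨h1', fun p hp hxp => ?_, fun p hp hxp => ?_⟩
    · have h3 : p.hi < b.lo := (List.pairwise_append.1 hS.1).2.2 p hp b List.mem_cons_self
      have h4 := (hS.2 p (List.mem_append_left _ hp)).1.1.lo_le_and_le_hi hxp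
      exact absurd (h4.2.trans_lt h3) (not_lt.2 hx.1)
    · have h3 : b.hi < p.lo := List.rel_of_pairwise_cons (List.pairwise_append.1 hS.1).2.1 hp
      have h4 := (hS.2 p (List.mem_append_right _ (List.mem_cons_of_mem _ hp))).1.1.lo_le_and_le_hi
        hxp
      exact absurd (h3.trans_le h4.1) (not_lt.2 hx.2)
  · simp at h2

theorem routeChild_eq_none {B h : ℕ} {x : α} {t : Tree α (h + 1)}
    (ht : WellFormed B (h + 1) t) (hr : routeChild (h := h) x t.slots = none) :
    x ∉ items (h + 1) t := by
  intro hx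
  obtain ⟨c, hc, hxc⟩ := List.mem_flatMap.1 hx
  have h1 := splitFirst_eq_none hr c hc
  rw [if_pos ((ht.2.2.2 c hc).1.lo_le_and_le_hi hxc)] at h1
  simp at h1

theorem runs_contains {B h : ℕ} (x : α) {t : Tree α h} (ht : WellFormed B h t) :
    Runs (contains x h t) fun b k => (b = true ↔ x ∈ items h t) ∧ k ≤ (h + 1) * (B + 1) := by
  induction h with
  | zero =>
    have key : ∀ l : List α, decide (x ∈ l) = true ↔ x ∈ l := fun l => decide_eq_true_iff
    refine Runs.tick_bind (Runs.pure ⟨key _, ?_⟩)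
    have := ht.length_le
    omega
  | succ h ih =>
    have hlen := ht.length_le
    refine Runs.tick_bind ?_
    rw [add_mul (h + 1), one_mul]
    split
    · rename_i hr
      exact Runs.pure ⟨by simpa using routeChild_eq_none ht hr, by omega⟩
    · rename_i pre c post hr
      obtain ⟨h1, h2, h3⟩ := routeChild_eq_some ht hr
      have hc : WellFormed B h c := (ht.slotOk (s := c) (by rw [h1]; exact mem_append_cons pre post c)).1
      refine (ih hc).mono fun b k hk => ⟨hk.1.trans ⟨fun hx => ?_, fun hx => ?_⟩, by omega⟩
      · exact List.mem_flatMap.2 ⟨c, by rw [h1]; exact mem_append_cons pre post c, hx⟩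
      · obtain ⟨p, hp, hxp⟩ := List.mem_flatMap.1 hx
        rw [h1] at hp
        rcases List.mem_append.1 hp with hp | hp
        · exact absurd hxp (h2 p hp)
        · rcases List.mem_cons.1 hp with rfl | hp
          · exact hxp
          · exact absurd hxp (h3 p hp)

/-- Rebalance one child among its siblings.  The cost is constant, apart from a cost that is paid by
the drop of the deficit if the node loses a child. -/
theorem runs_rebalance {B h : ℕ} (hB : 4 ≤ B) (h4 : 4 ∣ B) (d : α) (E : ℕ) {lo hi : α}
    {pre post : List (Tree α h)} {c : Tree α h} (h1 : SlotsOk B (h + 1) lo hi pre)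
    (h3 : SlotsOk B (h + 1) lo hi post) (hc : WellFormed B h c) (hlh : c.lo ≤ c.hi)
    (hle : c.wt ≤ B ^ (h + 1)) (hge : B ^ (h + 1) ≤ 4 * c.wt + 4)
    (hpre : ∀ p ∈ pre, p.hi < c.lo) (hpost : ∀ p ∈ post, c.hi < p.lo) (hlo : lo ≤ c.lo)
    (hhi : c.hi ≤ hi) (hone : pre = [] → post = [] → B ^ (h + 1) ≤ 4 * c.wt) :
    Runs (rebalance B d pre c post) fun cs k => SlotsOk B (h + 1) lo hi cs ∧
      cs.flatMap (items h) = (pre ++ c :: post).flatMap (items h) ∧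
      cs.length ≤ (pre ++ c :: post).length ∧ (pre ++ c :: post).length ≤ cs.length + 1 ∧
      (2 ≤ (pre ++ c :: post).length → ∀ w, cs = [w] → WeightBalanced B h w) ∧
      k + 2 * (E + 14) * (cs.map (nodeDeficit B)).sum +
          E * B ^ (h + 1) * ((pre ++ c :: post).length - cs.length) ≤
        2 * (E + 14) * ((pre ++ c :: post).map (nodeDeficit B)).sum +
          (6 * B + 1 + 4 * (E + 14)) := by
  have hP : B ^ (h + 1) = B * B ^ h := pow_succ' B h
  have hPB : 4 * B ^ h ≤ B * B ^ h := Nat.mul_le_mul_right _ hB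
  unfold rebalance
  split
  · rename_i hbal
    refine Runs.pure ⟨?_, rfl, le_rfl, Nat.le_succ _, ?_, ?_⟩
    · have := SlotsOk.replace h1 (SlotsOk.singleton (h := h + 1) (s := c) (lo := c.lo) (hi := c.hi)
        (slotOk_succ.2 ⟨hc, hlh, hbal, hle⟩) le_rfl le_rfl) h3 hpre hpost hlo hlh hhi
      rw [List.append_cons]
      exact this
    · intro h5 w hw
      rw [hw] at h5
      simp at h5
    · rw [Nat.sub_self, mul_zero]
      omega
  · rename_i hnb
    have him : Imbalanced B c := ⟨hc, hlh, by omega, hge⟩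
    split
    · rename_i v post'
      have hvs : SlotOk B (h + 1) v := (h3.2 v List.mem_cons_self).1
      obtain ⟨hv1, hv2, hv3, hv4⟩ := slotOk_succ.1 hvs
      have hcv : c.hi < v.lo := hpost v List.mem_cons_self
      have hvhi : v.hi ≤ hi := (h3.2 v List.mem_cons_self).2.2
      refine Runs.bind (runs_repairPair hB h4 d E hc hv1 hcv hlh hv2
        (fun p hp => borrowRight_eq_some hB him hvs hcv hp) (fun hn => ?_) hge (by omega) (by omega)
        (Or.inl him.lt_pow)) fun r k hr => Runs.pure ?_
      · have := borrowRight_eq_none hB him hvs hn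
        have := him.lt_pow
        omega
      · obtain ⟨hr, hk⟩ := hr
        have hr1 := hr.one_le
        have hr2 := hr.le_two
        refine ⟨?_, ?_, ?_, ?_, ?_, ?_⟩
        · exact SlotsOk.replace h1 hr.slotsOk (h3.sublist (List.sublist_cons_self _ _)) hpre
            (fun s hs => List.rel_of_pairwise_cons h3.1 hs) hlo (hlh.trans (hcv.le.trans hv2)) hvhi
        · simp [hr.items_eq]
        · simp only [List.length_append, List.length_cons]; omega
        · simp only [List.length_append, List.length_cons]; omega
        · intro h5 w hw
          have hlen := congrArg List.length hw
          simp only [List.length_append, List.length_cons, List.length_nil] at hlen h5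
          have e1 : pre = [] := List.length_eq_zero_iff.1 (by omega)
          have e2 : post' = [] := List.length_eq_zero_iff.1 (by omega)
          rw [e1, e2] at hw
          exact hr.of_singleton w (by simpa using hw)
        · have e1 : (pre ++ c :: v :: post').length - (pre ++ r ++ post').length =
            2 - r.length := by simp only [List.length_append, List.length_cons]; omega
          rw [e1]
          simp only [List.map_append, List.map_cons, List.sum_append, List.sum_cons, mul_add] at hk ⊢
          omega
    · rename_i v hlast
      obtain ⟨pre', rfl⟩ := List.getLast?_eq_some_iff.1 hlast
      rw [List.dropLast_concat]
      have hvs : SlotOk B (h + 1) v := (h1.2 v (mem_append_cons pre' [] v)).1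
      obtain ⟨hv1, hv2, hv3, hv4⟩ := slotOk_succ.1 hvs
      have hvc : v.hi < c.lo := hpre v (mem_append_cons pre' [] v)
      have hvlo : lo ≤ v.lo := (h1.2 v (mem_append_cons pre' [] v)).2.1
      refine Runs.bind (runs_repairPair hB h4 d E hv1 hc hvc hv2 hlh
        (fun p hp => borrowLeft_eq_some hB him hvs hvc hp) (fun hn => ?_) (by omega) hge (by omega)
        (Or.inr him.lt_pow)) fun r k hr => Runs.pure ?_
      · have := borrowLeft_eq_none hB him hvs hn
        have := him.lt_pow
        omega
      · obtain ⟨hr, hk⟩ := hr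
        have hr1 := hr.one_le
        have hr2 := hr.le_two
        refine ⟨?_, ?_, ?_, ?_, ?_, ?_⟩
        · have := SlotsOk.replace (h1.sublist (List.sublist_append_left pre' [v])) hr.slotsOk h3
            (fun s hs => (List.pairwise_append.1 h1.1).2.2 s hs v (List.mem_singleton_self v))
            (fun s hs => absurd hs List.not_mem_nil) hvlo (hv2.trans (hvc.le.trans hlh)) hhi
          rw [← List.append_nil (pre' ++ r)]
          exact this
        · simp [hr.items_eq]
        · simp only [List.length_append, List.length_cons, List.length_nil]; omega
        · simp only [List.length_append, List.length_cons, List.length_nil]; omega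
        · intro h5 w hw
          have hlen := congrArg List.length hw
          simp only [List.length_append, List.length_cons, List.length_nil] at hlen h5
          have e1 : pre' = [] := List.length_eq_zero_iff.1 (by omega)
          rw [e1] at hw
          exact hr.of_singleton w (by simpa using hw)
        · have e1 : (pre' ++ [v] ++ [c]).length - (pre' ++ r).length = 2 - r.length := by
            simp only [List.length_append, List.length_cons, List.length_nil]; omega
          rw [e1]
          simp only [List.map_append, List.map_cons, List.sum_append, List.sum_cons, mul_add,
            List.map_nil, List.sum_nil, add_zero] at hk ⊢
          omega
    · rename_i hlast
      rw [List.getLast?_eq_none_iff] at hlast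
      exact absurd (hone hlast rfl) hnb

/-- If the node is an internal node with a single child, then this child would do as the root of a
weight-balanced tree. -/
def SoleChildBalanced (B : ℕ) : (h : ℕ) → Tree α h → Prop
  | 0, _ => True
  | h + 1, t => ∀ c : Tree α h, t.slots = [c] → WeightBalanced B h c

/-- The cost of a deletion per level of a tree. -/
def deleteConst (B E : ℕ) : ℕ := E + 9 * B + 2 + 8 * (E + 14)

theorem length_filter_ne {l : List α} (hl : l.Pairwise (· < ·)) {x : α} (hx : x ∈ l) :
    (l.filter fun y => y ≠ x).length + 1 = l.length := by
  have hn : l.Nodup := hl.imp ne_of_lt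
  have h1 : l.filter (fun y => y ≠ x) = l.erase x := by
    rw [hn.erase_eq_filter]
    exact List.filter_congr fun y _ => by simp [bne, BEq.beq]
  rw [h1, List.length_erase_of_mem hx]
  have := List.length_pos_of_mem hx
  omega

/-- Deletion in a tree takes constant time per level, apart from the work paid by the drop of the
deficit.  If the root loses a child, then a surplus proportional to the capacity of the child is
left. -/
theorem runs_deleteBelow {B h : ℕ} (hB : 4 ≤ B) (h4 : 4 ∣ B) (E : ℕ) (x : α) {t : Tree α h}
    (ht : WellFormed B h t) (hx : x ∈ items h t)
    (hone : h ≠ 0 → t.slots.length = 1 → B ^ (h + 1) ≤ 4 * t.wt) :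
    Runs (deleteBelow B x h t) fun t' k => WellFormed B h t' ∧
      items h t' = (items h t).filter (fun y => y ≠ x) ∧ t'.lo = t.lo ∧ t'.hi = t.hi ∧
      t'.slots.length ≤ t.slots.length ∧ t.slots.length ≤ t'.slots.length + 1 ∧
      (2 ≤ t.slots.length → SoleChildBalanced B h t') ∧
      k + 2 * (E + 14) * deficit B h t' + E * B ^ h * (t.slots.length - t'.slots.length) ≤
        2 * (E + 14) * deficit B h t + (h + 1) * deleteConst B E := by
  induction h with
  | zero =>
    have hlen := length_filter_ne ht.pairwise_items hx
    have hle := ht.length_le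
    simp only [items] at hlen
    refine Runs.tick_bind (Runs.store_bind (Runs.pure ⟨⟨?_, rfl, ?_, ?_⟩, rfl, rfl, rfl, ?_, ?_,
      fun _ => trivial, ?_⟩))
    · exact (List.length_filter_le _ _).trans hle
    · exact ht.pairwise_items.filter _
    · exact fun y hy => ht.2.2.2 y (List.mem_filter.1 hy).1
    · exact List.length_filter_le _ _
    · exact hlen.ge
    · have hle' : t.slots.length - (t.slots.filter fun y => decide (y ≠ x)).length ≤ 1 := by
        change (items 0 t).length - ((items 0 t).filter fun y => decide (y ≠ x)).length ≤ 1
        simp only [items]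
        omega
      simp only [deficit, deleteConst]
      change t.slots.length + 1 + (2 * B + 0) + 2 * (E + 14) * 0 + E * B ^ 0 *
        (t.slots.length - (t.slots.filter fun y => decide (y ≠ x)).length) ≤ _
      have := Nat.mul_le_mul_left (E * B ^ 0) hle'
      rw [pow_zero, mul_one, mul_one] at this
      rw [pow_zero, mul_one]
      omega
  | succ h ih =>
    have hlen := ht.length_le
    have hP : B ^ (h + 1 + 1) = B * B ^ (h + 1) := pow_succ' B (h + 1)
    have hPB : 4 * B ^ (h + 1) ≤ B * B ^ (h + 1) := Nat.mul_le_mul_right _ hB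
    have hP4 : B ≤ B ^ (h + 1) := Nat.le_self_pow (Nat.succ_ne_zero h) B
    rw [deleteBelow]
    refine Runs.tick_bind ?_
    split
    · rename_i hr
      exact absurd hx (routeChild_eq_none ht hr)
    · rename_i pre c post hr
      obtain ⟨h1, h2, h3⟩ := routeChild_eq_some ht hr
      have hS := ht.slotsOk
      rw [h1] at hS hlen
      have hcm := hS.2 c (mem_append_cons pre post c)
      obtain ⟨hc1, hc2, hc3, hc4⟩ := slotOk_succ.1 hcm.1
      have hxc : x ∈ items h c := by
        obtain ⟨p, hp, hxp⟩ := List.mem_flatMap.1 hx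
        rw [h1] at hp
        rcases List.mem_append.1 hp with hp | hp
        · exact absurd hxp (h2 p hp)
        · rcases List.mem_cons.1 hp with rfl | hp
          · exact hxp
          · exact absurd hxp (h3 p hp)
      refine Runs.bind (ih hc1 hxc fun _ _ => hc3) fun c' k1 hc' => ?_
      obtain ⟨g1, g2, g3, g4, g5, g6, -, g7⟩ := hc'
      have hwt : c'.wt + 1 = c.wt := by
        rw [g1.wt_eq, g2, hc1.wt_eq]
        exact length_filter_ne hc1.pairwise_items hxc
      have hpp := List.pairwise_append.1 hS.1
      refine Runs.bind (runs_rebalance (lo := t.lo) (hi := t.hi) hB h4 x E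
        (hS.sublist (List.sublist_append_left pre (c :: post)))
        (hS.sublist ((List.sublist_cons_self c post).trans
          (List.sublist_append_right pre (c :: post)))) g1 (by rw [g3, g4]; exact hc2)
        (by omega) (by omega) (fun p hp => by rw [g3]; exact hpp.2.2 p hp c List.mem_cons_self)
        (fun p hp => by rw [g4]; exact List.rel_of_pairwise_cons hpp.2.1 hp)
        (by rw [g3]; exact hcm.2.1) (by rw [g4]; exact hcm.2.2) ?_) fun cs k2 hcs => ?_
      · intro e1 e2
        rw [e1, e2] at h1
        have h5 := hone (Nat.succ_ne_zero h) (by rw [h1]; rfl)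
        have h6 : t.wt = c.wt := by
          have := ht.wt_eq_sum
          rw [h1] at this
          exact this.trans (Nat.add_zero _)
        omega
      · obtain ⟨r1, r2, r3, r4, r5, r6⟩ := hcs
        have hlen' : (pre ++ c' :: post).length = t.slots.length := by
          rw [h1]
          exact (by simp : (pre ++ c' :: post).length = (pre ++ c :: post).length)
        rw [hlen'] at r3 r4 r5 r6
        have hfilter : cs.flatMap (items h) =
            (items (h + 1) t).filter (fun y => y ≠ x) := by
          have e1 : ∀ l : List (Tree α h), (∀ p ∈ l, x ∉ items h p) →
              (l.flatMap (items h)).filter (fun y => decide (y ≠ x)) = l.flatMap (items h) := by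
            intro l hl
            refine List.filter_eq_self.2 fun y hy => ?_
            obtain ⟨p, hp, hyp⟩ := List.mem_flatMap.1 hy
            simp only [ne_eq, decide_not, Bool.not_eq_eq_eq_not, Bool.not_true,
              decide_eq_false_iff_not]
            rintro rfl
            exact hl p hp hyp
          have e2 : items (h + 1) t = (pre ++ c :: post).flatMap (items h) := by
            rw [← h1]; rfl
          rw [r2, e2, List.flatMap_append, List.flatMap_append, List.filter_append, e1 pre h2,
            List.flatMap_cons, List.flatMap_cons, List.filter_append, e1 post h3, g2]
        refine Runs.store_bind (Runs.pure ⟨?_, hfilter, rfl, rfl, r3, r4, ?_, ?_⟩)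
        · exact SlotsOk.wellFormed r1 (r3.trans ht.length_le) rfl
        · exact fun h5 w hw => r5 h5 w hw
        · have hd : deficit B (h + 1) t = ((pre ++ c :: post).map (nodeDeficit B)).sum := by
            rw [deficit_succ, h1]
          have hd' : nodeDeficit B c' + deficit B h c ≤ nodeDeficit B c + 2 + deficit B h c' := by
            rw [nodeDeficit, nodeDeficit]; omega
          have hd'' := Nat.mul_le_mul_left (2 * (E + 14)) hd'
          rw [deficit_succ]
          rw [hd]
          simp only [List.map_append, List.map_cons, List.sum_append, List.sum_cons, mul_add] at r6 hd'' ⊢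
          have hlen2 : t.slots.length ≤ B := ht.length_le
          change t.slots.length + 1 + (k1 + (k2 + (2 * B + 0))) +
            (2 * E + 2 * 14) * (List.map (nodeDeficit B) cs).sum +
            E * B ^ (h + 1) * (t.slots.length - cs.length) ≤ _
          simp only [mul_add] at g7
          have e3 : (h + 1 + 1) * deleteConst B E = (h + 1) * deleteConst B E + deleteConst B E := by
            ring
          rw [e3]
          have e4 : deleteConst B E = E + 9 * B + 2 + 8 * (E + 14) := rfl
          omega

/-- Find the tree that contains `x` in a forest. -/
theorem runs_locate {B i : ℕ} (x : α) {ts : List (Tree α i)} (hts : ∀ t ∈ ts, WellFormed B i t) :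
    Runs (locate x ts) fun r k => k ≤ ts.length * ((i + 1) * (B + 1)) ∧
      ((∃ t ∈ ts, x ∈ items i t) → ∃ p, r = some p) ∧
      ∀ p, r = some p → x ∈ items i p.1 ∧ ts.Perm (p.1 :: p.2) := by
  induction ts with
  | nil => exact Runs.pure ⟨Nat.zero_le _, by simp, by simp⟩
  | cons t ts ih =>
    have hlen : (t :: ts).length * ((i + 1) * (B + 1)) =
        (i + 1) * (B + 1) + ts.length * ((i + 1) * (B + 1)) := by
      rw [List.length_cons]; ring
    rw [hlen]
    refine Runs.bind (runs_contains x (hts t List.mem_cons_self)) fun b k hb => ?_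
    split
    · rename_i hbt
      refine Runs.pure ⟨by omega, fun _ => ⟨_, rfl⟩, fun p hp => ?_⟩
      simp only [Option.some.injEq] at hp
      subst hp
      exact ⟨hb.1.1 hbt, List.Perm.refl _⟩
    · rename_i hbf
      refine Runs.bind (ih fun t ht => hts t (List.mem_cons_of_mem _ ht)) fun r k' hr => ?_
      obtain ⟨r1, r2, r3⟩ := hr
      refine Runs.pure ⟨by omega, ?_, ?_⟩
      · rintro ⟨t', ht', hxt'⟩
        rcases List.mem_cons.1 ht' with rfl | ht'
        · exact absurd (hb.1.2 hxt') hbf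
        · obtain ⟨p, hp⟩ := r2 ⟨t', ht', hxt'⟩
          exact ⟨(p.1, t :: p.2), by rw [hp]; rfl⟩
      · intro p hp
        rw [Option.map_eq_some_iff] at hp
        obtain ⟨p', hp', rfl⟩ := hp
        obtain ⟨q1, q2⟩ := r3 p' hp'
        exact ⟨q1, (q2.cons t).trans (List.Perm.swap _ _ _)⟩

end TreeDelete


/-! ### Merging sorted lists and roots -/

section MergeRoots

variable {α : Type} [LinearOrder α]

theorem pairwise_lt_of_le {l : List α} (h : l.Pairwise (· ≤ ·)) (hn : l.Nodup) :
    l.Pairwise (· < ·) :=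
  (h.and hn).imp fun h => lt_of_le_of_ne h.1 h.2

theorem runs_mergeSorted {ls : List (List α)} (hls : ∀ l ∈ ls, l.Pairwise (· < ·))
    (hn : ls.flatten.Nodup) : Runs (mergeSorted ls) fun r k => r.Perm ls.flatten ∧
      r.Pairwise (· < ·) ∧ k ≤ ls.length * (ls.flatten.length + 1) := by
  induction ls with
  | nil => exact Runs.pure ⟨List.Perm.refl _, List.Pairwise.nil, Nat.zero_le _⟩
  | cons l ls ih =>
    rw [List.flatten_cons] at hn ⊢
    have hl := hls l List.mem_cons_self
    refine Runs.bind (ih (fun l' hl' => hls l' (List.mem_cons_of_mem _ hl'))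
      (List.nodup_append.1 hn).2.1) fun r k hr => ?_
    obtain ⟨h1, h2, h3⟩ := hr
    have hperm : (List.merge l r fun a b => decide (a ≤ b)).Perm (l ++ ls.flatten) :=
      (List.merge_perm_append _).trans (h1.append_left l)
    refine Runs.tick_bind (Runs.pure ⟨hperm, pairwise_lt_of_le ?_ (hperm.nodup_iff.2 hn), ?_⟩)
    · have hm := List.pairwise_merge (le := fun a b : α => decide (a ≤ b))
        (fun a b c h1 h2 => by simp only [decide_eq_true_eq] at *; exact h1.trans h2)
        (fun a b => by simpa using le_total a b) l r
        (hl.imp fun h => by simpa using h.le) (h2.imp fun h => by simpa using h.le)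
      exact hm.imp fun h => by simpa using h
    · rw [h1.length_eq, List.length_cons, List.length_append, add_mul, one_mul]
      have : ls.length * (ls.flatten.length + 1) ≤
          ls.length * (l.length + ls.flatten.length + 1) := Nat.mul_le_mul_left _ (by omega)
      omega

theorem WellFormed.lo_le_hi {B h : ℕ} {t : Tree α h} (ht : WellFormed B h t)
    (h1 : 1 ≤ t.slots.length) : t.lo ≤ t.hi := by
  cases hs : t.slots with
  | nil => simp [hs] at h1
  | cons s l =>
    have hS := ht.slotsOk.2 s (by rw [hs]; exact List.mem_cons_self)
    exact hS.2.1.trans (hS.1.lo_le_hi.trans hS.2.2)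

theorem joinApart_spec {B h : ℕ} {u v : Tree α h} (hu : WellFormed B h u) (hv : WellFormed B h v)
    (hu' : 1 ≤ u.slots.length) (hv' : 1 ≤ v.slots.length) (ha : Apart u v)
    (hlen : u.slots.length + v.slots.length ≤ B) :
    WellFormed B h (joinApart u v) ∧
      (joinApart u v).slots.length = u.slots.length + v.slots.length ∧
      (items h (joinApart u v)).Perm (items h u ++ items h v) ∧
      deficit B h (joinApart u v) = deficit B h u + deficit B h v := by
  unfold joinApart
  split
  · rename_i hlt
    exact ⟨wellFormed_concat hu hv hlt (hu.lo_le_hi hu') (hv.lo_le_hi hv') hlen,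
      by simp [concat], List.Perm.of_eq (items_concat u v), deficit_concat u v⟩
  · rename_i hlt
    have hw := wellFormed_concat hv hu (ha.resolve_left hlt) (hv.lo_le_hi hv') (hu.lo_le_hi hu')
      (by omega)
    -- the ID of a node is irrelevant to its shape and its contents
    have key : ∀ (w : Tree α h) (j : ℕ), items h { w with id := j } = items h w ∧
        deficit B h { w with id := j } = deficit B h w := fun w j =>
      ⟨by rw [items_eq_flatMap, items_eq_flatMap], by rw [deficit_eq_sum, deficit_eq_sum]⟩
    obtain ⟨k1, k2⟩ := key (concat v u) u.id
    refine ⟨?_, ?_, ?_, ?_⟩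
    · exact SlotsOk.wellFormed hw.slotsOk hw.length_le hw.wt_eq_sum
    · simp [concat, add_comm]
    · rw [k1, items_concat]; exact List.perm_append_comm
    · rw [k2, deficit_concat, add_comm]

/-- Merging two roots costs no more than the capacity of a tree, up to a constant, and does not
increase the deficit. -/
theorem runs_mergeRoots {B h : ℕ} (hB : 4 ≤ B) (h4 : 4 ∣ B) (d : α) (h0 : h ≠ 0) {t t' : Tree α h}
    (ht : WellFormed B h t) (ht1 : 1 ≤ t.slots.length) (ht' : WeightBalanced B h t')
    (hn : (items h t ++ items h t').Nodup) :
    Runs (mergeRoots B d t t') fun r k => (∀ w ∈ r, WeightBalanced B h w) ∧ r.length ≤ 2 ∧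
      (r.flatMap (items h)).Perm (items h t ++ items h t') ∧
      (r.map (deficit B h)).sum ≤ deficit B h t + deficit B h t' ∧ k ≤ 30 * B ^ (h + 1) := by
  have hP : B ^ (h + 1) = B * B ^ h := pow_succ' B h
  have hPB : 4 * B ^ h ≤ B * B ^ h := Nat.mul_le_mul_right _ hB
  have hP0 : 0 < B ^ h := Nat.pow_pos (by omega)
  have hBP : B ≤ B ^ (h + 1) := Nat.le_self_pow (Nat.succ_ne_zero h) B
  obtain ⟨htw', -, ht2'⟩ := weightBalanced_iff.1 ht'
  have ht2' := ht2' h0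
  have hlen := ht.length_le
  have hlen' := htw'.length_le
  refine Runs.tick_bind ?_
  split
  · rename_i hc
    obtain ⟨j1, j2, j3, j4⟩ := joinApart_spec ht htw' ht1 (by omega) hc.1 hc.2
    refine Runs.store_bind (Runs.pure ⟨?_, by simp, by simpa using j3, by simp [j4], by omega⟩)
    intro w hw
    rw [List.mem_singleton.1 hw]
    exact weightBalanced_iff.2 ⟨j1, by omega, fun _ => by omega⟩
  · have d1 := ht.length_mul_pow_le_deficit
    have d2 := ht'.two_mul_pow_le
    have d3 : B ^ h ≤ t.slots.length * B ^ h := Nat.le_mul_of_pos_left _ ht1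
    have w1 := ht.wt_le
    have w2 := htw'.wt_le
    have w3 := ht'.pow_le
    refine Runs.bind (runs_collect hB ht) fun l k1 hl => ?_
    refine Runs.bind (runs_collect hB htw') fun l' k2 hl' => ?_
    rw [hl.1, hl'.1]
    have hfl : [items h t, items h t'].flatten = items h t ++ items h t' := by simp
    refine Runs.bind (runs_mergeSorted (ls := [items h t, items h t'])
      (List.forall_mem_cons.2 ⟨ht.pairwise_items, List.forall_mem_cons.2 ⟨htw'.pairwise_items,
        fun _ h => absurd h List.not_mem_nil⟩⟩) (hfl ▸ hn)) fun m k3 hm => ?_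
    obtain ⟨m1, m2, m3⟩ := hm
    rw [hfl] at m1 m3
    have hmlen : m.length = t.wt + t'.wt := by
      rw [m1.length_eq, List.length_append, ht.wt_eq, htw'.wt_eq]
    rw [← m1.length_eq, hmlen] at m3
    simp only [List.length_cons, List.length_nil] at m3
    have hl2 := hl.2
    have hl2' := hl'.2
    split
    · rename_i hmle
      refine Runs.bind (runs_build hB h4 d m2 hmle (by omega)) fun w k4 hw => Runs.pure ?_
      obtain ⟨hw, hk4⟩ := hw
      refine ⟨?_, by simp, ?_, ?_, by omega⟩
      · intro w' hw'
        rw [List.mem_singleton.1 hw']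
        exact hw.balanced
      · simpa [hw.items_eq] using m1
      · have := hw.deficit_le
        simp only [List.map_cons, List.map_nil, List.sum_cons, List.sum_nil, add_zero]
        omega
    · rename_i hmle
      obtain ⟨M, hM⟩ : 4 ∣ B ^ (h + 1) := h4.trans (dvd_pow_self B (Nat.succ_ne_zero h))
      obtain ⟨s1, s2, s3⟩ := splitEven_spec (k := 2) (by omega) m
      have hpw := s1.symm ▸ m2
      rw [List.pairwise_flatten] at hpw
      have hp : ∀ p ∈ splitEven 2 m, p.length ≤ B ^ (h + 1) ∧ B ^ h ≤ p.length := by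
        intro p hp
        refine ⟨(s3 p hp).2 _ (by omega), ?_⟩
        have := (s3 p hp).1 (2 * M) (by omega)
        omega
      refine (Runs.mapM (P := BuiltOn B h) (C := 8 * B ^ (h + 1) - 5)
        fun p hpm => (runs_build hB h4 d (hpw.1 p hpm) (hp p hpm).1
          (by have := (hp p hpm).2; omega)).mono fun w k hw => ⟨hw.1, by omega⟩).mono
        fun r k hr => ?_
      obtain ⟨hF, hk⟩ := hr
      have hitems : splitEven 2 m = r.map (items h) :=
        List.forall₂_eq_eq_eq ▸ List.forall₂_map_right_iff.2 (hF.imp fun _ _ h => h.items_eq.symm)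
      refine ⟨?_, by rw [← hF.length_eq, s2], ?_, ?_, by rw [s2] at hk; omega⟩
      · intro w hw
        obtain ⟨p, -, hpw⟩ := forall₂_exists_left hF hw
        exact hpw.balanced
      · rw [List.flatMap_def, ← hitems, s1]; exact m1
      · rw [List.sum_eq_zero]
        · exact Nat.zero_le _
        · intro y hy
          obtain ⟨w, hw, rfl⟩ := List.mem_map.1 hy
          obtain ⟨p, hpm, hpw⟩ := forall₂_exists_left hF hw
          have := hpw.deficit_le
          have := (hp p hpm).2
          omega

theorem sum_map_remove {β : Type} (f : β → ℕ) (r1 r3 : List β) (b : β) :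
    ((r1 ++ b :: r3).map f).sum = ((r1 ++ r3).map f).sum + f b := by
  simp only [List.map_append, List.map_cons, List.sum_append, List.sum_cons]
  omega

/-- A child that is given to a root with one child turns it into the root of a weight-balanced
tree. -/
theorem addChild_spec {B i : ℕ} (hB : 4 ≤ B) {t : Tree α (i + 1)} {c c' : Tree α i}
    (hc : SlotOk B (i + 1) c) (hc' : SlotOk B (i + 1) c') (ha : Apart c c') :
    WeightBalanced B (i + 1) (addChild t c c') ∧
      (items (i + 1) (addChild t c c')).Perm (items i c ++ items i c') ∧
      deficit B (i + 1) (addChild t c c') = nodeDeficit B c + nodeDeficit B c' := by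
  have hlen : ([c, c'] : List (Tree α i)).length ≤ B :=
    le_trans (Nat.le_succ_of_le (Nat.le_succ 2)) hB
  have hlen' : ([c', c] : List (Tree α i)).length ≤ B :=
    le_trans (Nat.le_succ_of_le (Nat.le_succ 2)) hB
  unfold addChild
  split
  · rename_i hlt
    refine ⟨⟨SlotsOk.wellFormed ?_ hlen ?_, le_rfl⟩, ?_, ?_⟩
    · exact (SlotsOk.singleton (h := i + 1) (lo := c.lo) (hi := c.hi) hc le_rfl le_rfl).append
        (SlotsOk.singleton (h := i + 1) (lo := c'.lo) (hi := c'.hi) hc' le_rfl le_rfl) hlt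
        (hc.2.1.trans hlt.le) (hlt.le.trans hc'.2.1)
    · rfl
    · refine List.Perm.of_eq ?_
      change ([c, c'] : List (Tree α i)).flatMap (items i) = _
      simp
    · rfl
  · rename_i hlt
    have hlt := ha.resolve_left hlt
    refine ⟨⟨SlotsOk.wellFormed ?_ hlen' ?_, le_rfl⟩, ?_, ?_⟩
    · exact (SlotsOk.singleton (h := i + 1) (lo := c'.lo) (hi := c'.hi) hc' le_rfl le_rfl).append
        (SlotsOk.singleton (h := i + 1) (lo := c.lo) (hi := c.hi) hc le_rfl le_rfl) hlt
        (hc'.2.1.trans hlt.le) (hlt.le.trans hc.2.1)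
    · exact add_comm c.wt c'.wt
    · change List.Perm (([c', c] : List (Tree α i)).flatMap (items i)) _
      simpa using List.perm_append_comm
    · exact add_comm (nodeDeficit B c') (nodeDeficit B c)

theorem findLender_eq_some {B i : ℕ} {c : Tree α i} {ts : List (Tree α (i + 1))}
    (hts : ∀ t ∈ ts, WeightBalanced B (i + 1) t) {pre post : List (Tree α (i + 1))}
    {c' : Tree α i} {t' : Tree α (i + 1)} (hf : findLender c ts = some (pre, (c', t'), post)) :
    ∃ t, ts = pre ++ t :: post ∧ Apart c c' ∧ SlotOk B (i + 1) c' ∧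
      WeightBalanced B (i + 1) t' ∧ (items (i + 1) t).Perm (items i c' ++ items (i + 1) t') ∧
      deficit B (i + 1) t = nodeDeficit B c' + deficit B (i + 1) t' := by
  obtain ⟨t, h1, h2⟩ := splitFirst_eq_some hf
  refine ⟨t, h1, ?_⟩
  have h1' : ts = pre ++ t :: post := h1
  obtain ⟨ht, -⟩ := hts t (by rw [h1']; exact mem_append_cons pre post t)
  dsimp only at h2
  split at h2
  · rename_i h3
    rw [Option.map_eq_some_iff] at h2
    obtain ⟨⟨r1, r2, r3⟩, hr, hrt⟩ := h2
    simp only [Prod.mk.injEq] at hrt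
    obtain ⟨rfl, rfl⟩ := hrt
    obtain ⟨b, h4, h5⟩ := splitFirst_eq_some hr
    split at h5
    · rename_i hapart
      simp only [Option.some.injEq] at h5
      subst h5
      have h4' : t.slots = r1 ++ b :: r3 := h4
      have hS := ht.slotsOk
      have hw := ht.wt_eq_sum
      have hl := ht.length_le
      rw [h4'] at hS hw hl h3
      have hl' : ((r1 ++ b :: r3 : List (Tree α i))).length = (r1 ++ r3).length + 1 := by
        simp only [List.length_append, List.length_cons]; omega
      have hw' : t.wt - b.wt = (List.map (slotWt (i + 1)) (r1 ++ r3)).sum := by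
        have e1 : (List.map (slotWt (i + 1)) (r1 ++ b :: r3)).sum =
            (List.map (slotWt (i + 1)) (r1 ++ r3)).sum + b.wt := by
          exact sum_map_remove (slotWt (i + 1)) r1 r3 b
        have := hw.trans e1
        omega
      refine ⟨hapart, (hS.2 b (mem_append_cons r1 r3 b)).1, ⟨SlotsOk.wellFormed ?_ ?_ hw', ?_⟩,
        ?_, ?_⟩
      · exact hS.sublist (List.Sublist.append_left (List.sublist_cons_self b r3) r1)
      · exact (Nat.le_succ _).trans (hl'.symm.le.trans hl)
      · exact Nat.le_of_succ_le_succ (h3.trans hl'.le)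
      · have e1 : items (i + 1) t = (r1 ++ b :: r3).flatMap (items i) := by
          rw [← h4']; rfl
        rw [e1]
        change List.Perm _ (items i b ++ (r1 ++ r3).flatMap (items i))
        rw [List.flatMap_append, List.flatMap_cons, List.flatMap_append, ← List.append_assoc,
          ← List.append_assoc]
        exact List.perm_append_comm.append_right _
      · rw [deficit_succ, deficit_succ, h4']
        exact (sum_map_remove (nodeDeficit B) r1 r3 b).trans (add_comm _ _)
    · simp at h5
  · simp at h2

end MergeRoots


/-! ### Sums over all forests -/

section Total

variable {α : Type}

/-- The key-record pairs in the trees of a forest. -/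
def forestItems (i : ℕ) (ts : List (Tree α i)) : Multiset α := ↑(ts.flatMap (items i))

/-- The sum of a function of the forests. -/
def DynTree.total {M : Type} [AddCommMonoid M] (g : (i : ℕ) → List (Tree α i) → M)
    (s : DynTree α) : M := ∑ i ∈ Finset.range s.top, g i (s.forest i)

theorem forestItems_nil (i : ℕ) : forestItems i ([] : List (Tree α i)) = 0 := rfl

theorem coe_contents (s : DynTree α) :
    (s.contents : Multiset α) = ↑s.buffer + s.total forestItems := by
  have h : ∀ n : ℕ, (((List.range n).flatMap fun i => (s.forest i).flatMap (items i) : List α) :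
      Multiset α) = ∑ i ∈ Finset.range n, forestItems i (s.forest i) := by
    intro n
    induction n with
    | zero => rfl
    | succ n ih =>
      rw [List.range_succ, List.flatMap_append, ← Multiset.coe_add, ih, Finset.sum_range_succ,
        List.flatMap_singleton]
      rfl
  rw [DynTree.contents, ← Multiset.coe_add, h]
  rfl

variable {M : Type} [AddCommMonoid M]

theorem total_eq_of_le {g : (i : ℕ) → List (Tree α i) → M} (hg : ∀ i, g i [] = 0) {s : DynTree α}
    (hs : ∀ i, s.top ≤ i → s.forest i = []) {n : ℕ} (hn : s.top ≤ n) :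
    s.total g = ∑ i ∈ Finset.range n, g i (s.forest i) := by
  refine Finset.sum_subset (Finset.range_subset_range.2 hn) fun i _ hi => ?_
  rw [hs i (by simpa using hi), hg]

/-- How a sum over all forests changes when some of them change. -/
theorem total_change {g : (i : ℕ) → List (Tree α i) → M} (hg : ∀ i, g i [] = 0)
    {s s' : DynTree α} (hs : ∀ i, s.top ≤ i → s.forest i = [])
    (hs' : ∀ i, s'.top ≤ i → s'.forest i = []) (J : Finset ℕ)
    (h : ∀ i ∉ J, s'.forest i = s.forest i) :
    s'.total g + ∑ i ∈ J, g i (s.forest i) = s.total g + ∑ i ∈ J, g i (s'.forest i) := by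
  obtain ⟨n, hn⟩ : ∃ n, ∀ i ∈ J, i < n := ⟨J.sup id + 1, fun i hi =>
    Nat.lt_succ_of_le (Finset.le_sup (f := id) hi)⟩
  have hJ : J ⊆ Finset.range (n + s.top + s'.top) := fun i hi => by
    have := hn i hi
    simp only [Finset.mem_range]
    omega
  rw [total_eq_of_le hg hs (n := n + s.top + s'.top) (by omega),
    total_eq_of_le hg hs' (n := n + s.top + s'.top) (by omega), ← Finset.sum_sdiff hJ,
    ← Finset.sum_sdiff hJ, Finset.sum_congr rfl fun i hi => by rw [h i (Finset.mem_sdiff.1 hi).2],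
    add_right_comm]

theorem forestItems_le_total {s : DynTree α} (hs : ∀ i, s.top ≤ i → s.forest i = []) (i : ℕ) :
    forestItems i (s.forest i) ≤ s.total forestItems := by
  rcases lt_or_ge i s.top with h | h
  · exact Finset.single_le_sum (f := fun i => forestItems i (s.forest i))
      (fun _ _ => Multiset.zero_le _) (Finset.mem_range.2 h)
  · rw [hs i h]
    exact Multiset.zero_le _

end Total

/-! ### The identifiers of pairs and their levels -/

section Indexed

variable {α : Type} [LinearOrder α]

/-- The pairs in level `0`, the sorted list, or in level `i + 1`, the forest `F_i`. -/
def DynTree.level (s : DynTree α) : ℕ → List α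
  | 0 => s.buffer
  | i + 1 => (s.forest i).flatMap (items i)

/-- The IDs of the pairs in level `k` are less than `upper k`. -/
def DynTree.upper (s : DynTree α) : ℕ → ℕ
  | 0 => s.nextItem
  | k + 1 => s.bound k

/-- The auxiliary trees are correct: `T0` holds the list `l0`, which gives an ID to each pair, `T1`
holds the list `l1`, which gives to each of these IDs a level that contains the pair, and IDs belong
to the interval of their level. -/
structure DynTree.Indexed (B : ℕ) (s : DynTree α) (l0 : List (α × ℕ)) (l1 : List (ℕ × ℕ)) :
    Prop where
  rep0 : s.T0.Represents B l0
  rep1 : s.T1.Represents B l1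
  ids : (l0.map Prod.snd).Perm (l1.map Prod.fst)
  range : ∀ p ∈ l1, s.bound p.2 ≤ p.1 ∧ p.1 < s.upper p.2
  anti : ∀ k, s.bound k ≤ s.upper k
  level : ∀ x n k, (x, n) ∈ l0 → (n, k) ∈ l1 → x ∈ s.level k

namespace DynTree.Indexed

variable {B : ℕ} {s s' : DynTree α} {l0 : List (α × ℕ)} {l1 : List (ℕ × ℕ)}

theorem length_eq (h : s.Indexed B l0 l1) : l1.length = l0.length := by
  simpa using h.ids.symm.length_eq

theorem antitone_bound (h : s.Indexed B l0 l1) : Antitone s.bound :=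
  antitone_nat_of_succ_le fun n => h.anti (n + 1)

theorem lt_nextItem (h : s.Indexed B l0 l1) {p : ℕ × ℕ} (hp : p ∈ l1) : p.1 < s.nextItem := by
  refine (h.range p hp).2.trans_le ?_
  cases p.2 with
  | zero => exact le_rfl
  | succ k => exact (h.antitone_bound (Nat.zero_le k)).trans (h.anti 0)

/-- The intervals of IDs of different levels are disjoint. -/
theorem mem_interval_iff (h : s.Indexed B l0 l1) {p : ℕ × ℕ} (hp : p ∈ l1) (k : ℕ) :
    s.bound k ≤ p.1 ∧ p.1 < s.upper k ↔ p.2 = k := by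
  refine ⟨fun hk => ?_, fun hk => hk ▸ h.range p hp⟩
  have hr := h.range p hp
  have key : ∀ a b : ℕ, a < b → s.upper b ≤ s.bound a := by
    intro a b hab
    obtain ⟨c, rfl⟩ : ∃ c, b = c + 1 := ⟨b - 1, by omega⟩
    exact h.antitone_bound (by omega)
  rcases lt_trichotomy p.2 k with hlt | heq | hlt
  · have := key _ _ hlt
    omega
  · exact heq
  · have := key _ _ hlt
    omega

theorem mem_map_snd (h : s.Indexed B l0 l1) {x : α} {n : ℕ} (hx : (x, n) ∈ l0) :
    ∃ k, (n, k) ∈ l1 := by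
  have : n ∈ l1.map Prod.fst := h.ids.mem_iff.1 (List.mem_map.2 ⟨_, hx, rfl⟩)
  obtain ⟨p, hp, rfl⟩ := List.mem_map.1 this
  exact ⟨p.2, hp⟩

/-- Only the auxiliary trees, the counters and the contents of the levels matter. -/
theorem congr (h : s.Indexed B l0 l1) (e0 : s'.T0 = s.T0) (e1 : s'.T1 = s.T1)
    (en : s'.nextItem = s.nextItem) (eb : s'.bound = s.bound)
    (hl : ∀ k, s.level k ⊆ s'.level k) : s'.Indexed B l0 l1 := by
  have eu : s'.upper = s.upper := by
    funext k
    cases k with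
    | zero => exact en
    | succ k => exact congrFun eb k
  exact ⟨e0 ▸ h.rep0, e1 ▸ h.rep1, h.ids, by rw [eb, eu]; exact h.range, eb ▸ eu ▸ h.anti, fun x n k hx hn => hl k (h.level x n k hx hn)⟩

/-- All pairs of level `a` move to level `b`, by one range assignment. -/
theorem move (h : s.Indexed B l0 l1) (a b : ℕ) (e0 : s'.T0 = s.T0)
    (e1 : s'.T1 = (s.T1.assignRange (s.bound a) (s.upper a) b).ret)
    (ha : ∀ k, s'.bound k ≤ s'.upper k)
    (hr : ∀ k, k ≠ a → s'.bound k ≤ s.bound k ∧ s.upper k ≤ s'.upper k)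
    (hr' : s'.bound b ≤ s.bound a ∧ s.upper a ≤ s'.upper b)
    (hl : ∀ k, k ≠ a → s.level k ⊆ s'.level k) (hl' : s.level a ⊆ s'.level b) :
    s'.Indexed B l0 (l1.map (setIn (s.bound a) (s.upper a) b)) := by
  have hset : ∀ p ∈ l1, setIn (s.bound a) (s.upper a) b p = (p.1, if p.2 = a then b else p.2) := by
    intro p hp
    have := h.mem_interval_iff hp a
    simp only [setIn, this]
    split <;> rfl
  refine ⟨e0 ▸ h.rep0, e1 ▸ (h.rep1.assignRange _ _ _).1, ?_, ?_, ha, ?_⟩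
  · rw [List.map_map, List.map_congr_left (g := Prod.fst) fun p hp => by
      rw [Function.comp_apply, hset p hp]]
    exact h.ids
  · intro q hq
    obtain ⟨p, hp, rfl⟩ := List.mem_map.1 hq
    rw [hset p hp]
    have := h.range p hp
    dsimp only
    split
    · rename_i hpa
      rw [hpa] at this
      exact ⟨hr'.1.trans this.1, this.2.trans_le hr'.2⟩
    · rename_i hpa
      exact ⟨(hr _ hpa).1.trans this.1, this.2.trans_le (hr _ hpa).2⟩
  · intro x n k hx hn
    obtain ⟨⟨n', k'⟩, hp, hpn⟩ := List.mem_map.1 hn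
    rw [hset _ hp] at hpn
    simp only [Prod.mk.injEq] at hpn
    obtain ⟨rfl, rfl⟩ := hpn
    have := h.level x n' k' hx hp
    split
    · rename_i hpa
      rw [hpa] at this
      exact hl' this
    · rename_i hpa
      exact hl _ hpa this

/-- All pairs of a level move to the next level, which takes over the interval of their IDs. -/
theorem moveUp (h : s.Indexed B l0 l1) (a : ℕ) (e0 : s'.T0 = s.T0)
    (e1 : s'.T1 = (s.T1.assignRange (s.bound a) (s.upper a) (a + 1)).ret)
    (en : s'.nextItem = s.nextItem) (eb : s'.bound = Function.update s.bound a (s.upper a))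
    (hl : ∀ k, k ≠ a → s.level k ⊆ s'.level k) (hl' : s.level a ⊆ s'.level (a + 1)) :
    ∃ l1', s'.Indexed B l0 l1' := by
  have hb : ∀ k, s'.bound k = if k = a then s.upper a else s.bound k := fun k => by
    rw [eb, Function.update_apply]
  have hu : ∀ k, s'.upper k = if k = a + 1 then s.upper a else s.upper k := by
    intro k
    cases k with
    | zero => exact en
    | succ k =>
      rw [DynTree.upper, hb]
      simp only [Nat.add_right_cancel_iff]
      rfl
  have h1 : s.bound (a + 1) ≤ s.bound a := h.anti (a + 1)
  have h2 := h.anti a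
  refine ⟨_, h.move a (a + 1) e0 e1 (fun k => ?_) (fun k hk => ?_) ?_ hl hl'⟩
  · rw [hb, hu]
    have := h.anti k
    split <;> split <;> (try subst_vars) <;> omega
  · rw [hb, hu, if_neg hk]
    refine ⟨le_rfl, ?_⟩
    split
    · rename_i hk
      rw [hk]
      exact h2
    · exact le_rfl
  · rw [hb, hu, if_neg (by omega), if_pos rfl]
    exact ⟨h1, le_rfl⟩

/-- All pairs of a level move to the preceding level, which takes over the interval of their IDs. -/
theorem moveDown (h : s.Indexed B l0 l1) (a : ℕ) (e0 : s'.T0 = s.T0)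
    (e1 : s'.T1 = (s.T1.assignRange (s.bound (a + 1)) (s.bound a) a).ret)
    (en : s'.nextItem = s.nextItem) (eb : s'.bound = Function.update s.bound a (s.bound (a + 1)))
    (hl : ∀ k, k ≠ a + 1 → s.level k ⊆ s'.level k) (hl' : s.level (a + 1) ⊆ s'.level a) :
    ∃ l1', s'.Indexed B l0 l1' := by
  have hb : ∀ k, s'.bound k = if k = a then s.bound (a + 1) else s.bound k := fun k => by
    rw [eb, Function.update_apply]
  have hu : ∀ k, s'.upper k = if k = a + 1 then s.bound (a + 1) else s.upper k := by
    intro k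
    cases k with
    | zero => exact en
    | succ k =>
      rw [DynTree.upper, hb]
      simp only [Nat.add_right_cancel_iff]
      rfl
  have h1 : s.bound (a + 1) ≤ s.bound a := h.anti (a + 1)
  have h2 := h.anti a
  refine ⟨_, h.move (a + 1) a e0 e1 (fun k => ?_) (fun k hk => ?_) ?_ hl hl'⟩
  · rw [hb, hu]
    have := h.anti k
    split <;> split <;> (try subst_vars) <;> omega
  · rw [hb, hu, if_neg hk]
    refine ⟨?_, le_rfl⟩
    split
    · rename_i hk
      rw [hk]
      exact h1
    · exact le_rfl
  · rw [hb, hu, if_pos rfl, if_neg (by omega)]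
    exact ⟨le_rfl, h2⟩

/-- A new pair gets the next ID and enters level `0`. -/
theorem insert (h : s.Indexed B l0 l1) (hB : 4 ≤ B) {x : α} (hx : ∀ p ∈ l0, p.1 ≠ x)
    (e0 : s'.T0 = (s.T0.insert B x s.nextItem).ret)
    (e1 : s'.T1 = (s.T1.insert B s.nextItem 0).ret) (en : s'.nextItem = s.nextItem + 1)
    (eb : s'.bound = s.bound) (hl : ∀ k, s.level k ⊆ s'.level k) (hxl : x ∈ s'.level 0) :
    s'.Indexed B (insertPair x s.nextItem l0) (insertPair s.nextItem 0 l1) := by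
  have hn : ∀ p ∈ l1, p.1 ≠ s.nextItem := fun p hp => (h.lt_nextItem hp).ne
  have p0 := insertPair_perm (v := s.nextItem) hx
  have p1 := insertPair_perm (v := 0) hn
  have hu : ∀ k, s.upper k ≤ s'.upper k := by
    intro k
    cases k with
    | zero => exact (Nat.le_succ _).trans en.ge
    | succ k => exact (congrFun eb k).ge
  refine ⟨e0 ▸ (h.rep0.insert hB _ hx).1, e1 ▸ (h.rep1.insert hB _ hn).1, ?_, ?_,
    fun k => eb ▸ (h.anti k).trans (hu k), ?_⟩
  · exact (p0.map _).trans ((h.ids.cons s.nextItem).trans (p1.map Prod.fst).symm)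
  · intro p hp
    rcases List.mem_cons.1 (p1.mem_iff.1 hp) with rfl | hp
    · exact ⟨eb ▸ h.anti 0, (Nat.lt_succ_self _).trans_le en.ge⟩
    · exact ⟨eb ▸ (h.range p hp).1, (h.range p hp).2.trans_le (hu _)⟩
  · intro y n k hy hk
    rcases List.mem_cons.1 (p0.mem_iff.1 hy) with hy | hy <;>
      rcases List.mem_cons.1 (p1.mem_iff.1 hk) with hk | hk
    · rw [(Prod.mk.inj hy).1, (Prod.mk.inj hk).2]
      exact hxl
    · exact absurd (Prod.mk.inj hy).2 (hn _ hk)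
    · obtain ⟨k', hk'⟩ := h.mem_map_snd hy
      exact absurd (Prod.mk.inj hk).1 (hn _ hk')
    · exact hl k (h.level y n k hy hk)

/-- A pair disappears. -/
theorem delete (h : s.Indexed B l0 l1) (hB : 4 ≤ B) {x : α} {n : ℕ} (hx : (x, n) ∈ l0)
    (e0 : s'.T0 = (s.T0.delete B x).ret)
    (e1 : s'.T1 = (s.T1.delete B n).ret) (en : s'.nextItem = s.nextItem)
    (eb : s'.bound = s.bound) (hl : ∀ k y, y ∈ s.level k → y ≠ x → y ∈ s'.level k) :
    s'.Indexed B (l0.filter fun p => p.1 ≠ x) (l1.filter fun p => p.1 ≠ n) := by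
  have eu : s'.upper = s.upper := by
    funext k
    cases k with
    | zero => exact en
    | succ k => exact congrFun eb k
  have hn1 : (l1.map Prod.fst).Nodup := (List.pairwise_map.2 h.rep1.sorted).imp fun h => h.ne
  have hn0 : (l0.map Prod.snd).Nodup := h.ids.nodup_iff.2 hn1
  have hk0 : (l0.map Prod.fst).Nodup := (List.pairwise_map.2 h.rep0.sorted).imp fun h => h.ne
  -- the keys and the IDs in `l0` are distinct, so both ways to remove a pair agree
  have hf : ∀ p ∈ l0, p.1 = x ↔ p.2 = n := fun p hp =>
    ⟨fun hpx => congrArg Prod.snd (List.inj_on_of_nodup_map hk0 hp hx hpx),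
      fun hpn => congrArg Prod.fst (List.inj_on_of_nodup_map hn0 hp hx hpn)⟩
  refine ⟨e0 ▸ (h.rep0.delete hB _).1, e1 ▸ (h.rep1.delete hB _).1, ?_, ?_, eb ▸ eu ▸ h.anti, ?_⟩
  · have f0 : (l0.filter fun p => p.1 ≠ x).map Prod.snd =
        (l0.map Prod.snd).filter fun m => m ≠ n := by
      rw [List.filter_map]
      exact congrArg _ (List.filter_congr fun p hp => by simp [hf p hp])
    have f1 : (l1.filter fun p => p.1 ≠ n).map Prod.fst =
        (l1.map Prod.fst).filter fun m => m ≠ n := by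
      rw [List.filter_map]
      rfl
    rw [f0, f1]
    exact h.ids.filter _
  · intro p hp
    rw [eb, eu]
    exact h.range p (List.mem_of_mem_filter hp)
  · intro y m k hy hk
    have hy' := List.mem_filter.1 hy
    exact hl k y (h.level y m k hy'.1 (List.mem_of_mem_filter hk)) (by simpa using hy'.2)

end DynTree.Indexed

end Indexed


/-! ### Logarithms -/

section Logarithm

/-- The logarithm to the base `B` of the number `n` of pairs; it is positive also for `n ≤ 1`. -/
noncomputable def lg (B n : ℕ) : ℝ := Real.logb B (max 2 (n : ℝ))

variable {B n : ℕ}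

theorem one_lt_cast (hB : 4 ≤ B) : (1 : ℝ) < B := by exact_mod_cast (show 1 < B by omega)

theorem two_le_max : (2 : ℝ) ≤ max 2 (n : ℝ) := le_max_left _ _

theorem le_lg_of_pow_le (hB : 4 ≤ B) {h : ℕ} {a : ℕ} (hh : (B : ℝ) ^ h ≤ (max 2 (n : ℝ)) ^ a) :
    (h : ℝ) ≤ a * lg B n := by
  have h0 : (0 : ℝ) < B := one_pos.trans (one_lt_cast hB)
  have := Real.logb_le_logb_of_le (one_lt_cast hB) (pow_pos h0 h) hh
  rwa [Real.logb_pow, Real.logb_pow, Real.logb_self_eq_one (one_lt_cast hB), mul_one] at this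

theorem one_le_mul_lg (hB : 4 ≤ B) (n : ℕ) : 1 ≤ B * lg B n := by
  have h1 : (B : ℝ) ≤ 2 ^ B := by exact_mod_cast Nat.lt_two_pow_self.le
  have := le_lg_of_pow_le (n := n) (h := 1) (a := B) hB
    (by rw [pow_one]; exact h1.trans (pow_le_pow_left₀ two_pos.le two_le_max _))
  simpa using this

theorem lg_nonneg (hB : 4 ≤ B) (n : ℕ) : 0 ≤ lg B n :=
  Real.logb_nonneg (one_lt_cast hB) (one_le_two.trans two_le_max)

theorem lg_mono (hB : 4 ≤ B) {m n : ℕ} (h : m ≤ n) : lg B m ≤ lg B n :=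
  Real.logb_le_logb_of_le (one_lt_cast hB) (two_pos.trans_le two_le_max)
    (max_le_max le_rfl (by exact_mod_cast h))

theorem lg_succ_le (hB : 4 ≤ B) (n : ℕ) : lg B (n + 1) ≤ 2 * lg B n := by
  have h2 := two_le_max (n := n)
  have : lg B (n + 1) ≤ Real.logb B ((max 2 (n : ℝ)) ^ 2) := by
    refine Real.logb_le_logb_of_le (one_lt_cast hB) (two_pos.trans_le two_le_max) (max_le ?_ ?_)
    · nlinarith
    · push_cast
      nlinarith [le_max_right 2 (n : ℝ)]
  rwa [Real.logb_pow] at this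

/-- The logarithm grows so slowly that all `n` pairs can pay for its growth. -/
theorem mul_lg_succ_sub_le (hB : 4 ≤ B) (n : ℕ) : n * (lg B (n + 1) - lg B n) ≤ 1 := by
  rcases lt_or_ge n 2 with hn | hn
  · have : lg B (n + 1) = lg B n := by
      have h1 : ((n + 1 : ℕ) : ℝ) ≤ 2 := by exact_mod_cast hn
      have h2 : (n : ℝ) ≤ 2 := by exact_mod_cast hn.le
      rw [lg, lg, max_eq_left h1, max_eq_left h2]
    rw [this, sub_self, mul_zero]
    exact zero_le_one
  · have h2 : (2 : ℝ) ≤ n := by exact_mod_cast hn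
    have h3 : (2 : ℝ) ≤ ((n + 1 : ℕ) : ℝ) := by push_cast; linarith
    have hn0 : (0 : ℝ) < n := by linarith
    have hlog : 1 ≤ Real.log B := by
      rw [Real.le_log_iff_exp_le (by linarith [one_lt_cast hB])]
      have h4 : (4 : ℝ) ≤ B := by exact_mod_cast hB
      linarith [Real.exp_one_lt_d9]
    rw [lg, lg, max_eq_right h2, max_eq_right h3,
      ← Real.logb_div (by positivity) (by positivity), Real.logb, mul_div_assoc',
      div_le_one (by linarith)]
    have h5 := Real.log_le_sub_one_of_pos (x := ((n + 1 : ℕ) : ℝ) / n) (by positivity)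
    have h6 : ((n + 1 : ℕ) : ℝ) / n - 1 = 1 / n := by
      push_cast
      field_simp
      ring
    rw [h6] at h5
    calc (n : ℝ) * Real.log (((n + 1 : ℕ) : ℝ) / n) ≤ n * (1 / n) := by gcongr
      _ = 1 := by field_simp
      _ ≤ Real.log B := hlog

theorem le_lg_add_one (hB : 4 ≤ B) {i : ℕ} (hi : B ^ i ≤ 2 * n) : (i : ℝ) ≤ lg B n + 1 := by
  cases i with
  | zero => simpa using add_nonneg (lg_nonneg hB n) zero_le_one
  | succ i =>
    have h1 : B ^ i ≤ n := by
      rw [pow_succ] at hi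
      have : B ^ i * 2 ≤ B ^ i * B := Nat.mul_le_mul_left _ (by omega)
      omega
    have := le_lg_of_pow_le (n := n) (h := i) (a := 1) hB
      (by rw [pow_one]; exact le_trans (by exact_mod_cast h1) (le_max_right _ _))
    push_cast at this ⊢
    linarith

theorem le_lg (hB : 4 ≤ B) {i : ℕ} (hi : B ^ (i + 1) ≤ 4 * n) : (i : ℝ) ≤ lg B n := by
  have h1 : B ^ i ≤ n := by
    rw [pow_succ] at hi
    have : B ^ i * 4 ≤ B ^ i * B := Nat.mul_le_mul_left _ hB
    omega
  have := le_lg_of_pow_le (n := n) (h := i) (a := 1) hB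
    (by rw [pow_one]; exact le_trans (by exact_mod_cast h1) (le_max_right _ _))
  simpa using this

/-- The cost of an operation on an auxiliary tree, up to the logarithm. -/
def auxConst (B : ℕ) : ℕ := (B + 2) * (5 * B + 6)

theorem auxTime_le {κ : Type} [LinearOrder κ] (hB : 4 ≤ B) {T : AuxTree κ} {l : List (κ × ℕ)}
    (hT : T.Represents B l) {n : ℕ} (hl : l.length ≤ n) {k : ℕ}
    (hk : k ≤ (T.height + 1) * (5 * B + 6)) : (k : ℝ) ≤ auxConst B * lg B n := by
  have h1 : (T.height : ℝ) ≤ 2 * lg B n := by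
    have := hT.pow_height_le hB
    refine (le_lg_of_pow_le (a := 2) hB (n := n) ?_)
    refine le_trans (b := ((max 2 l.length : ℕ) : ℝ) ^ 2) (by exact_mod_cast this) ?_
    gcongr
    push_cast
    exact max_le_max le_rfl (by exact_mod_cast hl)
  have h2 := one_le_mul_lg hB n
  have h3 : (k : ℝ) ≤ (T.height + 1) * (5 * B + 6) := by exact_mod_cast hk
  refine h3.trans ?_
  rw [auxConst]
  push_cast
  have : (0 : ℝ) ≤ 5 * B + 6 := by positivity
  nlinarith

end Logarithm


/-! ### The potential and the merging of full forests -/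

section Cascade

variable {α : Type}

/-- The cost of merging two roots, relative to the capacity of a child of a root. -/
def mergeConst (B : ℕ) : ℕ := 30 * B

/-- The weight of a deficit in the potential. -/
def deficitConst (B : ℕ) : ℕ := 2 * (mergeConst B + 14)

/-- The weight of a tree in the potential. -/
def treeConst (B : ℕ) : ℕ := auxConst B + B + 12

/-- The potential of a forest of trees of height `i`.  Each tree of the forest can pay for its merge
into higher and higher trees, up to the height `L + 2`, where `L` is the logarithm of the number of
pairs. -/
noncomputable def forestPot (B : ℕ) (L : ℝ) (i : ℕ) (ts : List (Tree α i)) : ℝ :=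
  deficitConst B * ((ts.map (deficit B i)).sum : ℕ) +
    treeConst B * ts.length * ((B : ℝ) ^ (i + 1) * (L + 2 - i) + L)

/-- The potential of the data structure. -/
noncomputable def DynTree.pot (B : ℕ) (L : ℝ) (s : DynTree α) : ℝ := s.total (forestPot B L)

theorem forestPot_nil (B : ℕ) (L : ℝ) (i : ℕ) : forestPot B L i ([] : List (Tree α i)) = 0 := by
  simp [forestPot]

theorem pot_change {B : ℕ} {L : ℝ} {s s' : DynTree α} (hs : ∀ i, s.top ≤ i → s.forest i = [])
    (hs' : ∀ i, s'.top ≤ i → s'.forest i = []) (J : Finset ℕ)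
    (h : ∀ i ∉ J, s'.forest i = s.forest i) :
    s'.pot B L + ∑ i ∈ J, forestPot B L i (s.forest i) =
      s.pot B L + ∑ i ∈ J, forestPot B L i (s'.forest i) :=
  total_change (forestPot_nil B L) hs hs' J h

theorem setForest_forest_self (s : DynTree α) (i : ℕ) (ts : List (Tree α i)) :
    (s.setForest i ts).forest i = ts := Function.update_self _ _ _

theorem setForest_forest_of_ne (s : DynTree α) {i j : ℕ} (h : j ≠ i) (ts : List (Tree α i)) :
    (s.setForest i ts).forest j = s.forest j := Function.update_of_ne h _ _

variable [LinearOrder α]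

/-- The form of the forests, apart from the number of trees. -/
structure DynTree.Shape (B : ℕ) (s : DynTree α) : Prop where
  top_empty : ∀ i, s.top ≤ i → s.forest i = []
  balanced : ∀ i, ∀ t ∈ s.forest i, WeightBalanced B i t
  nodup : (s.total forestItems).Nodup

theorem DynTree.Shape.lt_top {B i : ℕ} {s : DynTree α} {t : Tree α i} (hs : s.Shape B)
    (ht : t ∈ s.forest i) : i < s.top := by
  by_contra h
  rw [hs.top_empty i (not_lt.1 h)] at ht
  exact List.not_mem_nil ht

/-- Changes in some of the forests that keep their contents and the balance of the trees. -/
theorem shape_of_change {B : ℕ} {s s' : DynTree α} (hs : ∀ i, s.top ≤ i → s.forest i = [])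
    (hs' : ∀ i, s'.top ≤ i → s'.forest i = []) (hn : (s.total forestItems).Nodup) (J : Finset ℕ)
    (hb : ∀ i ∉ J, ∀ t ∈ s.forest i, WeightBalanced B i t)
    (hb' : ∀ i ∈ J, ∀ t ∈ s'.forest i, WeightBalanced B i t)
    (h : ∀ i ∉ J, s'.forest i = s.forest i)
    (he : ∑ i ∈ J, forestItems i (s'.forest i) = ∑ i ∈ J, forestItems i (s.forest i)) :
    s'.Shape B ∧ s'.total forestItems = s.total forestItems := by
  have h1 := total_change forestItems_nil hs hs' J h
  rw [he] at h1
  have h2 := add_right_cancel h1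
  refine ⟨⟨hs', fun i => ?_, h2 ▸ hn⟩, h2⟩
  by_cases hi : i ∈ J
  · exact hb' i hi
  · rw [h i hi]
    exact hb i hi

/-- The weights of the trees of a forest. -/
theorem forest_weights {B i : ℕ} {ts : List (Tree α i)} (h : ∀ t ∈ ts, WeightBalanced B i t) :
    (ts.flatMap (items i)).length ≤ ts.length * B ^ (i + 1) ∧
    ts.length * B ^ i ≤ 2 * (ts.flatMap (items i)).length ∧
    2 * (ts.length * B ^ i) ≤ (ts.map (deficit B i)).sum + 2 * (ts.flatMap (items i)).length := by
  induction ts with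
  | nil => simp
  | cons t ts ih =>
    obtain ⟨h1, h2⟩ := List.forall_mem_cons.1 h
    obtain ⟨i1, i2, i3⟩ := ih h2
    have a1 := h1.wellFormed.wt_le
    have a2 := h1.pow_le
    have a3 := h1.two_mul_pow_le
    have a4 : t.wt = (items i t).length := h1.wellFormed.wt_eq
    simp only [List.flatMap_cons, List.length_append, List.length_cons, List.map_cons,
      List.sum_cons, add_mul, one_mul]
    omega

/-- What a sequence of repairs of the forests achieves: it keeps the contents, it leaves all forests
with fewer than `B` trees, and up to `C` steps it is paid by the potential. -/
structure DynTree.Settles (B : ℕ) (L C : ℝ) (l0 : List (α × ℕ)) (s s' : DynTree α) (k : ℕ) :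
    Prop where
  shape : s'.Shape B
  indexed : ∃ l1, s'.Indexed B l0 l1
  length_lt : ∀ i, (s'.forest i).length < B
  buffer_eq : s'.buffer = s.buffer
  total_eq : s'.total forestItems = s.total forestItems
  pot_le : k + s'.pot B L ≤ s.pot B L + C

/-- Reading and merging the trees of a full forest, and building their union, followed by any
program `f` on the new tree. -/
theorem runs_mergeForest {B i : ℕ} (hB : 4 ≤ B) (h4 : 4 ∣ B) (d : α) {ts : List (Tree α i)}
    (hts : ∀ t ∈ ts, WeightBalanced B i t) (hlen : ts.length = B)
    (hn : (ts.flatMap (items i)).Nodup) {γ : Type} {f : Tree α (i + 1) → Prog α γ}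
    {Q : γ → ℕ → Prop}
    (hf : ∀ t k₀, WeightBalanced B (i + 1) t → (items (i + 1) t).Perm (ts.flatMap (items i)) →
      deficit B (i + 1) t ≤ (ts.map (deficit B i)).sum → k₀ ≤ (B + 11) * B ^ (i + 2) + B →
      Runs (f t) fun r k => Q r (k₀ + k)) :
    Runs (do
      let ls ← ts.mapM (collect i)
      let l ← mergeSorted ls
      let t ← build B d (i + 1) l
      f t) Q := by
  obtain ⟨w1, w2, w3⟩ := forest_weights hts
  refine Runs.bind (Runs.mapM (P := fun t l => l = items i t) (C := 3 * B ^ (i + 1))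
    fun t ht => (runs_collect hB (hts t ht).wellFormed).mono fun l k h => ⟨h.1, by omega⟩)
    fun ls k1 h1 => ?_
  obtain ⟨hF, hk1⟩ := h1
  have hls : ls = ts.map (items i) := by
    symm
    exact List.forall₂_eq_eq_eq ▸ List.forall₂_map_left_iff.2 (hF.imp fun _ _ h => h.symm)
  have hfl : ls.flatten = ts.flatMap (items i) := by rw [hls, List.flatMap_def]
  refine Runs.bind (runs_mergeSorted (ls := ls) (fun l hl => ?_) (hfl ▸ hn)) fun l k2 h2 => ?_
  · rw [hls] at hl
    obtain ⟨t, ht, rfl⟩ := List.mem_map.1 hl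
    exact (hts t ht).wellFormed.pairwise_items
  obtain ⟨p1, p2, p3⟩ := h2
  rw [hfl] at p1 p3
  have hpl := p1.length_eq
  have hlsl : ls.length = B := by rw [hls, List.length_map, hlen]
  rw [hlen, ← hpl] at w1 w2 w3
  rw [← hpl, hlsl] at p3
  rw [hlen] at hk1
  have e1 : B ^ (i + 2) = B * B ^ (i + 1) := pow_succ' B (i + 1)
  have e2 : B ^ (i + 1) = B * B ^ i := pow_succ' B i
  refine Runs.bind (runs_build hB h4 d p2 (by rw [e1]; exact w1) (by rw [e2]; exact w2))
    fun t k3 ht => ?_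
  obtain ⟨ht, hk3⟩ := ht
  refine (hf t (k1 + (k2 + k3)) ht.balanced (ht.items_eq ▸ p1) ?_ ?_).mono
    fun r k h => by rwa [add_assoc, add_assoc] at h
  · have := ht.deficit_le
    omega
  · have : B * (l.length + 1) ≤ B * (B ^ (i + 2) + 1) := Nat.mul_le_mul_left _ (by omega)
    have e3 : B * (B ^ (i + 2) + 1) = B * B ^ (i + 2) + B := by ring
    have e4 : B * (3 * B ^ (i + 1)) = 3 * B ^ (i + 2) := by rw [e1]; ring
    have e5 : (B + 11) * B ^ (i + 2) = B * B ^ (i + 2) + 11 * B ^ (i + 2) := by ring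
    have e6 : B ^ (i + 1 + 1) = B ^ (i + 2) := rfl
    omega

/-- The merging of full forests, from the forest `i` on, is paid by the potential, apart from the
last test.  By `hn`, the bound `n` on the number of rounds is no restriction: the cascade stops at
the latest at the first empty forest. -/
theorem runs_cascade {B : ℕ} (hB : 4 ≤ B) (h4 : 4 ∣ B) (d : α) {N : ℕ} {l0 : List (α × ℕ)}
    (hl0 : l0.length ≤ N) (n i : ℕ) {s : DynTree α} {l1 : List (ℕ × ℕ)} (hs : s.Shape B)
    (hI : s.Indexed B l0 l1) (hi : (s.forest i).length ≤ B)
    (hj : ∀ j, j ≠ i → (s.forest j).length < B)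
    (hn : (s.forest i).length < B ∨ s.top ≤ i + n) :
    Runs (cascade B d n i s) (s.Settles B (lg B N) (B * lg B N) l0) := by
  have hall : ∀ {s : DynTree α} {i : ℕ}, (∀ j, j ≠ i → (s.forest j).length < B) →
      (s.forest i).length < B → ∀ j, (s.forest j).length < B := by
    intro s i hj h j
    rcases eq_or_ne j i with rfl | hji
    · exact h
    · exact hj j hji
  have hL := one_le_mul_lg hB N
  induction n generalizing i s l1 with
  | zero =>
    have hlt : (s.forest i).length < B := by
      rcases hn with h | h
      · exact h
      · rw [hs.top_empty i h]
        simp only [List.length_nil]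
        omega
    exact Runs.pure ⟨hs, ⟨l1, hI⟩, hall hj hlt, rfl, rfl, by simp; linarith⟩
  | succ n ih =>
    refine Runs.tick_bind ?_
    split
    · rename_i hlt
      exact Runs.pure ⟨hs, ⟨l1, hI⟩, hall hj hlt, rfl, rfl, by push_cast; linarith⟩
    rename_i hlt
    have hlen : (s.forest i).length = B := by omega
    have hitop : i < s.top := by
      by_contra h
      rw [hs.top_empty i (not_lt.1 h)] at hlen
      simp at hlen
      omega
    refine runs_mergeForest hB h4 d (hs.balanced i) hlen
      (Multiset.coe_nodup.1 ((Multiset.nodup_of_le (forestItems_le_total hs.top_empty i))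
        hs.nodup)) fun t k0 ht hperm hdef hk0 => ?_
    obtain ⟨-, haux⟩ := hI.rep1.assignRange (s.bound (i + 1)) (s.bound i) (i + 2)
    refine Runs.liftTimed_bind ?_
    dsimp only
    generalize hs'' : ({ ((s.setForest i []).setForest (i + 1) (t :: s.forest (i + 1))) with
      T1 := (s.T1.assignRange (s.bound (i + 1)) (s.bound i) (i + 2)).ret
      top := max s.top (i + 2)
      bound := Function.update s.bound (i + 1) (s.bound i) } : DynTree α) = s''
    have f0 : s''.forest i = [] := by
      rw [← hs'']
      exact (setForest_forest_of_ne _ (Nat.succ_ne_self i).symm _).trans (setForest_forest_self _ _ _)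
    have f1 : s''.forest (i + 1) = t :: s.forest (i + 1) := by
      rw [← hs'']
      exact setForest_forest_self _ _ _
    have f2 : ∀ j ∉ ({i, i + 1} : Finset ℕ), s''.forest j = s.forest j := by
      intro j hj
      simp only [Finset.mem_insert, Finset.mem_singleton, not_or] at hj
      rw [← hs'']
      exact (setForest_forest_of_ne _ hj.2 _).trans (setForest_forest_of_ne _ hj.1 _)
    have ft : s''.top = max s.top (i + 2) := by rw [← hs'']
    have hne : i ≠ i + 1 := (Nat.succ_ne_self i).symm
    have htop : ∀ j, s''.top ≤ j → s''.forest j = [] := by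
      intro j hj
      rw [ft] at hj
      rw [f2 j (by simp only [Finset.mem_insert, Finset.mem_singleton]; omega)]
      exact hs.top_empty j (by omega)
    obtain ⟨hshape, htot⟩ := shape_of_change (B := B) hs.top_empty htop hs.nodup {i, i + 1}
      (fun j _ => hs.balanced j)
      (by
        intro j hj t' ht'
        simp only [Finset.mem_insert, Finset.mem_singleton] at hj
        rcases hj with rfl | rfl
        · rw [f0] at ht'
          exact absurd ht' List.not_mem_nil
        · rw [f1] at ht'
          rcases List.mem_cons.1 ht' with rfl | ht'
          · exact ht
          · exact hs.balanced _ _ ht') f2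
      (by
        rw [Finset.sum_pair hne, Finset.sum_pair hne, f0, f1, forestItems_nil, zero_add,
          forestItems, forestItems, forestItems, List.flatMap_cons, ← Multiset.coe_add]
        exact congrArg (· + _) (Multiset.coe_eq_coe.2 hperm))
    have hpot := pot_change (B := B) (L := lg B N) hs.top_empty htop {i, i + 1} f2
    rw [Finset.sum_pair hne, Finset.sum_pair hne, f0, f1, forestPot_nil, zero_add] at hpot
    obtain ⟨l1', hI'⟩ := hI.moveUp (s' := s'') (i + 1) (by rw [← hs'']; rfl) (by rw [← hs'']; rfl)
      (by rw [← hs'']; rfl) (by rw [← hs'']; rfl)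
      (by
        intro k hk
        cases k with
        | zero =>
          have : s''.buffer = s.buffer := by rw [← hs'']; rfl
          rw [DynTree.level, DynTree.level, this]
          exact List.Subset.refl _
        | succ k =>
          rw [DynTree.level, DynTree.level]
          rcases eq_or_ne k (i + 1) with rfl | hk'
          · rw [f1, List.flatMap_cons]
            exact List.subset_append_right _ _
          · rw [f2 k (by simp only [Finset.mem_insert, Finset.mem_singleton]; omega)]
            exact List.Subset.refl _)
      (by
        rw [DynTree.level, DynTree.level, f1, List.flatMap_cons]
        exact List.Subset.trans hperm.symm.subset (List.subset_append_left _ _))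
    have hi1 := hj (i + 1) (Nat.succ_ne_self i)
    refine (ih (i + 1) hshape hI' ?_ ?_ ?_).mono fun s' k h => ?_
    · rw [f1, List.length_cons]
      omega
    · intro j hj'
      rcases eq_or_ne j i with rfl | hji
      · rw [f0, List.length_nil]
        omega
      · rw [f2 j (by simp only [Finset.mem_insert, Finset.mem_singleton]; omega)]
        exact hj j hji
    · rcases Nat.eq_zero_or_pos n with rfl | hn0
      · left
        rw [f1, hs.top_empty (i + 1) (by omega)]
        simp only [List.length_cons, List.length_nil]
        omega
      · right
        omega
    · refine ⟨h.shape, h.indexed, h.length_lt, ?_, h.total_eq.trans htot, ?_⟩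
      · rw [h.buffer_eq, ← hs'']
        rfl
      · have hp := h.pot_le
        have hauxR := auxTime_le hB hI.rep1 (hI.length_eq.trans_le hl0) haux
        have hk0R : (k0 : ℝ) ≤ (B + 11) * (B : ℝ) ^ (i + 2) + B := by exact_mod_cast hk0
        have hdefR : (deficit B (i + 1) t : ℝ) ≤ (((s.forest i).map (deficit B i)).sum : ℕ) := by
          exact_mod_cast hdef
        have hBQ : (B : ℝ) + 1 ≤ (B : ℝ) ^ (i + 2) := by
          have : B ^ 2 ≤ B ^ (i + 2) := Nat.pow_le_pow_right (by omega) (by omega)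
          have : B + 1 ≤ B ^ (i + 2) := by nlinarith
          exact_mod_cast this
        have hL0 := lg_nonneg hB N
        have hB4 : (4 : ℝ) ≤ B := by exact_mod_cast hB
        have e1 : forestPot B (lg B N) (i + 1) (t :: s.forest (i + 1)) =
            forestPot B (lg B N) (i + 1) (s.forest (i + 1)) +
              deficitConst B * deficit B (i + 1) t +
              treeConst B * ((B : ℝ) ^ (i + 2) * (lg B N + 1 - i) + lg B N) := by
          simp only [forestPot, List.map_cons, List.sum_cons, List.length_cons]
          push_cast
          ring
        have e2 : forestPot B (lg B N) i (s.forest i) =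
            deficitConst B * (((s.forest i).map (deficit B i)).sum : ℕ) +
              treeConst B * ((B : ℝ) ^ (i + 2) * (lg B N + 2 - i) + B * lg B N) := by
          rw [forestPot, hlen, pow_succ (B : ℝ) (i + 1)]
          ring
        have e3 : (0 : ℝ) ≤ auxConst B := Nat.cast_nonneg _
        have e4 : (deficitConst B : ℝ) * deficit B (i + 1) t ≤
            deficitConst B * (((s.forest i).map (deficit B i)).sum : ℕ) := by gcongr
        have e5 : (treeConst B : ℝ) = auxConst B + B + 12 := by
          rw [treeConst]
          push_cast
          ring
        -- one merge releases this much potential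
        have e6 : ((B : ℝ) + 12) * (B : ℝ) ^ (i + 2) + auxConst B * lg B N ≤
            treeConst B * ((B : ℝ) ^ (i + 2) + (B - 1) * lg B N) := by
          rw [e5]
          have h1 : 0 ≤ (auxConst B : ℝ) * (B : ℝ) ^ (i + 2) := by positivity
          have h2 : 0 ≤ (auxConst B : ℝ) * lg B N * (B - 2) :=
            mul_nonneg (by positivity) (by linarith)
          have h3 : 0 ≤ ((B : ℝ) + 12) * ((B - 1) * lg B N) :=
            mul_nonneg (by positivity) (mul_nonneg (by linarith) hL0)
          linarith
        push_cast
        rw [e1, e2] at hpot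
        linarith

end Cascade


/-! ### Repairing a forest after a deletion -/

section FixRoot

variable {α : Type}

theorem forestPot_le {B i : ℕ} {L : ℝ} (hL : 0 ≤ L) (hi : (i : ℝ) ≤ L + 1)
    {us vs : List (Tree α i)} (hl : vs.length ≤ us.length)
    (hd : (vs.map (deficit B i)).sum ≤ (us.map (deficit B i)).sum) :
    forestPot B L i vs ≤ forestPot B L i us := by
  have h1 : (0 : ℝ) ≤ (B : ℝ) ^ (i + 1) * (L + 2 - i) + L :=
    add_nonneg (mul_nonneg (by positivity) (by linarith)) hL
  unfold forestPot
  gcongr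

variable [LinearOrder α]

/-- A change in one forest only. -/
theorem settles_setForest {B i : ℕ} {L C : ℝ} {s : DynTree α} {us vs : List (Tree α i)}
    {l0 : List (α × ℕ)} {l1 : List (ℕ × ℕ)} {k : ℕ} (hf : s.forest i = us) (hi : i < s.top)
    (hs : ∀ j, s.top ≤ j → s.forest j = []) (hn : (s.total forestItems).Nodup)
    (hb : ∀ j, j ≠ i → ∀ t ∈ s.forest j, WeightBalanced B j t) (hI : s.Indexed B l0 l1)
    (hlen : ∀ j, (s.forest j).length < B) (hvs : ∀ t ∈ vs, WeightBalanced B i t)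
    (hl : vs.length ≤ us.length) (hp : (vs.flatMap (items i)).Perm (us.flatMap (items i)))
    (hd : (vs.map (deficit B i)).sum ≤ (us.map (deficit B i)).sum) (hL : 0 ≤ L)
    (hiL : (i : ℝ) ≤ L + 1) (hk : (k : ℝ) ≤ C) : s.Settles B L C l0 (s.setForest i vs) k := by
  have f1 := setForest_forest_self s i vs
  have f2 : ∀ j ∉ ({i} : Finset ℕ), (s.setForest i vs).forest j = s.forest j := fun j hj =>
    setForest_forest_of_ne s (by simpa using hj) vs
  have htop : ∀ j, (s.setForest i vs).top ≤ j → (s.setForest i vs).forest j = [] := by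
    intro j hj
    change s.top ≤ j at hj
    rw [f2 j (by simp only [Finset.mem_singleton]; omega)]
    exact hs j hj
  obtain ⟨hshape, htot⟩ := shape_of_change (B := B) hs htop hn {i}
    (fun j hj => hb j (by simpa using hj))
    (by
      intro j hj t ht
      obtain rfl := Finset.mem_singleton.1 hj
      rw [f1] at ht
      exact hvs t ht) f2
    (by
      rw [Finset.sum_singleton, Finset.sum_singleton, f1, hf]
      exact Multiset.coe_eq_coe.2 hp)
  have hpot := pot_change (B := B) (L := L) hs htop {i} f2
  rw [Finset.sum_singleton, Finset.sum_singleton, f1, hf] at hpot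
  have hle := forestPot_le (B := B) hL hiL hl hd
  refine ⟨hshape, ⟨l1, hI.congr rfl rfl rfl rfl fun k => ?_⟩, fun j => ?_, rfl, htot, by linarith⟩
  · cases k with
    | zero => exact List.Subset.refl _
    | succ k =>
      rw [DynTree.level, DynTree.level]
      rcases eq_or_ne k i with rfl | hk
      · rw [f1, hf]
        exact hp.symm.subset
      · rw [f2 k (by simpa using hk)]
        exact List.Subset.refl _
  · rcases eq_or_ne j i with rfl | hj
    · have := hlen j
      rw [hf] at this
      rw [f1]
      omega
    · rw [f2 j (by simpa using hj)]
      exact hlen j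

theorem fixRoot_setForest (B : ℕ) (d : α) (i : ℕ) (t : Tree α i) (ts us : List (Tree α i))
    (s : DynTree α) : fixRoot B d i t ts (s.setForest i us) = fixRoot B d i t ts s := by
  have h1 : ∀ vs : List (Tree α i), (s.setForest i us).setForest i vs = s.setForest i vs := by
    intro vs
    simp [DynTree.setForest]
  cases i with
  | zero => simp only [fixRoot, h1]
  | succ i =>
    have h2 : (s.setForest (i + 1) us).forest i = s.forest i :=
      setForest_forest_of_ne s (Nat.succ_ne_self i).symm us
    simp only [fixRoot, h1, h2]
    rfl

/-- The cost of the repair of a forest after a deletion, apart from the merge of two roots. -/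
def fixConst (B : ℕ) : ℕ := (B * B + 5 * B + 2) * B + auxConst B + B

/-- The root of a tree after a deletion.  If two roots are merged, then the root has just lost a
child, so that this is paid by the deletion below the root, through `m`. -/
theorem runs_fixRoot {B : ℕ} (hB : 4 ≤ B) (h4 : 4 ∣ B) (d : α) {N : ℕ} {l0 : List (α × ℕ)}
    (hl0 : l0.length ≤ N) {i m : ℕ} {t : Tree α i} {ts : List (Tree α i)} {s : DynTree α}
    {l1 : List (ℕ × ℕ)} (hf : s.forest i = t :: ts) (hs : ∀ j, s.top ≤ j → s.forest j = [])
    (hn : (s.total forestItems).Nodup) (hN : (s.total forestItems).card ≤ N)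
    (hb : ∀ j, j ≠ i → ∀ t ∈ s.forest j, WeightBalanced B j t) (hI : s.Indexed B l0 l1)
    (hlen : ∀ j, (s.forest j).length < B) (hts : ∀ t ∈ ts, WeightBalanced B i t)
    (ht : WellFormed B i t) (ht1 : i ≠ 0 → 1 ≤ t.slots.length) (hsole : SoleChildBalanced B i t)
    (hm : i ≠ 0 → t.slots.length = 1 → 1 ≤ m) (hiL : (i : ℝ) ≤ lg B N + 1) :
    Runs (fixRoot B d i t ts s)
      (s.Settles B (lg B N) (mergeConst B * B ^ i * m + fixConst B * lg B N) l0) := by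
  have hL0 := lg_nonneg hB N
  have hL1 := one_le_mul_lg hB N
  have hi : i < s.top := by
    by_contra h
    simp [hs i (not_lt.1 h)] at hf
  have hE : (0 : ℝ) ≤ mergeConst B * B ^ i * m := by positivity
  have hconst : ∀ k : ℕ, k ≤ B * B + 5 * B + 2 → (k : ℝ) ≤ fixConst B * lg B N := by
    intro k hk
    have h1 : (k : ℝ) ≤ B * B + 5 * B + 2 := by exact_mod_cast hk
    have h2 : (0 : ℝ) ≤ auxConst B := Nat.cast_nonneg _
    have h3 : (0 : ℝ) ≤ (B : ℝ) * B + 5 * B + 2 := by positivity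
    have h4 : ((B : ℝ) * B + 5 * B + 2) * 1 ≤ (B * B + 5 * B + 2) * (B * lg B N) := by gcongr
    have h5 : 0 ≤ (auxConst B : ℝ) * lg B N := by positivity
    rw [fixConst]
    push_cast
    linarith
  -- the outcome in all cases but the downgrade
  have key : ∀ (vs : List (Tree α i)) (k : ℕ), (∀ t ∈ vs, WeightBalanced B i t) →
      vs.length ≤ (t :: ts).length → (vs.flatMap (items i)).Perm ((t :: ts).flatMap (items i)) →
      (vs.map (deficit B i)).sum ≤ ((t :: ts).map (deficit B i)).sum →
      (k : ℝ) ≤ mergeConst B * B ^ i * m + fixConst B * lg B N →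
      s.Settles B (lg B N) (mergeConst B * B ^ i * m + fixConst B * lg B N) l0
        (s.setForest i vs) k := fun vs k a1 a2 a3 a4 a5 =>
    settles_setForest hf hi hs hn hb hI hlen a1 a2 a3 a4 hL0 hiL a5
  have hlent := hlen i
  rw [hf, List.length_cons] at hlent
  cases i with
  | zero =>
    refine Runs.tick_bind ?_
    have hk : ((1 + 0 : ℕ) : ℝ) ≤ mergeConst B * B ^ 0 * m + fixConst B * lg B N := by
      have := hconst (1 + 0) (by omega)
      linarith
    split
    · rename_i h0
      refine Runs.pure (key ts _ hts (Nat.le_succ _) ?_ ?_ hk)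
      · have : items 0 t = [] := List.length_eq_zero_iff.1 h0
        rw [List.flatMap_cons, this, List.nil_append]
      · rw [List.map_cons, List.sum_cons]
        exact Nat.le_add_left _ _
    · rename_i h0
      refine Runs.pure (key (t :: ts) _ ?_ le_rfl (List.Perm.refl _) le_rfl hk)
      exact List.forall_mem_cons.2 ⟨⟨ht, Nat.pos_of_ne_zero h0⟩, hts⟩
  | succ i =>
    unfold fixRoot
    refine Runs.tick_bind ?_
    dsimp only
    split
    · rename_i c hc
      have hc' : t.slots = ([c] : List (Tree α i)) := hc
      have hm1 := hm (Nat.succ_ne_zero i) (by rw [hc']; rfl)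
      have hcS : SlotOk B (i + 1) c :=
        (ht.slotsOk.2 c (by rw [hc']; exact List.mem_singleton.2 rfl)).1
      have hdt : deficit B (i + 1) t = nodeDeficit B c := by
        rw [deficit_succ, hc']
        simp
      have hit : items (i + 1) t = items i c := by
        have : items (i + 1) t = ([c] : List (Tree α i)).flatMap (items i) := by
          rw [← hc']
          rfl
        simpa using this
      have htick : (ts.map fun t' => t'.slots.length + 1).sum ≤ ts.length * (B + 1) := by
        have := List.sum_le_card_nsmul (ts.map fun t' => t'.slots.length + 1) (B + 1) (by
          intro y hy
          obtain ⟨t', ht', rfl⟩ := List.mem_map.1 hy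
          have := (hts t' ht').wellFormed.length_le
          omega)
        simpa using this
      have htick2 : ts.length * (B + 1) ≤ B * (B + 1) := Nat.mul_le_mul_right _ (by omega)
      have htick3 : B * (B + 1) = B * B + B := by ring
      refine Runs.tick_bind ?_
      split
      · rename_i pre c2 t2 post hfind
        obtain ⟨t0, e1, e2, e3, e4, e5, e6⟩ := findLender_eq_some hts hfind
        obtain ⟨g1, g2, g3⟩ := addChild_spec (t := t) hB hcS e3 e2
        refine Runs.store_bind (Runs.store_bind (Runs.pure (key _ _ ?_ ?_ ?_ ?_ ?_)))
        · rw [e1] at hts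
          intro w hw
          simp only [List.mem_cons, List.mem_append] at hw hts
          rcases hw with rfl | hw | rfl | hw
          · exact g1
          · exact hts w (Or.inl hw)
          · exact e4
          · exact hts w (Or.inr (Or.inr hw))
        · rw [e1]
          simp
        · rw [e1]
          have p1 : (pre ++ t2 :: post).Perm (t2 :: (pre ++ post)) := List.perm_middle
          have p2 : (pre ++ t0 :: post).Perm (t0 :: (pre ++ post)) := List.perm_middle
          refine ((p1.cons _).flatMap_right (items (i + 1))).trans
            (List.Perm.trans ?_ ((p2.cons t).flatMap_right (items (i + 1))).symm)
          simp only [List.flatMap_cons, hit]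
          rw [← List.append_assoc, ← List.append_assoc]
          refine List.Perm.append_right _ ?_
          refine (g2.append_right _).trans ?_
          rw [List.append_assoc]
          exact e5.symm.append_left _
        · rw [e1]
          simp only [List.map_cons, List.sum_cons, List.map_append, List.sum_append]
          omega
        · have := hconst (1 + ((ts.map fun t' => t'.slots.length + 1).sum + 1 +
            (2 * B + (2 * B + 0)))) (by omega)
          linarith
      · split
        · rename_i t2 ts2 hfind
          obtain ⟨ht2, hts2⟩ := List.forall_mem_cons.1 hts
          have hnd : (items (i + 1) t ++ items (i + 1) t2).Nodup := by
            have := Multiset.coe_nodup.1 (Multiset.nodup_of_le (forestItems_le_total hs (i + 1)) hn)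
            rw [hf, List.flatMap_cons, List.flatMap_cons, ← List.append_assoc] at this
            exact this.of_append_left
          refine Runs.bind (runs_mergeRoots (h := i + 1) hB h4 d (Nat.succ_ne_zero i) ht
            (ht1 (Nat.succ_ne_zero i)) ht2 hnd) fun r k hr => ?_
          obtain ⟨r1, r2, r3, r4, r5⟩ := hr
          refine Runs.pure (key _ _ ?_ ?_ ?_ ?_ ?_)
          · intro w hw
            rcases List.mem_append.1 hw with hw | hw
            · exact r1 w hw
            · exact hts2 w hw
          · simp only [List.length_append, List.length_cons]
            omega
          · rw [List.flatMap_append, List.flatMap_cons, List.flatMap_cons, ← List.append_assoc]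
            exact r3.append_right _
          · simp only [List.map_cons, List.sum_cons, List.map_append, List.sum_append]
            omega
          · have h1 := hconst (1 + ((List.map (fun t' => t'.slots.length + 1) (t2 :: ts2)).sum + 1))
              (by omega)
            have h2 : (k : ℝ) ≤ mergeConst B * B ^ (i + 1) * m := by
              have h3 : k ≤ mergeConst B * B ^ (i + 1) * m := by
                refine r5.trans (le_trans (le_of_eq ?_) (Nat.le_mul_of_pos_right _ hm1))
                rw [mergeConst]
                ring
              exact_mod_cast h3
            push_cast at h1 ⊢
            linarith
        · -- the only tree of the forest becomes a tree of the forest below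
          have hcB : WeightBalanced B i c := hsole c hc
          obtain ⟨-, haux⟩ := hI.rep1.assignRange (s.bound (i + 2)) (s.bound (i + 1)) (i + 1)
          refine Runs.liftTimed_bind ?_
          generalize hs'' : ({ ((s.setForest (i + 1) []).setForest i (c :: s.forest i)) with
            T1 := (s.T1.assignRange (s.bound (i + 2)) (s.bound (i + 1)) (i + 1)).ret
            bound := Function.update s.bound (i + 1) (s.bound (i + 2)) } : DynTree α) = s''
          have hne : i ≠ i + 1 := (Nat.succ_ne_self i).symm
          have f0 : s''.forest i = c :: s.forest i := by
            rw [← hs'']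
            exact setForest_forest_self _ _ _
          have f1 : s''.forest (i + 1) = [] := by
            rw [← hs'']
            exact (setForest_forest_of_ne _ hne.symm _).trans (setForest_forest_self _ _ _)
          have f2 : ∀ j ∉ ({i, i + 1} : Finset ℕ), s''.forest j = s.forest j := by
            intro j hj
            simp only [Finset.mem_insert, Finset.mem_singleton, not_or] at hj
            rw [← hs'']
            exact (setForest_forest_of_ne _ hj.1 _).trans (setForest_forest_of_ne _ hj.2 _)
          have ft : s''.top = s.top := by rw [← hs'']; rfl
          have htop : ∀ j, s''.top ≤ j → s''.forest j = [] := by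
            intro j hj
            rw [ft] at hj
            rw [f2 j (by simp only [Finset.mem_insert, Finset.mem_singleton]; omega)]
            exact hs j hj
          obtain ⟨hshape, htot⟩ := shape_of_change (B := B) hs htop hn {i, i + 1}
            (fun j hj => hb j (by
              simp only [Finset.mem_insert, Finset.mem_singleton, not_or] at hj
              exact hj.2))
            (by
              intro j hj t' ht'
              simp only [Finset.mem_insert, Finset.mem_singleton] at hj
              rcases hj with rfl | rfl
              · rw [f0] at ht'
                rcases List.mem_cons.1 ht' with rfl | ht'
                · exact hcB
                · exact hb _ hne _ ht'
              · rw [f1] at ht'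
                exact absurd ht' List.not_mem_nil) f2
            (by
              rw [Finset.sum_pair hne, Finset.sum_pair hne, f0, f1, hf, forestItems_nil, add_zero,
                forestItems, forestItems, forestItems, List.flatMap_cons, ← Multiset.coe_add,
                List.flatMap_singleton, hit]
              exact add_comm _ _)
          have hpot := pot_change (B := B) (L := lg B N) hs htop {i, i + 1} f2
          rw [Finset.sum_pair hne, Finset.sum_pair hne, f0, f1, hf, forestPot_nil, add_zero] at hpot
          obtain ⟨l1', hI'⟩ := hI.moveDown (s' := s'') (i + 1) (by rw [← hs'']; rfl)
            (by rw [← hs'']) (by rw [← hs'']; rfl) (by rw [← hs''])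
            (by
              intro k hk
              cases k with
              | zero =>
                have : s''.buffer = s.buffer := by rw [← hs'']; rfl
                rw [DynTree.level, DynTree.level, this]
                exact List.Subset.refl _
              | succ k =>
                rw [DynTree.level, DynTree.level]
                rcases eq_or_ne k i with rfl | hk'
                · rw [f0, List.flatMap_cons]
                  exact List.subset_append_right _ _
                · rw [f2 k (by simp only [Finset.mem_insert, Finset.mem_singleton]; omega)]
                  exact List.Subset.refl _)
            (by
              rw [DynTree.level, DynTree.level, f0, hf, List.flatMap_singleton, hit,
                List.flatMap_cons]
              exact List.subset_append_left _ _)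
          refine (runs_cascade hB h4 d hl0 (s.top + 1) i hshape hI' ?_ ?_ ?_).mono fun s' k h => ?_
          · rw [f0, List.length_cons]
            exact hlen i
          · intro j hj
            rcases eq_or_ne j (i + 1) with rfl | hj'
            · rw [f1, List.length_nil]
              omega
            · rw [f2 j (by simp only [Finset.mem_insert, Finset.mem_singleton]; omega)]
              exact hlen j
          · right
            omega
          · refine ⟨h.shape, h.indexed, h.length_lt, ?_, h.total_eq.trans htot, ?_⟩
            · rw [h.buffer_eq, ← hs'']
              rfl
            · have hp := h.pot_le
              have hauxR := auxTime_le hB hI.rep1 (hI.length_eq.trans_le hl0) haux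
              have hcN : c.wt ≤ N := by
                have h1 := Multiset.card_le_card (forestItems_le_total hs (i + 1))
                rw [hf, forestItems, List.flatMap_singleton, hit, Multiset.coe_card] at h1
                have h2 : c.wt = (items i c).length := hcB.wellFormed.wt_eq
                omega
              have hiL2 : (i : ℝ) ≤ lg B N := le_lg hB (by
                have : B ^ (i + 1) ≤ 4 * c.wt := hcS.2.2.1
                omega)
              have hdef : (deficit B i c : ℝ) ≤ deficit B (i + 1) t := by
                rw [hdt, nodeDeficit]
                exact_mod_cast Nat.le_add_left _ _
              have hB4 : (4 : ℝ) ≤ B := by exact_mod_cast hB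
              have e1 : forestPot B (lg B N) i (c :: s.forest i) =
                  forestPot B (lg B N) i (s.forest i) + deficitConst B * deficit B i c +
                    treeConst B * ((B : ℝ) ^ (i + 1) * (lg B N + 2 - i) + lg B N) := by
                simp only [forestPot, List.map_cons, List.sum_cons, List.length_cons]
                push_cast
                ring
              have e2 : forestPot B (lg B N) (i + 1) [t] = deficitConst B * deficit B (i + 1) t +
                  treeConst B * ((B : ℝ) ^ (i + 1) * (B * (lg B N + 1 - i)) + lg B N) := by
                simp only [forestPot, List.map_cons, List.sum_cons, List.length_cons, List.map_nil,
                  List.sum_nil, List.length_nil]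
                push_cast
                ring
              have e3 : (deficitConst B : ℝ) * deficit B i c ≤
                  deficitConst B * deficit B (i + 1) t := by gcongr
              -- the tree becomes lighter and gets one more level to climb
              have e4 : (treeConst B : ℝ) * ((B : ℝ) ^ (i + 1) * (lg B N + 2 - i) + lg B N) ≤
                  treeConst B * ((B : ℝ) ^ (i + 1) * (B * (lg B N + 1 - i)) + lg B N) := by
                gcongr
                nlinarith
              rw [e1, e2] at hpot
              have e5 : ((1 + (([] : List (Tree α (i + 1))).map
                  (fun t' => t'.slots.length + 1)).sum + 1 : ℕ) : ℝ) ≤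
                  (B * B + 5 * B + 2) * (B * lg B N) := by
                simp only [List.map_nil, List.sum_nil]
                push_cast
                nlinarith
              have e6 : (fixConst B : ℝ) * lg B N = (B * B + 5 * B + 2) * (B * lg B N) +
                  auxConst B * lg B N + B * lg B N := by
                rw [fixConst]
                push_cast
                ring
              push_cast at e5 ⊢
              linarith
    · rename_i hnc
      obtain ⟨c1, c2, l, hl⟩ : ∃ c1 c2 l, t.slots = (c1 :: c2 :: l : List (Tree α i)) := by
        have h1 := ht1 (Nat.succ_ne_zero i)
        rcases h2 : t.slots with _ | ⟨c1, _ | ⟨c2, l⟩⟩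
        · simp [h2] at h1
        · exact absurd h2 (hnc c1)
        · exact ⟨c1, c2, l, rfl⟩
      rw [hl]
      refine Runs.pure (key (t :: ts) _ ?_ le_rfl (List.Perm.refl _) le_rfl ?_)
      · refine List.forall_mem_cons.2 ⟨⟨ht, ?_⟩, hts⟩
        rw [hl]
        exact Nat.le_add_left 2 l.length
      · have := hconst (1 + 0) (by omega)
        linarith

end FixRoot


/-! ### Insertions and deletions -/

section Operations

variable {α : Type}

theorem pot_congr {s s' : DynTree α} {B : ℕ} {L : ℝ} (e1 : s'.forest = s.forest)
    (e2 : s'.top = s.top) : s'.pot B L = s.pot B L := by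
  rw [DynTree.pot, DynTree.pot, DynTree.total, DynTree.total, e1, e2]

theorem pot_sub_eq (s : DynTree α) (B : ℕ) (L L' : ℝ) : s.pot B L' - s.pot B L =
    treeConst B * (∑ i ∈ Finset.range s.top, (s.forest i).length * ((B : ℝ) ^ (i + 1) + 1)) *
      (L' - L) := by
  simp only [DynTree.pot, DynTree.total, Finset.mul_sum, Finset.sum_mul, ← Finset.sum_sub_distrib]
  refine Finset.sum_congr rfl fun i _ => ?_
  unfold forestPot
  ring

theorem pot_mono (s : DynTree α) (B : ℕ) {L L' : ℝ} (h : L ≤ L') : s.pot B L ≤ s.pot B L' := by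
  rw [← sub_nonneg, pot_sub_eq]
  exact mul_nonneg (by positivity) (sub_nonneg.2 h)

variable [LinearOrder α]

/-- The data structure holds the dataset `D`, and its auxiliary trees are correct. -/
structure DynTree.Stores (B : ℕ) (s : DynTree α) (D : Finset α) (l0 : List (α × ℕ))
    (l1 : List (ℕ × ℕ)) : Prop where
  shape : s.Shape B
  indexed : s.Indexed B l0 l1
  length_lt : ∀ i, (s.forest i).length < B
  buffer_length : s.buffer.length < B
  buffer_sorted : s.buffer.Pairwise (· < ·)
  contents_eq : (s.buffer : Multiset α) + s.total forestItems = D.val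
  keys_eq : (↑(l0.map Prod.fst) : Multiset α) = D.val

namespace DynTree.Stores

variable {B : ℕ} {s : DynTree α} {D : Finset α} {l0 : List (α × ℕ)} {l1 : List (ℕ × ℕ)}

theorem length_eq (h : s.Stores B D l0 l1) : l0.length = D.card := by
  have := congrArg Multiset.card h.keys_eq
  simpa using this

theorem mem_iff (h : s.Stores B D l0 l1) {x : α} : x ∈ D ↔ ∃ n, (x, n) ∈ l0 := by
  rw [← Finset.mem_val, ← h.keys_eq, Multiset.mem_coe]
  simp

theorem card_total_le (h : s.Stores B D l0 l1) : (s.total forestItems).card ≤ D.card := by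
  have := congrArg Multiset.card h.contents_eq
  rw [Multiset.card_add] at this
  exact (Nat.le_add_left _ _).trans this.le

theorem holds (h : s.Stores B D l0 l1) : s.Holds B D := by
  have hc : (s.contents : Multiset α) = D.val := (coe_contents s).trans h.contents_eq
  refine ⟨?_, ?_, h.buffer_length, h.buffer_sorted, h.shape.top_empty, fun i =>
    ⟨Nat.le_sub_one_of_lt (h.length_lt i), h.shape.balanced i⟩⟩
  · rw [← Multiset.coe_nodup, hc]
    exact D.nodup
  · ext x
    rw [List.mem_toFinset, ← Multiset.mem_coe, hc, Finset.mem_val]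

/-- Trees are not higher than the logarithm of the number of pairs. -/
theorem height_le (h : s.Stores B D l0 l1) (hB : 4 ≤ B) {i : ℕ} {t : Tree α i}
    (ht : t ∈ s.forest i) : (i : ℝ) ≤ lg B D.card + 1 := by
  have h1 := (h.shape.balanced i t ht).pow_le
  have h2 : t.wt = (items i t).length := (h.shape.balanced i t ht).wellFormed.wt_eq
  have h3 := Multiset.card_le_card (forestItems_le_total h.shape.top_empty i)
  have h4 : (items i t).length ≤ ((s.forest i).flatMap (items i)).length :=
    List.flatMap_def ▸ (List.sublist_flatten_of_mem (List.mem_map_of_mem ht)).length_le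
  rw [forestItems, Multiset.coe_card] at h3
  have h5 := h.card_total_le
  exact le_lg_add_one hB (by omega)

theorem pot_nonneg (h : s.Stores B D l0 l1) (hB : 4 ≤ B) : 0 ≤ s.pot B (lg B D.card) := by
  rw [DynTree.pot, DynTree.total]
  refine Finset.sum_nonneg fun i _ => ?_
  rcases List.eq_nil_or_concat (s.forest i) with h0 | ⟨ts, t, h0⟩
  · rw [h0, forestPot_nil]
  · rw [← forestPot_nil (α := α) B (lg B D.card) i]
    refine forestPot_le (lg_nonneg hB _) (h.height_le hB (t := t) ?_) (Nat.zero_le _)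
      (Nat.zero_le _)
    rw [h0]
    simp

/-- The potential grows by a constant only if the number of pairs grows by one. -/
theorem pot_succ_le (h : s.Stores B D l0 l1) (hB : 4 ≤ B) :
    s.pot B (lg B (D.card + 1)) ≤ s.pot B (lg B D.card) + treeConst B * (2 * B + 2) := by
  have hL : 0 ≤ lg B (D.card + 1) - lg B D.card := sub_nonneg.2 (lg_mono hB (Nat.le_succ _))
  have h1 : ∑ i ∈ Finset.range s.top, (s.forest i).length * (B ^ (i + 1) + 1) ≤
      (2 * B + 2) * (s.total forestItems).card := by
    rw [DynTree.total, Multiset.card_sum, Finset.mul_sum]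
    refine Finset.sum_le_sum fun i _ => ?_
    have h2 := (forest_weights (h.shape.balanced i)).2.1
    have h3 : (s.forest i).length ≤ (s.forest i).length * B ^ i :=
      Nat.le_mul_of_pos_right _ (Nat.pow_pos (by omega))
    rw [forestItems, Multiset.coe_card]
    calc (s.forest i).length * (B ^ (i + 1) + 1)
        = B * ((s.forest i).length * B ^ i) + (s.forest i).length := by ring
      _ ≤ B * (2 * ((s.forest i).flatMap (items i)).length) +
          2 * ((s.forest i).flatMap (items i)).length :=
        add_le_add (Nat.mul_le_mul_left _ h2) (h3.trans h2)
      _ = (2 * B + 2) * ((s.forest i).flatMap (items i)).length := by ring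
  have h2 : (∑ i ∈ Finset.range s.top, (s.forest i).length * ((B : ℝ) ^ (i + 1) + 1)) ≤
      (2 * B + 2) * D.card := by
    have := h1.trans (Nat.mul_le_mul_left _ h.card_total_le)
    exact_mod_cast this
  have h3 := pot_sub_eq s B (lg B D.card) (lg B (D.card + 1))
  have h4 := mul_lg_succ_sub_le hB D.card
  have h5 : treeConst B * (∑ i ∈ Finset.range s.top,
      (s.forest i).length * ((B : ℝ) ^ (i + 1) + 1)) * (lg B (D.card + 1) - lg B D.card) ≤
      treeConst B * ((2 * B + 2) * D.card) * (lg B (D.card + 1) - lg B D.card) := by gcongr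
  have h6 : (treeConst B : ℝ) * ((2 * B + 2) * D.card) * (lg B (D.card + 1) - lg B D.card) =
      treeConst B * (2 * B + 2) * (D.card * (lg B (D.card + 1) - lg B D.card)) := by ring
  have h7 : (treeConst B : ℝ) * (2 * B + 2) * (D.card * (lg B (D.card + 1) - lg B D.card)) ≤
      treeConst B * (2 * B + 2) * 1 := by gcongr
  linarith

end DynTree.Stores

/-- The amortized cost of a deletion, up to the logarithm. -/
def deleteOpConst (B : ℕ) : ℕ :=
  4 * auxConst B + B * B + B * (B + 1) * (2 * B + 1) + (2 * B + 1) * deleteConst B (mergeConst B) +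
    fixConst B

theorem filter_ne_eq_erase {x : α} {l : List α} (h : l.Nodup) :
    ((l.filter fun y => y ≠ x : List α) : Multiset α) = (l : Multiset α).erase x := by
  rw [Multiset.coe_erase, h.erase_eq_filter]
  congr 2
  funext y
  simp [bne, beq_eq_decide]

/-- The pair is removed from the auxiliary trees and from its level; the potential that counts is
that of the forests after the removal from a tree and before the repair of the root. -/
theorem runs_delete {B : ℕ} (hB : 4 ≤ B) (h4 : 4 ∣ B) (x : α) {s : DynTree α} {D : Finset α}
    {l0 : List (α × ℕ)} {l1 : List (ℕ × ℕ)} (h : s.Stores B D l0 l1) :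
    Runs (s.delete B x) fun s' k => (∃ l0' l1', s'.Stores B (D.erase x) l0' l1') ∧
      k + s'.pot B (lg B (D.erase x).card) ≤
        s.pot B (lg B D.card) + deleteOpConst B * lg B D.card := by
  have hL0 := lg_nonneg hB D.card
  have hL1 := one_le_mul_lg hB D.card
  have hlow : lg B (D.erase x).card ≤ lg B D.card :=
    lg_mono hB (Finset.card_le_card (Finset.erase_subset x D))
  have hlen0 := h.length_eq
  have hlen1 := h.indexed.length_eq.trans hlen0
  have t1 := auxTime_le hB h.indexed.rep0 hlen0.le (h.indexed.rep0.time_lookup_le x)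
  have cA : (0 : ℝ) ≤ auxConst B := Nat.cast_nonneg _
  have cD : (deleteOpConst B : ℝ) * lg B D.card = 4 * (auxConst B * lg B D.card) +
      B * (B * lg B D.card) + B * (B + 1) * (2 * (B * lg B D.card) + lg B D.card) +
      (2 * (B * lg B D.card) + lg B D.card) * deleteConst B (mergeConst B) +
      fixConst B * lg B D.card := by
    rw [deleteOpConst]
    push_cast
    ring
  have p1 : 0 ≤ (auxConst B : ℝ) * lg B D.card := by positivity
  have p2 : 0 ≤ (B : ℝ) * (B + 1) * (2 * (B * lg B D.card) + lg B D.card) := by positivity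
  have p3 : 0 ≤ (2 * (B * lg B D.card) + lg B D.card) * (deleteConst B (mergeConst B) : ℝ) := by
    positivity
  have p4 : 0 ≤ (fixConst B : ℝ) * lg B D.card := by positivity
  have p5 : (B : ℝ) ≤ B * (B * lg B D.card) := le_mul_of_one_le_right (Nat.cast_nonneg _) hL1
  have p6 : (0 : ℝ) ≤ B := Nat.cast_nonneg _
  refine Runs.liftTimed_bind ?_
  split
  · rename_i hfound
    have hxD : x ∉ D := by
      intro hx
      obtain ⟨n, hn⟩ := h.mem_iff.1 hx
      rw [h.indexed.rep0.lookup_eq_some_iff.2 hn] at hfound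
      simp at hfound
    rw [Finset.erase_eq_of_notMem hxD]
    refine Runs.pure ⟨⟨l0, l1, h⟩, ?_⟩
    push_cast
    linarith
  · rename_i n hfound
    have hxn := h.indexed.rep0.lookup_eq_some_iff.1 hfound
    have hxD : x ∈ D := h.mem_iff.2 ⟨n, hxn⟩
    obtain ⟨k, hnk⟩ := h.indexed.mem_map_snd hxn
    have hlook : (s.T1.lookup n).ret = some k := h.indexed.rep1.lookup_eq_some_iff.2 hnk
    have hxk := h.indexed.level x n k hxn hnk
    have t2 := auxTime_le hB h.indexed.rep1 hlen1.le (h.indexed.rep1.time_lookup_le n)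
    have t3 := auxTime_le hB h.indexed.rep0 hlen0.le (h.indexed.rep0.delete hB x).2
    have t4 := auxTime_le hB h.indexed.rep1 hlen1.le (h.indexed.rep1.delete hB n).2
    refine Runs.liftTimed_bind (Runs.liftTimed_bind (Runs.liftTimed_bind ?_))
    rw [hlook]
    have hkeys : (↑((l0.filter fun p => p.1 ≠ x).map Prod.fst) : Multiset α) =
        (D.erase x).val := by
      rw [Finset.erase_val, ← h.keys_eq, ← filter_ne_eq_erase
        (Multiset.coe_nodup.1 (h.keys_eq ▸ D.nodup)), List.filter_map]
      rfl
    cases k with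
    | zero =>
      refine Runs.tick_bind (Runs.pure ⟨⟨l0.filter fun p => p.1 ≠ x, l1.filter fun p => p.1 ≠ n,
        ⟨⟨h.shape.top_empty, h.shape.balanced, h.shape.nodup⟩, ?_, h.length_lt, ?_, ?_, ?_,
          hkeys⟩⟩, ?_⟩)
      · refine h.indexed.delete hB hxn rfl rfl rfl rfl fun k y hy hyx => ?_
        cases k with
        | zero => exact List.mem_filter.2 ⟨hy, by simpa using hyx⟩
        | succ k => exact hy
      · exact (List.length_filter_le _ _).trans_lt h.buffer_length
      · exact h.buffer_sorted.filter _
      · have hx : x ∈ (s.buffer : Multiset α) := hxk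
        rw [Finset.erase_val, ← h.contents_eq, Multiset.erase_add_left_pos _ hx,
          ← filter_ne_eq_erase (h.buffer_sorted.imp fun h => h.ne)]
        rfl
      · have hb : ((s.buffer.length + 1 : ℕ) : ℝ) ≤ B := by exact_mod_cast h.buffer_length
        have hp := pot_mono s B hlow
        refine le_trans (add_le_add le_rfl (le_of_eq (pot_congr (s := s) rfl rfl))) ?_
        push_cast at hb ⊢
        linarith
    | succ i =>
      have hxi : x ∈ (s.forest i).flatMap (items i) := hxk
      obtain ⟨t₀, ht₀, hxt₀⟩ := List.mem_flatMap.1 hxi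
      refine Runs.bind (runs_locate x fun t ht => (h.shape.balanced i t ht).wellFormed)
        fun r k1 hr => ?_
      obtain ⟨hk1, hr1, hr2⟩ := hr
      obtain ⟨⟨t, ts⟩, rfl⟩ := hr1 ⟨t₀, ht₀, hxt₀⟩
      obtain ⟨hxt, hperm⟩ := hr2 _ rfl
      dsimp only at hxt hperm ⊢
      have htm : t ∈ s.forest i := hperm.mem_iff.2 List.mem_cons_self
      have htB := h.shape.balanced i t htm
      have hts : ∀ t' ∈ ts, WeightBalanced B i t' := fun t' ht' =>
        h.shape.balanced i t' (hperm.mem_iff.2 (List.mem_cons_of_mem _ ht'))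
      obtain ⟨htw, -, ht2⟩ := weightBalanced_iff.1 htB
      have hiL := h.height_le hB htm
      refine Runs.bind (runs_deleteBelow hB h4 (mergeConst B) x htw hxt
        fun h0 h1 => absurd (ht2 h0) (by omega)) fun t' k2 ht' => ?_
      obtain ⟨d1, d2, -, -, d3, d4, d5, d6⟩ := ht'
      generalize hs1 : ({ s with
        T0 := (s.T0.delete B x).ret
        T1 := (s.T1.delete B n).ret } : DynTree α) = s1
      rw [← fixRoot_setForest B x i t' ts (t' :: ts) s1]
      have g1 : (s1.setForest i (t' :: ts)).forest i = t' :: ts := setForest_forest_self _ _ _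
      have g2 : ∀ j ∉ ({i} : Finset ℕ), (s1.setForest i (t' :: ts)).forest j = s.forest j := by
        intro j hj
        rw [← hs1]
        exact setForest_forest_of_ne _ (by simpa using hj) _
      have g3 : (s1.setForest i (t' :: ts)).buffer = s.buffer := by rw [← hs1]; rfl
      have g4 : (s1.setForest i (t' :: ts)).top = s.top := by rw [← hs1]; rfl
      have g5 := h.indexed.delete hB hxn (s' := s1.setForest i (t' :: ts)) (by rw [← hs1]; rfl)
        (by rw [← hs1]; rfl) (by rw [← hs1]; rfl) (by rw [← hs1]; rfl) (by
          intro k y hy hyx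
          cases k with
          | zero =>
            rw [DynTree.level, g3]
            exact hy
          | succ k =>
            rw [DynTree.level] at hy ⊢
            rcases eq_or_ne k i with rfl | hk
            · rw [g1, List.flatMap_cons, d2]
              have := (hperm.flatMap_right (items k)).mem_iff.1 hy
              rw [List.flatMap_cons] at this
              rcases List.mem_append.1 this with hm | hm
              · exact List.mem_append_left _ (List.mem_filter.2 ⟨hm, by simpa using hyx⟩)
              · exact List.mem_append_right _ hm
            · rw [g2 k (by simpa using hk)]
              exact hy)
      generalize s1.setForest i (t' :: ts) = s2 at g1 g2 g3 g4 g5 ⊢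
      have htop : ∀ j, s2.top ≤ j → s2.forest j = [] := by
        intro j hj
        rw [g4] at hj
        have := h.shape.lt_top htm
        rw [g2 j (by simp only [Finset.mem_singleton]; omega)]
        exact h.shape.top_empty j hj
      have htot : s.total forestItems = x ::ₘ s2.total forestItems := by
        have e1 := total_change forestItems_nil h.shape.top_empty htop {i} g2
        rw [Finset.sum_singleton, Finset.sum_singleton, g1] at e1
        have e2 : forestItems i (s.forest i) = x ::ₘ forestItems i (t' :: ts) := by
          have e3 : (items i t : Multiset α) = x ::ₘ (items i t' : Multiset α) := by
            rw [d2, filter_ne_eq_erase (htw.pairwise_items.imp fun h => h.ne)]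
            exact (Multiset.cons_erase (Multiset.mem_coe.2 hxt)).symm
          rw [forestItems, Multiset.coe_eq_coe.2 (hperm.flatMap_right (items i)), forestItems,
            List.flatMap_cons, List.flatMap_cons, ← Multiset.coe_add, ← Multiset.coe_add, e3,
            Multiset.cons_add]
        rw [e2, Multiset.add_cons, ← Multiset.cons_add] at e1
        exact (add_right_cancel e1).symm
      have hnd : (s2.total forestItems).Nodup := (Multiset.nodup_cons.1 (htot ▸ h.shape.nodup)).2
      have hcard : (s2.total forestItems).card ≤ D.card := by
        have := h.card_total_le
        rw [htot, Multiset.card_cons] at this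
        omega
      have hbal : ∀ j, j ≠ i → ∀ t ∈ s2.forest j, WeightBalanced B j t := by
        intro j hj
        rw [g2 j (by simpa using hj)]
        exact h.shape.balanced j
      have hlen : ∀ j, (s2.forest j).length < B := by
        intro j
        have := h.length_lt j
        rcases eq_or_ne j i with rfl | hj
        · rw [g1]
          rw [hperm.length_eq] at this
          exact this
        · rw [g2 j (by simpa using hj)]
          exact this
      refine (runs_fixRoot hB h4 x ((List.length_filter_le _ _).trans hlen0.le) g1 htop hnd hcard
        hbal g5 hlen hts d1 (fun h0 => by have := ht2 h0; omega) (by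
          cases i with
          | zero => trivial
          | succ i => exact d5 (ht2 (Nat.succ_ne_zero i)))
        (m := t.slots.length - t'.slots.length) (fun h0 h1 => by have := ht2 h0; omega)
        hiL).mono fun s' k3 hs' => ?_
      obtain ⟨l1', hI'⟩ := hs'.indexed
      refine ⟨⟨_, l1', hs'.shape, hI', hs'.length_lt, ?_, ?_, ?_, hkeys⟩, ?_⟩
      · rw [hs'.buffer_eq, g3]
        exact h.buffer_length
      · rw [hs'.buffer_eq, g3]
        exact h.buffer_sorted
      · rw [hs'.buffer_eq, g3, hs'.total_eq, Finset.erase_val, ← h.contents_eq, htot,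
          Multiset.add_cons, Multiset.erase_cons_head]
      · have hp := hs'.pot_le
        have hmono := pot_mono s' B hlow
        have hpot := pot_change (B := B) (L := lg B D.card) h.shape.top_empty htop {i} g2
        rw [Finset.sum_singleton, Finset.sum_singleton, g1] at hpot
        have e1 : forestPot B (lg B D.card) i (s.forest i) =
            forestPot B (lg B D.card) i (t :: ts) := by
          rw [forestPot, forestPot, hperm.length_eq, (hperm.map (deficit B i)).sum_eq]
        have e2 : forestPot B (lg B D.card) i (t' :: ts) + deficitConst B * deficit B i t =
            forestPot B (lg B D.card) i (t :: ts) + deficitConst B * deficit B i t' := by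
          simp only [forestPot, List.map_cons, List.sum_cons, List.length_cons]
          push_cast
          ring
        have e3 : (k2 : ℝ) + deficitConst B * deficit B i t' +
            mergeConst B * B ^ i * ((t.slots.length - t'.slots.length : ℕ) : ℝ) ≤
            deficitConst B * deficit B i t + (i + 1) * deleteConst B (mergeConst B) := by
          exact_mod_cast d6
        have e4 : (i : ℝ) + 1 ≤ 2 * (B * lg B D.card) + lg B D.card := by linarith
        have e5 : ((i : ℝ) + 1) * deleteConst B (mergeConst B) ≤
            (2 * (B * lg B D.card) + lg B D.card) * deleteConst B (mergeConst B) := by gcongr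
        have e6 : (k1 : ℝ) ≤ B * (B + 1) * (2 * (B * lg B D.card) + lg B D.card) := by
          have e7 : (k1 : ℝ) ≤ (s.forest i).length * ((i + 1) * (B + 1)) := by exact_mod_cast hk1
          have e8 : ((s.forest i).length : ℝ) ≤ B := by exact_mod_cast (h.length_lt i).le
          refine e7.trans ?_
          calc ((s.forest i).length : ℝ) * ((i + 1) * (B + 1))
              ≤ B * ((2 * (B * lg B D.card) + lg B D.card) * (B + 1)) := by gcongr
            _ = B * (B + 1) * (2 * (B * lg B D.card) + lg B D.card) := by ring
        push_cast
        linarith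

end Operations


section Insertion

variable {α : Type} [LinearOrder α]

/-- The amortized cost of an insertion, up to the logarithm. -/
def insertOpConst (B : ℕ) : ℕ :=
  7 * auxConst B + 9 * B * B + 2 * B + treeConst B * (4 * B * B + 4 * B + 2)

/-- Only a flush of the sorted list adds a tree; this raises the potential by `O(L)`, since the new
tree has height `0`. -/
theorem runs_insert {B : ℕ} (hB : 4 ≤ B) (h4 : 4 ∣ B) (x : α) {s : DynTree α} {D : Finset α}
    {l0 : List (α × ℕ)} {l1 : List (ℕ × ℕ)} (h : s.Stores B D l0 l1) :
    Runs (s.insert B x) fun s' k => (∃ l0' l1', s'.Stores B (Insert.insert x D) l0' l1') ∧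
      k + s'.pot B (lg B (Insert.insert x D).card) ≤
        s.pot B (lg B D.card) + insertOpConst B * lg B D.card := by
  have hL0 := lg_nonneg hB D.card
  have hL1 := one_le_mul_lg hB D.card
  have hlen0 := h.length_eq
  have hlen1 := h.indexed.length_eq.trans hlen0
  have t1 := auxTime_le hB h.indexed.rep0 hlen0.le (h.indexed.rep0.time_lookup_le x)
  have cA : (0 : ℝ) ≤ auxConst B := Nat.cast_nonneg _
  have cT : (0 : ℝ) ≤ treeConst B := Nat.cast_nonneg _
  have cB : (0 : ℝ) ≤ B := Nat.cast_nonneg _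
  have p1 : 0 ≤ (auxConst B : ℝ) * lg B D.card := by positivity
  have p2 : (B : ℝ) ≤ B * (B * lg B D.card) := le_mul_of_one_le_right cB hL1
  have p3 : (treeConst B : ℝ) * (2 * B + 2) ≤ treeConst B * (2 * B + 2) * (B * lg B D.card) :=
    le_mul_of_one_le_right (by positivity) hL1
  have p4 : 0 ≤ (treeConst B : ℝ) * (2 * B * B + 2 * B + 2) * lg B D.card := by positivity
  have p5 : 0 ≤ B * lg B D.card := by positivity
  have cI : (insertOpConst B : ℝ) * lg B D.card = 7 * (auxConst B * lg B D.card) +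
      9 * (B * (B * lg B D.card)) + 2 * (B * lg B D.card) +
      treeConst B * (2 * B + 2) * (B * lg B D.card) +
      treeConst B * (2 * B * B + 2 * B + 2) * lg B D.card := by
    rw [insertOpConst]
    push_cast
    ring
  refine Runs.liftTimed_bind ?_
  split
  · rename_i n hfound
    have hxD : x ∈ D := h.mem_iff.2 ⟨n, h.indexed.rep0.lookup_eq_some_iff.1 hfound⟩
    rw [Finset.insert_eq_of_mem hxD]
    refine Runs.pure ⟨⟨l0, l1, h⟩, ?_⟩
    have p6 : 0 ≤ (treeConst B : ℝ) * (2 * B + 2) := by positivity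
    push_cast
    linarith
  · rename_i hfound
    have hxD : x ∉ D := by
      intro hx
      obtain ⟨n, hn⟩ := h.mem_iff.1 hx
      rw [h.indexed.rep0.lookup_eq_some_iff.2 hn] at hfound
      exact Option.some_ne_none _ hfound
    have hxl : ∀ p ∈ l0, p.1 ≠ x := fun p hp hpx => hxD (h.mem_iff.2 ⟨p.2, hpx ▸ hp⟩)
    have hxb : x ∉ s.buffer := by
      intro hx
      refine hxD ?_
      rw [← Finset.mem_val, ← h.contents_eq]
      exact Multiset.mem_add.2 (Or.inl hx)
    have hcard := Finset.card_insert_of_notMem hxD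
    rw [hcard]
    have hL0' := lg_nonneg hB (D.card + 1)
    have hL2 := lg_succ_le hB D.card
    have hn : ∀ p ∈ l1, p.1 ≠ s.nextItem := fun p hp => (h.indexed.lt_nextItem hp).ne
    have t2 := auxTime_le hB h.indexed.rep0 (hlen0.le.trans (Nat.le_succ _))
      (h.indexed.rep0.insert hB s.nextItem hxl).2
    have t3 := auxTime_le hB h.indexed.rep1 (hlen1.le.trans (Nat.le_succ _))
      (h.indexed.rep1.insert hB 0 hn).2
    have hgrow := h.pot_succ_le hB
    have p6 : (auxConst B : ℝ) * lg B (D.card + 1) ≤ auxConst B * (2 * lg B D.card) := by gcongr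
    refine Runs.liftTimed_bind (Runs.liftTimed_bind (Runs.tick_bind ?_))
    have hb : ((s.buffer.length + 1 : ℕ) : ℝ) ≤ B := by exact_mod_cast h.buffer_length
    have bperm : (s.buffer.orderedInsert (· ≤ ·) x).Perm (x :: s.buffer) :=
      List.perm_orderedInsert _ _ _
    have blen := bperm.length_eq
    have bsorted : (s.buffer.orderedInsert (· ≤ ·) x).Pairwise (· < ·) := by
      refine pairwise_lt_of_le ?_ (bperm.nodup_iff.2
        (List.nodup_cons.2 ⟨hxb, h.buffer_sorted.imp fun h => h.ne⟩))
      exact List.Pairwise.orderedInsert x _ (h.buffer_sorted.imp fun h => h.le)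
    have hkeys : (↑((insertPair x s.nextItem l0).map Prod.fst) : Multiset α) =
        (Insert.insert x D).val := by
      rw [Finset.insert_val_of_notMem hxD, ← h.keys_eq, Multiset.cons_coe]
      exact Multiset.coe_eq_coe.2 ((insertPair_perm hxl).map Prod.fst)
    have hcont : (↑(s.buffer.orderedInsert (· ≤ ·) x) : Multiset α) + s.total forestItems =
        (Insert.insert x D).val := by
      rw [Finset.insert_val_of_notMem hxD, ← h.contents_eq, Multiset.coe_eq_coe.2 bperm,
        ← Multiset.cons_coe, Multiset.cons_add]
    generalize hs1 : ({ s with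
      buffer := s.buffer.orderedInsert (· ≤ ·) x
      T0 := (s.T0.insert B x s.nextItem).ret
      T1 := (s.T1.insert B s.nextItem 0).ret
      nextItem := s.nextItem + 1 } : DynTree α) = s1
    have gf : s1.forest = s.forest := by rw [← hs1]
    have gt : s1.top = s.top := by rw [← hs1]
    have gb : s1.buffer = s.buffer.orderedInsert (· ≤ ·) x := by rw [← hs1]
    have gI : s1.Indexed B (insertPair x s.nextItem l0) (insertPair s.nextItem 0 l1) := by
      refine h.indexed.insert hB hxl (by rw [← hs1]) (by rw [← hs1]) (by rw [← hs1])
        (by rw [← hs1]) (fun k => ?_) ?_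
      · cases k with
        | zero =>
          rw [DynTree.level, DynTree.level, gb]
          exact List.Subset.trans (List.subset_cons_self x _) bperm.symm.subset
        | succ k =>
          rw [DynTree.level, DynTree.level, gf]
          exact List.Subset.refl _
      · rw [DynTree.level, gb]
        exact bperm.mem_iff.2 List.mem_cons_self
    have gtot : s1.total forestItems = s.total forestItems := by
      rw [DynTree.total, DynTree.total, gf, gt]
    have gS : s1.Shape B :=
      ⟨by rw [gf, gt]; exact h.shape.top_empty, by rw [gf]; exact h.shape.balanced,
        gtot ▸ h.shape.nodup⟩
    have gpot : s1.pot B (lg B (D.card + 1)) = s.pot B (lg B (D.card + 1)) := pot_congr gf gt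
    have glen : ∀ i, (s1.forest i).length < B := by rw [gf]; exact h.length_lt
    rw [← gb] at hcont bsorted bperm blen
    rw [← gtot] at hcont
    dsimp only
    split
    · rename_i hlt
      refine Runs.pure ⟨⟨_, _, gS, gI, glen, hlt, bsorted, hcont, hkeys⟩, ?_⟩
      rw [gpot]
      push_cast at hb ⊢
      linarith
    · rename_i hlt
      have hblen : s1.buffer.length = B := by
        have := h.buffer_length
        rw [List.length_cons] at blen
        omega
      refine Runs.bind (runs_build (h := 0) hB h4 x bsorted (by rw [hblen]; simp)
        (by rw [hblen, pow_zero]; omega)) fun t k1 ht => ?_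
      obtain ⟨ht, hk1⟩ := ht
      have hlen1' : (insertPair s.nextItem 0 l1).length = D.card + 1 := by
        rw [(insertPair_perm hn).length_eq, List.length_cons, hlen1]
      have hlen0' : (insertPair x s.nextItem l0).length = D.card + 1 := by
        rw [(insertPair_perm hxl).length_eq, List.length_cons, hlen0]
      have t4 := auxTime_le hB gI.rep1 hlen1'.le
        (gI.rep1.assignRange (s1.bound 0) s1.nextItem 1).2
      refine Runs.liftTimed_bind ?_
      generalize hs2 : ({ s1.setForest 0 (t :: s1.forest 0) with
        buffer := []
        T1 := (s1.T1.assignRange (s1.bound 0) s1.nextItem 1).ret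
        top := max s1.top 1
        bound := Function.update s1.bound 0 s1.nextItem } : DynTree α) = s2
      have f0 : s2.forest 0 = t :: s1.forest 0 := by
        rw [← hs2]
        exact setForest_forest_self s1 0 (t :: s1.forest 0)
      have f1 : ∀ j ∉ ({0} : Finset ℕ), s2.forest j = s1.forest j := by
        intro j hj
        rw [← hs2]
        exact setForest_forest_of_ne _ (by simpa using hj) _
      have ft : s2.top = max s1.top 1 := by rw [← hs2]
      have fb : s2.buffer = [] := by rw [← hs2]
      have htop : ∀ j, s2.top ≤ j → s2.forest j = [] := by
        intro j hj
        rw [ft] at hj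
        rw [f1 j (by simp only [Finset.mem_singleton]; omega)]
        exact gS.top_empty j (by omega)
      have htot : s2.total forestItems = ↑s1.buffer + s1.total forestItems := by
        have e1 := total_change forestItems_nil gS.top_empty htop {0} f1
        rw [Finset.sum_singleton, Finset.sum_singleton, f0] at e1
        have e2 : forestItems 0 (t :: s1.forest 0) =
            ↑s1.buffer + forestItems 0 (s1.forest 0) := by
          rw [forestItems, forestItems, List.flatMap_cons, ← Multiset.coe_add, ht.items_eq]
        rw [e2, ← add_assoc] at e1
        rw [add_right_cancel e1, add_comm]
      have hshape : s2.Shape B := by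
        refine ⟨htop, fun j => ?_, ?_⟩
        · rcases eq_or_ne j 0 with rfl | hj
          · rw [f0]
            exact List.forall_mem_cons.2 ⟨ht.balanced, gS.balanced 0⟩
          · rw [f1 j (by simpa using hj)]
            exact gS.balanced j
        · rw [htot, hcont]
          exact (Insert.insert x D).nodup
      have hpot := pot_change (B := B) (L := lg B (D.card + 1)) gS.top_empty htop {0} f1
      rw [Finset.sum_singleton, Finset.sum_singleton, f0] at hpot
      obtain ⟨l1', hI'⟩ := gI.moveUp (s' := s2) 0 (by rw [← hs2]; rfl) (by rw [← hs2]; rfl)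
        (by rw [← hs2]; rfl) (by rw [← hs2]; rfl)
        (by
          intro k hk
          cases k with
          | zero => exact absurd rfl hk
          | succ k =>
            rw [DynTree.level, DynTree.level]
            rcases eq_or_ne k 0 with rfl | hk'
            · rw [f0, List.flatMap_cons]
              exact List.subset_append_right _ _
            · rw [f1 k (by simpa using hk')]
              exact List.Subset.refl _)
        (by
          rw [DynTree.level, DynTree.level, f0, List.flatMap_cons, ht.items_eq]
          exact List.subset_append_left _ _)
      refine (runs_cascade hB h4 x hlen0'.le (s1.top + 1) 0 hshape hI' ?_ ?_ ?_).mono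
        fun s' k hs' => ?_
      · rw [f0, List.length_cons]
        exact glen 0
      · intro j hj
        rw [f1 j (by simpa using hj)]
        exact glen j
      · right
        omega
      · obtain ⟨l1'', hI''⟩ := hs'.indexed
        have hbe : s'.buffer = [] := hs'.buffer_eq.trans fb
        refine ⟨⟨_, l1'', hs'.shape, hI'', hs'.length_lt, ?_, ?_, ?_, hkeys⟩, ?_⟩
        · rw [hbe, List.length_nil]
          omega
        · rw [hbe]
          exact List.Pairwise.nil
        · rw [hbe, hs'.total_eq, htot, hcont]
          exact zero_add _
        · have hp := hs'.pot_le
          have e1 : forestPot B (lg B (D.card + 1)) 0 (t :: s1.forest 0) =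
              forestPot B (lg B (D.card + 1)) 0 (s1.forest 0) +
                treeConst B * (B * (lg B (D.card + 1) + 2) + lg B (D.card + 1)) := by
            have e2 : deficit B 0 t = 0 := rfl
            simp only [forestPot, List.map_cons, List.sum_cons, List.length_cons, e2]
            push_cast
            ring
          have e2 : (treeConst B : ℝ) * (B * (lg B (D.card + 1) + 2) + lg B (D.card + 1)) ≤
              treeConst B * (B * (2 * lg B D.card + 2 * (B * lg B D.card)) + 2 * lg B D.card) := by
            gcongr
            linarith
          have e3 : (treeConst B : ℝ) *
              (B * (2 * lg B D.card + 2 * (B * lg B D.card)) + 2 * lg B D.card) =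
              treeConst B * (2 * B * B + 2 * B + 2) * lg B D.card := by ring
          have e4 : (B : ℝ) * lg B (D.card + 1) ≤ B * (2 * lg B D.card) := by gcongr
          have e5 : (k1 : ℝ) ≤ 8 * B := by
            have : k1 ≤ 8 * B := by
              rw [zero_add, pow_one] at hk1
              omega
            exact_mod_cast this
          rw [e1] at hpot
          push_cast at hb ⊢
          linarith

end Insertion

/-! ### Sequences of operations -/

section Sequences

variable {α : Type} [LinearOrder α]

theorem stores_empty {B : ℕ} (hB : 4 ≤ B) :
    (DynTree.empty : DynTree α).Stores B ∅ [] [] where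
  shape := ⟨fun _ _ => rfl, fun _ _ ht => absurd ht List.not_mem_nil, Multiset.nodup_zero⟩
  indexed := ⟨AuxTree.represents_empty B, AuxTree.represents_empty B, List.Perm.nil,
    fun _ hp => absurd hp List.not_mem_nil, fun k => by cases k <;> exact le_rfl,
    fun _ _ _ hx => absurd hx List.not_mem_nil⟩
  length_lt _ := (show 0 < B by omega)
  buffer_length := (show 0 < B by omega)
  buffer_sorted := List.Pairwise.nil
  contents_eq := rfl
  keys_eq := rfl

theorem runs_ops {B : ℕ} (hB : 4 ≤ B) (h4 : 4 ∣ B) (ops : List (Op α)) :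
    Runs (ops.foldlM (step B) DynTree.empty) fun s k =>
      (∃ l0 l1, s.Stores B (dataset ops) l0 l1) ∧ k + s.pot B (lg B (dataset ops).card) ≤
        ((insertOpConst B + deleteOpConst B : ℕ) : ℝ) *
          ∑ t ∈ Finset.range ops.length, lg B (dataset (ops.take t)).card := by
  induction ops using List.reverseRecOn with
  | nil =>
    refine Runs.pure ⟨⟨[], [], stores_empty hB⟩, ?_⟩
    simp [DynTree.pot, DynTree.total, DynTree.empty]
  | append_singleton ops op ih =>
    rw [List.foldlM_append]
    refine Runs.bind ih fun s k hs => ?_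
    obtain ⟨⟨l0, l1, hs⟩, hk⟩ := hs
    have hdata : dataset (ops ++ [op]) = op.apply (dataset ops) := by
      rw [dataset, List.foldl_append]
      rfl
    have hsum : ∑ t ∈ Finset.range (ops ++ [op]).length,
        lg B (dataset ((ops ++ [op]).take t)).card =
        ∑ t ∈ Finset.range ops.length, lg B (dataset (ops.take t)).card +
          lg B (dataset ops).card := by
      rw [List.length_append, List.length_singleton, Finset.sum_range_succ, List.take_left]
      refine congrArg (· + _) (Finset.sum_congr rfl fun t ht => ?_)
      rw [List.take_append_of_le_length (Finset.mem_range.1 ht).le]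
    have hL := lg_nonneg hB (dataset ops).card
    have hstep : Runs (step B s op) fun s' k' =>
        (∃ l0' l1', s'.Stores B (op.apply (dataset ops)) l0' l1') ∧
        k' + s'.pot B (lg B (op.apply (dataset ops)).card) ≤ s.pot B (lg B (dataset ops).card) +
          ((insertOpConst B + deleteOpConst B : ℕ) : ℝ) * lg B (dataset ops).card := by
      have hI : (0 : ℝ) ≤ insertOpConst B * lg B (dataset ops).card := by positivity
      have hD : (0 : ℝ) ≤ deleteOpConst B * lg B (dataset ops).card := by positivity
      cases op with
      | insert x =>
        refine (runs_insert hB h4 x hs).mono fun s' k' h' => ⟨h'.1, h'.2.trans ?_⟩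
        push_cast
        linarith
      | delete x =>
        refine (runs_delete hB h4 x hs).mono fun s' k' h' => ⟨h'.1, h'.2.trans ?_⟩
        push_cast
        linarith
    rw [hdata, hsum]
    refine Runs.bind hstep fun s' k' h' => Runs.pure ⟨h'.1, ?_⟩
    have := h'.2
    push_cast at this hk ⊢
    linarith

end Sequences

end QBTree

theorem mainTheorem4 (B : ℕ) (hB : 4 ≤ B) (hpow : ∃ m : ℕ, B = 2 ^ m) :
    ∃ C : ℝ, ∀ (K R : Type) [LinearOrder K] [LinearOrder R] (ops : List (QBTree.Op (K ×ₗ R))),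
      (QBTree.finalTree B ops).Holds B (QBTree.dataset ops) ∧
      (QBTree.totalCost B ops : ℝ) ≤
        C * ∑ t ∈ Finset.range ops.length,
          Real.logb B (max 2 ((QBTree.dataset (ops.take t)).card : ℝ)) := by
  have h4 : 4 ∣ B := by
    obtain ⟨m, rfl⟩ := hpow
    have hm : 2 ≤ m := by
      by_contra h
      have : 2 ^ m ≤ 2 ^ 1 := Nat.pow_le_pow_right (by omega) (by omega)
      omega
    exact pow_dvd_pow 2 hm
  refine ⟨((QBTree.insertOpConst B + QBTree.deleteOpConst B : ℕ) : ℝ), fun K R _ _ ops => ?_⟩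
  obtain ⟨k, hk, ⟨l0, l1, hs⟩, hcost⟩ :=
    QBTree.runs_ops hB h4 ops ⟨fun _ => none, fun _ => none, 0, 0⟩
  have hfin : QBTree.finalTree B ops = (QBTree.exec
      (ops.foldlM (QBTree.step B) QBTree.DynTree.empty) ⟨fun _ => none, fun _ => none, 0, 0⟩).1 :=
    rfl
  have htot : QBTree.totalCost B ops = k := by
    refine Eq.trans ?_ (hk.trans (zero_add k))
    rfl
  rw [hfin, htot]
  refine ⟨hs.holds, ?_⟩
  -- the potential at the end is not negative and may be dropped
  have := hs.pot_nonneg hB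
  exact (le_add_of_nonneg_right this).trans hcost
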